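/- **Setting.** Let $\mathcal S,\mathcal U,\mathcal V$ be measurable spaces (e.g. topological spaces with their Borel $\sigma$-algebras) and let $k:\mathcal S\times\mathcal S\to\mathbb R$ be a measurable, symmetric, positive definite, bounded and characteristic kernel, i.e. the mean embedding $P\mapsto\mu_P:=\int k(\cdot,y)\,P(dy)$ is injective on probability measures. Put $$\mathrm{MMD}^2(P,Q)=E[k(X,X')]-2E[k(X,Y)]+E[k(Y,Y')],\qquad X,X'\sim P,\ Y,Y'\sim Q \text{ independent}.$$ Let $(X_i,U_i,V_i)_{i\ge1}$ be i.i.d. in $\mathcal S\times\mathcal U\times\mathcal V$, with $X_i\sim P$, $U_i\sim P_U$, $V_i\sim P_V$, where $(U_i)$ is independent of $(X_i)$ and $(V_i)$ is independent of $(X_i)$; $(U_i)$ and $(V_i)$ may be dependent. Let $\Theta_\alpha\subset\mathbb R^{p_\alpha}$ and $\Theta_\beta\subset\mathbb R^{p_\beta}$ be compact, let $F:\mathcal U\times\Theta_\alpha\to\mathcal S$ and $G:\mathcal V\times\Theta_\beta\to\mathcal S$ be measurable, and let $P_\alpha$ and $Q_\beta$ be the laws of $F(U;\alpha)$ and $G(V;\beta)$,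 where $(X,U,V)$ denotes a generic copy of $(X_i,U_i,V_i)$. Let $\alpha_\star$ and $\beta_\star$ be interior points of $\Theta_\alpha$ and $\Theta_\beta$, and let $\alpha_n$, $\beta_n$ be random vectors in $\Theta_\alpha$, $\Theta_\beta$. Throughout, $n$ is even and $n\to\infty$. **Notation.** For the first model let $$h^{(1)}(x_1,u_1,x_2,u_2;\alpha)=k(x_1,x_2)-k(x_1,F(u_2;\alpha))-k(x_2,F(u_1;\alpha))+k(F(u_1;\alpha),F(u_2;\alpha)),$$ $$q^{(1)}(x_1,u_1,\dots,x_4,u_4;\alpha)=k(x_1,x_3)-k(x_4,F(u_2;\alpha))-k(x_2,F(u_4;\alpha))+k(F(u_1;\alpha),F(u_3;\alpha)).$$ For a function $f$ of two arguments and $c\in\mathbb R$ put $$T_c f(a_1,a_2,a_3)=\tfrac c3\{f(a_1,a_2)f(a_1,a_3)+f(a_2,a_1)f(a_2,a_3)+f(a_3,a_2)f(a_3,a_1)\},$$ and let $g^{(1)}_\alpha=T_4h^{(1)}(\cdot;\alpha)$, where $h^{(1)}$ is a function of the two arguments $(x_1,u_1),(x_2,u_2)$. Define $h^{(2)},q^{(2)},g^{(2)}_\beta$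 in the same way for the second model, with $(G,v,\beta)$ in place of $(F,u,\alpha)$. Let $h_{\alpha,\beta}=h^{(1)}(\cdot;\alpha)-h^{(2)}(\cdot;\beta)$, a function of two triples $(x,u,v)$, and $q_{\alpha,\beta}=q^{(1)}(\cdot;\alpha)-q^{(2)}(\cdot;\beta)$, a function of two pairs of triples; let $g_{\alpha,\beta}=T_4h_{\alpha,\beta}$ and $\xi_{\alpha,\beta}=T_8q_{\alpha,\beta}$. Let $\mathcal U_n^{(1)}f$ be the U-statistic with kernel $f$ (the average of $f$ over all tuples of pairwise distinct indices) on the sample $Z_i=(X_i,U_i,V_i)$, $i\le n$, and $\mathcal U_n^{(2)}f$ the one on the sample of pairs $(Z_{2i-1},Z_{2i})$, $i\le n/2$. Define $$\widehat{\mathrm{MMD}^2}(P_\alpha,P)=\mathcal U^{(1)}_nh^{(1)}(\cdot;\alpha),\qquad \widehat{\mathrm{MMD}^2}_q(P_\alpha,P)=\mathcal U_n^{(2)}q^{(1)}(\cdot;\alpha),$$ and similarly for $Q_\beta$, and $$\hat\sigma^2_{\alpha,\beta}=\mathcal U_n^{(1)}g_{\alpha,\beta}-4\{\widehat{\mathrm{MMD}^2}(P_\alpha,P)-\widehat{\mathrm{MMD}^2}(Q_\beta,P)\}^2,$$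 $$\hat\sigma^2_{q,\alpha,\beta}=\mathcal U_n^{(2)}\xi_{\alpha,\beta}-8\{\widehat{\mathrm{MMD}^2}(P_\alpha,P)-\widehat{\mathrm{MMD}^2}(Q_\beta,P)\}^2,$$ $$\sigma^2_{\alpha,\beta}=\mathrm{Var}\big(2\,E[h_{\alpha,\beta}(Z_1,Z_2)\mid Z_1]\big),\qquad \sigma^2_{q,\alpha,\beta}=\mathrm{Var}\big(2\sqrt2\,E[q_{\alpha,\beta}((Z_1,Z_2),(Z_3,Z_4))\mid Z_1,Z_2]\big).$$ **Assumptions.** Assume the following for the first model, and the analogous conditions for the second one. * $\alpha\mapsto \mathrm{MMD}^2(P_\alpha,P)$ is $C^2$ in a neighbourhood of $\alpha_\star$, and $\int k(X,F(u;\alpha_\star))\,P_U(du)$ is not almost surely constant. * For all $x,u,\tilde u$, the maps $\alpha\mapsto k(x,F(u;\alpha))$ and $\alpha\mapsto k(F(u;\alpha),F(\tilde u;\alpha))$ are twice differentiable on the interior of $\Theta_\alpha$. * For some $\delta>0$, the suprema over $\alpha\in B_\delta(\alpha_\star)$ of the norms of the Hessians in $\alpha$ of $h^{(1)}$, $q^{(1)}$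 and $g^{(1)}_\alpha$, at independent arguments distributed as $P\otimes P_U$, have finite expectations; and for each of these three functions the gradient at $\alpha_\star$ and the expectation can be interchanged. Moreover, assume that the vector $$\sqrt n\begin{pmatrix}\widehat{\mathrm{MMD}^2}(P_{\alpha_\star},P)-\mathrm{MMD}^2(P_{\alpha_\star},P)\\ \widehat{\mathrm{MMD}^2}(Q_{\beta_\star},P)-\mathrm{MMD}^2(Q_{\beta_\star},P)\\ \widehat{\mathrm{MMD}^2}_q(P_{\alpha_\star},P)-\mathrm{MMD}^2(P_{\alpha_\star},P)\\ \widehat{\mathrm{MMD}^2}_q(Q_{\beta_\star},P)-\mathrm{MMD}^2(Q_{\beta_\star},P)\\ \alpha_n-\alpha_\star\\ \beta_n-\beta_\star\end{pmatrix}$$ converges in law to some $(Z^{(1)},Z^{(2)},Z^{(1)}_q,Z^{(2)}_q,V^{(1)},V^{(2)})$. If $\alpha_\star$ minimizes $\mathrm{MMD}^2(P_\alpha,P)$ over $\Theta_\alpha$, the component $\sqrt n(\alpha_n-\alpha_\star)$ is dropped from this requirement and it is only required that $\sqrt n(\alpha_n-\alpha_\star)=O_{\mathbb P}(1)$ (the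 term with $V^{(1)}$ below then vanishes); similarly for $\beta_\star$. **Conclusions.** (i) $\sqrt n\{\widehat{\mathrm{MMD}^2}(P_{\alpha_n},P)-\mathrm{MMD}^2(P_{\alpha_\star},P)-\widehat{\mathrm{MMD}^2}(Q_{\beta_n},P)+\mathrm{MMD}^2(Q_{\beta_\star},P)\}$ converges in law to $$W+\nabla_{\alpha^\top}\mathrm{MMD}^2(P_\alpha,P)|_{\alpha=\alpha_\star}V^{(1)}-\nabla_{\beta^\top}\mathrm{MMD}^2(Q_\beta,P)|_{\beta=\beta_\star}V^{(2)},$$ where $W:=Z^{(1)}-Z^{(2)}\sim\mathcal N(0,\sigma^2_{\alpha_\star,\beta_\star})$. Moreover, $\hat\sigma^2_{\alpha_n,\beta_n}\to\sigma^2_{\alpha_\star,\beta_\star}$ in probability. (ii) If $P_{\alpha_\star}=Q_{\beta_\star}=P$, then $\sigma^2_{\alpha_\star,\beta_\star}=0$, $\hat\sigma^2_{\alpha_n,\beta_n}=O_{\mathbb P}(n^{-1})$ and $\sqrt n\{\widehat{\mathrm{MMD}^2}(P_{\alpha_n},P)-\widehat{\mathrm{MMD}^2}(Q_{\beta_n},P)\}=O_{\mathbb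 P}(n^{-1/2})$. (iii) $\sqrt n\{\widehat{\mathrm{MMD}^2}_q(P_{\alpha_n},P)-\mathrm{MMD}^2(P_{\alpha_\star},P)-\widehat{\mathrm{MMD}^2}_q(Q_{\beta_n},P)+\mathrm{MMD}^2(Q_{\beta_\star},P)\}$ converges in law to $$W_q+\nabla_{\alpha^\top}\mathrm{MMD}^2(P_\alpha,P)|_{\alpha=\alpha_\star}V^{(1)}-\nabla_{\beta^\top}\mathrm{MMD}^2(Q_\beta,P)|_{\beta=\beta_\star}V^{(2)},$$ where $W_q:=Z^{(1)}_q-Z^{(2)}_q\sim\mathcal N(0,\sigma^2_{q,\alpha_\star,\beta_\star})$. Moreover, $\hat\sigma^2_{q,\alpha_n,\beta_n}\to\sigma^2_{q,\alpha_\star,\beta_\star}$ in probability. If the samples $(U_i)$ and $(V_i)$ are independent, then $\sigma^2_{q,\alpha_\star,\beta_\star}>0$, except possibly in the degenerate case where the five random variables $\mu_P(F(U;\alpha_\star))$, $\mu_P(G(V;\beta_\star))$, $\mu_{P_{\alpha_\star}}(F(U;\alpha_\star))$, $\mu_{Q_{\beta_\star}}(G(V;\beta_\star))$ and $\mu_{P_{\alpha_\star}}(X)-\mu_{Q_{\beta_\star}}(X)$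 are all almost surely constant. In particular, it is positive if $(U_i)$ and $(V_i)$ are independent and $P$ is absolutely continuous with respect to $P_{\alpha_\star}$ or to $Q_{\beta_\star}$ (for instance if $P_{\alpha_\star}=P$ or $Q_{\beta_\star}=P$). -/

import Mathlib

open MeasureTheory ProbabilityTheory Filter Topology

noncomputable section

namespace MMDComparison

/-! ### Kernels, mean embeddings, squared MMD -/

section Kernel

variable {S : Type*} [MeasurableSpace S]

/-- The mean embedding `x ↦ ∫ k(x, y) P(dy)` of `P`, as a function on the sample space. -/
def meanEmbed (k : S → S → ℝ) (P : Measure S) (x : S) : ℝ := ∫ y, k x y ∂P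

/-- `MMD²(P, Q) = E[k(X, X')] - 2 E[k(X, Y)] + E[k(Y, Y')]`, with independent
`X, X' ∼ P` and `Y, Y' ∼ Q`. -/
def mmdSq (k : S → S → ℝ) (P Q : Measure S) : ℝ :=
  (∫ x, ∫ x', k x x' ∂P ∂P) - 2 * (∫ x, ∫ y, k x y ∂Q ∂P) + ∫ y, ∫ y', k y y' ∂Q ∂Q

/-- `k` is measurable, symmetric, positive definite (in the sense of reproducing kernels),
bounded, and characteristic: the mean embedding is injective on probability measures (elements
of the reproducing kernel Hilbert space of `k` are functions on `S`, so that two of them are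
equal iff they are equal as functions). -/
structure CharacteristicKernel (k : S → S → ℝ) : Prop where
  measurable : Measurable (fun z : S × S => k z.1 z.2)
  symm : ∀ x y, k x y = k y x
  posDef : ∀ (n : ℕ) (x : Fin n → S) (c : Fin n → ℝ),
    0 ≤ ∑ i, ∑ j, c i * c j * k (x i) (x j)
  bounded : ∃ C : ℝ, ∀ x y, |k x y| ≤ C
  characteristic : ∀ P Q : Measure S, IsProbabilityMeasure P → IsProbabilityMeasure Q →
    meanEmbed k P = meanEmbed k Q → P = Q

end Kernel

/-! ### Kernels of the U-statistics -/

section UKernels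

variable {S 𝒰 𝒱 E E' Z : Type*}

/-- `h((x₁,y₁),(x₂,y₂)) = k(x₁,x₂) - k(x₁,y₂) - k(x₂,y₁) + k(y₁,y₂)`. -/
def hKer (k : S → S → ℝ) (a b : S × S) : ℝ :=
  k a.1 b.1 - k a.1 b.2 - k b.1 a.2 + k a.2 b.2

/-- `q((x₁,y₁,x₂,y₂),(x₃,y₃,x₄,y₄)) = k(x₁,x₃) - k(x₄,y₂) - k(x₂,y₄) + k(y₁,y₃)`. -/
def qKer (k : S → S → ℝ) (a b : (S × S) × (S × S)) : ℝ :=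
  k a.1.1 b.1.1 - k b.2.1 a.2.2 - k a.2.1 b.2.2 + k a.1.2 b.1.2

/-- `(x, u) ↦ (x, F(u; α))`. -/
def gen (F : 𝒰 → E → S) (α : E) (a : S × 𝒰) : S × S := (a.1, F a.2 α)

/-- `h(x₁,u₁,x₂,u₂;α)`, as a function of `(x₁,u₁)` and `(x₂,u₂)`. -/
def h (k : S → S → ℝ) (F : 𝒰 → E → S) (α : E) (a b : S × 𝒰) : ℝ :=
  hKer k (gen F α a) (gen F α b)

/-- `q(x₁,u₁,x₂,u₂,x₃,u₃,x₄,u₄;α)`, as a function of `((x₁,u₁),(x₂,u₂))` and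
`((x₃,u₃),(x₄,u₄))`. -/
def q (k : S → S → ℝ) (F : 𝒰 → E → S) (α : E) (a b : (S × 𝒰) × (S × 𝒰)) : ℝ :=
  qKer k (gen F α a.1, gen F α a.2) (gen F α b.1, gen F α b.2)

/-- The symmetric kernel of three arguments
`(c / 3) { f(a₁,a₂) f(a₁,a₃) + f(a₂,a₁) f(a₂,a₃) + f(a₃,a₂) f(a₃,a₁) }`. -/
def triple (c : ℝ) (f : Z → Z → ℝ) (a₁ a₂ a₃ : Z) : ℝ :=
  c / 3 * (f a₁ a₂ * f a₁ a₃ + f a₂ a₁ * f a₂ a₃ + f a₃ a₂ * f a₃ a₁)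

/-- `g_α`. -/
def g (k : S → S → ℝ) (F : 𝒰 → E → S) (α : E) : S × 𝒰 → S × 𝒰 → S × 𝒰 → ℝ :=
  triple 4 (h k F α)

/-- `(x, u, v) ↦ (x, u)`. -/
def fstModel (a : S × 𝒰 × 𝒱) : S × 𝒰 := (a.1, a.2.1)

/-- `(x, u, v) ↦ (x, v)`. -/
def sndModel (a : S × 𝒰 × 𝒱) : S × 𝒱 := (a.1, a.2.2)

/-- `h(x₁,u₁,v₁,x₂,u₂,v₂;α,β) = h⁽¹⁾(x₁,u₁,x₂,u₂;α) - h⁽²⁾(x₁,v₁,x₂,v₂;β)`. -/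
def hDiff (k : S → S → ℝ) (F : 𝒰 → E → S) (G : 𝒱 → E' → S) (α : E) (β : E')
    (a b : S × 𝒰 × 𝒱) : ℝ :=
  h k F α (fstModel a) (fstModel b) - h k G β (sndModel a) (sndModel b)

/-- `q(x₁,u₁,v₁,…,x₄,u₄,v₄;α,β) = q⁽¹⁾(x₁,u₁,…,x₄,u₄;α) - q⁽²⁾(x₁,v₁,…,x₄,v₄;β)`. -/
def qDiff (k : S → S → ℝ) (F : 𝒰 → E → S) (G : 𝒱 → E' → S) (α : E) (β : E')
    (a b : (S × 𝒰 × 𝒱) × (S × 𝒰 × 𝒱)) : ℝ :=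
  q k F α (fstModel a.1, fstModel a.2) (fstModel b.1, fstModel b.2)
    - q k G β (sndModel a.1, sndModel a.2) (sndModel b.1, sndModel b.2)

/-- `g_{α,β}`. -/
def gDiff (k : S → S → ℝ) (F : 𝒰 → E → S) (G : 𝒱 → E' → S) (α : E) (β : E') :
    S × 𝒰 × 𝒱 → S × 𝒰 × 𝒱 → S × 𝒰 × 𝒱 → ℝ :=
  triple 4 (hDiff k F G α β)

/-- `ξ_{α,β}`, as a function of three consecutive pairs of observations. -/
def xiDiff (k : S → S → ℝ) (F : 𝒰 → E → S) (G : 𝒱 → E' → S) (α : E) (β : E') :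
    (S × 𝒰 × 𝒱) × (S × 𝒰 × 𝒱) → (S × 𝒰 × 𝒱) × (S × 𝒰 × 𝒱) →
      (S × 𝒰 × 𝒱) × (S × 𝒰 × 𝒱) → ℝ :=
  triple 8 (qDiff k F G α β)

end UKernels

/-! ### U-statistics and estimators

Samples are indexed from `0`: the observations of index `1, …, n` in mathematical notation are
`z 0, …, z (n - 1)`. -/

section UStatistics

variable {S 𝒰 𝒱 E E' Z : Type*}

/-- `(1 / (m (m-1))) ∑_{i ≠ j} f(zᵢ, zⱼ)`, over the first `m` entries of `z`. -/
def ustat₂ (f : Z → Z → ℝ) (m : ℕ) (z : ℕ → Z) : ℝ :=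
  1 / ((m : ℝ) * ((m : ℝ) - 1)) *
    ∑ i ∈ Finset.range m, ∑ j ∈ Finset.range m, if i ≠ j then f (z i) (z j) else 0

/-- `(1 / (m (m-1) (m-2))) ∑_{i, j, l distinct} f(zᵢ, zⱼ, z_l)`, over the first `m` entries. -/
def ustat₃ (f : Z → Z → Z → ℝ) (m : ℕ) (z : ℕ → Z) : ℝ :=
  1 / ((m : ℝ) * ((m : ℝ) - 1) * ((m : ℝ) - 2)) *
    ∑ i ∈ Finset.range m, ∑ j ∈ Finset.range m, ∑ l ∈ Finset.range m,
      if i ≠ j ∧ i ≠ l ∧ l ≠ j then f (z i) (z j) (z l) else 0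

/-- The sample of consecutive pairs `(z₁, z₂), (z₃, z₄), …`. -/
def pairs (z : ℕ → Z) (i : ℕ) : Z × Z := (z (2 * i), z (2 * i + 1))

/-- `MMD²-hat(P_α, P)` from `(xᵢ, uᵢ)`, `i ≤ n`. -/
def mmdHat (k : S → S → ℝ) (F : 𝒰 → E → S) (α : E) (n : ℕ) (z : ℕ → S × 𝒰) : ℝ :=
  ustat₂ (h k F α) n z

/-- The split-sample estimator `MMD²-hat_q(P_α, P)` from `(xᵢ, uᵢ)`, `i ≤ n`, for even `n`. -/
def mmdHatSplit (k : S → S → ℝ) (F : 𝒰 → E → S) (α : E) (n : ℕ) (z : ℕ → S × 𝒰) : ℝ :=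
  ustat₂ (q k F α) (n / 2) (pairs z)

/-- `σ̂²_{α,β}`. -/
def sigmaHatSq (k : S → S → ℝ) (F : 𝒰 → E → S) (G : 𝒱 → E' → S) (α : E) (β : E')
    (n : ℕ) (z : ℕ → S × 𝒰 × 𝒱) : ℝ :=
  ustat₃ (gDiff k F G α β) n z
    - 4 * (mmdHat k F α n (fun i => fstModel (z i))
        - mmdHat k G β n (fun i => sndModel (z i))) ^ 2

/-- `σ̂²_{q,α,β}`, for even `n`. -/
def sigmaHatSqSplit (k : S → S → ℝ) (F : 𝒰 → E → S) (G : 𝒱 → E' → S) (α : E) (β : E')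
    (n : ℕ) (z : ℕ → S × 𝒰 × 𝒱) : ℝ :=
  ustat₃ (xiDiff k F G α β) (n / 2) (pairs z)
    - 8 * (mmdHat k F α n (fun i => fstModel (z i))
        - mmdHat k G β n (fun i => sndModel (z i))) ^ 2

end UStatistics

/-! ### Asymptotic variances -/

section Variances

variable {S 𝒰 𝒱 E E' : Type*} [MeasurableSpace S] [MeasurableSpace 𝒰] [MeasurableSpace 𝒱]

/-- `σ²_{α,β} = Var(2 E_{X₂,U₂,V₂}[h⁽¹⁾(X₁,U₁,X₂,U₂;α) - h⁽²⁾(X₁,V₁,X₂,V₂;β)])`, where `ρ` is the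
law of `(X, U, V)`. -/
def sigmaSq (k : S → S → ℝ) (F : 𝒰 → E → S) (G : 𝒱 → E' → S) (α : E) (β : E')
    (ρ : Measure (S × 𝒰 × 𝒱)) : ℝ :=
  variance (fun a => 2 * ∫ b, hDiff k F G α β a b ∂ρ) ρ

/-- `σ²_{q,α,β} = Var(2√2 E_{X₃,X₄,U₃,U₄,V₃,V₄}[q⁽¹⁾(…;α) - q⁽²⁾(…;β)])`, where `ρ` is the law of
`(X, U, V)`. -/
def sigmaSqSplit (k : S → S → ℝ) (F : 𝒰 → E → S) (G : 𝒱 → E' → S) (α : E) (β : E')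
    (ρ : Measure (S × 𝒰 × 𝒱)) : ℝ :=
  variance (fun a => 2 * √2 * ∫ b, qDiff k F G α β a b ∂(ρ.prod ρ)) (ρ.prod ρ)

end Variances

/-! ### Assumptions on one parametric model -/

section Model

variable {S 𝒰 : Type*} [MeasurableSpace S] [MeasurableSpace 𝒰]
  {E : Type*} [NormedAddCommGroup E] [NormedSpace ℝ E] [MeasurableSpace E]

/-- `P_α`, the law of `F(U; α)` for `U ∼ PU`. -/
def modelLaw (F : 𝒰 → E → S) (PU : Measure 𝒰) (α : E) : Measure S :=
  PU.map (fun u => F u α)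

/-- The function `f` is almost surely constant under `m`. -/
def AEConst {T : Type*} [MeasurableSpace T] (f : T → ℝ) (m : Measure T) : Prop :=
  ∃ c : ℝ, ∀ᵐ x ∂m, f x = c

/-- Regular parametric model with generating function `F`. -/
structure RegularModel (k : S → S → ℝ) (P : Measure S) (PU : Measure 𝒰) (F : 𝒰 → E → S)
    (Θ : Set E) (αs : E) : Prop where
  isCompact : IsCompact Θ
  mem_interior : αs ∈ interior Θ
  measurable : Measurable (fun z : 𝒰 × Θ => F z.1 z.2)
  contDiffAt : ContDiffAt ℝ 2 (fun α => mmdSq k (modelLaw F PU α) P) αs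
  not_aeConst : ¬ AEConst (fun x => ∫ u, k x (F u αs) ∂PU) P

/-- `f` is twice differentiable on the open set `s`. -/
def TwiceDiffOn (f : E → ℝ) (s : Set E) : Prop :=
  DifferentiableOn ℝ f s ∧ DifferentiableOn ℝ (fderiv ℝ f) s

/-- `α ↦ k(x, F(u;α))` and `α ↦ k(F(u;α), F(u';α))` are twice differentiable. -/
structure DiffGenerator (k : S → S → ℝ) (F : 𝒰 → E → S) (Θ : Set E) : Prop where
  left : ∀ x u, TwiceDiffOn (fun α => k x (F u α)) (interior Θ)
  both : ∀ u u', TwiceDiffOn (fun α => k (F u α) (F u' α)) (interior Θ)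

/-- `E[sup_{α ∈ B_δ(αs)} ‖∇² f(z; α)‖] < ∞`, for `z ∼ ν`; the supremum is
(almost everywhere) measurable. -/
def HessianDominated {T : Type*} [MeasurableSpace T] (f : E → T → ℝ) (ν : Measure T)
    (αs : E) (δ : ℝ) : Prop :=
  AEMeasurable
    (fun z => ⨆ α ∈ Metric.ball αs δ, ‖fderiv ℝ (fderiv ℝ (fun a => f a z)) α‖ₑ) ν ∧
  ∫⁻ z, (⨆ α ∈ Metric.ball αs δ, ‖fderiv ℝ (fderiv ℝ (fun a => f a z)) α‖ₑ) ∂ν < ⊤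

/-- `E[∇ f(z; αs)] = ∇ E[f(z; αs)]`, for `z ∼ ν`, both sides being well defined. -/
def GradientInterchange {T : Type*} [MeasurableSpace T] (f : E → T → ℝ) (ν : Measure T)
    (αs : E) : Prop :=
  Integrable (fun z => fderiv ℝ (fun a => f a z) αs) ν ∧
  HasFDerivAt (fun a => ∫ z, f a z ∂ν) (∫ z, fderiv ℝ (fun a => f a z) αs ∂ν) αs

/-- Moment conditions on the second derivatives of `h`, `q`, `g` on a ball included in `Θ`, and
interchange of derivatives and expectations at `αs`. Here `ν = P ⊗ PU` is the law of `(X, U)`. -/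
structure ResidualDeriv (k : S → S → ℝ) (P : Measure S) (PU : Measure 𝒰) (F : 𝒰 → E → S)
    (Θ : Set E) (αs : E) : Prop where
  hessian : ∃ δ : ℝ, 0 < δ ∧ Metric.ball αs δ ⊆ Θ ∧
    HessianDominated (fun α (z : (S × 𝒰) × (S × 𝒰)) => h k F α z.1 z.2)
      ((P.prod PU).prod (P.prod PU)) αs δ ∧
    HessianDominated
      (fun α (z : ((S × 𝒰) × (S × 𝒰)) × ((S × 𝒰) × (S × 𝒰))) => q k F α z.1 z.2)
      (((P.prod PU).prod (P.prod PU)).prod ((P.prod PU).prod (P.prod PU))) αs δ ∧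
    HessianDominated (fun α (z : (S × 𝒰) × (S × 𝒰) × (S × 𝒰)) => g k F α z.1 z.2.1 z.2.2)
      ((P.prod PU).prod ((P.prod PU).prod (P.prod PU))) αs δ
  gradient_h : GradientInterchange (fun α (z : (S × 𝒰) × (S × 𝒰)) => h k F α z.1 z.2)
    ((P.prod PU).prod (P.prod PU)) αs
  gradient_q : GradientInterchange
    (fun α (z : ((S × 𝒰) × (S × 𝒰)) × ((S × 𝒰) × (S × 𝒰))) => q k F α z.1 z.2)
    (((P.prod PU).prod (P.prod PU)).prod ((P.prod PU).prod (P.prod PU))) αs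
  gradient_g : GradientInterchange
    (fun α (z : (S × 𝒰) × (S × 𝒰) × (S × 𝒰)) => g k F α z.1 z.2.1 z.2.2)
    ((P.prod PU).prod ((P.prod PU).prod (P.prod PU))) αs

/-- `αs` minimizes `α ↦ MMD²(P_α, P)` over `Θ`. -/
def Minimizes (k : S → S → ℝ) (P : Measure S) (PU : Measure 𝒰) (F : 𝒰 → E → S)
    (Θ : Set E) (αs : E) : Prop :=
  IsMinOn (fun α => mmdSq k (modelLaw F PU α) P) Θ αs

end Model

/-! ### Sampling scheme and stochastic orders -/

section Sampling

variable {Ω S 𝒰 𝒱 : Type*} [MeasurableSpace Ω] [MeasurableSpace S] [MeasurableSpace 𝒰]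
  [MeasurableSpace 𝒱]

/-- The vectors `(Xᵢ, Uᵢ, Vᵢ)` are i.i.d. with law `ρ`, with marginals `P`, `PU`, `PV`; the samples
`(Uᵢ)` and `(Vᵢ)` are each independent of `(Xᵢ)`, but possibly dependent on each other. -/
structure Sampling (μ : Measure Ω) (X : ℕ → Ω → S) (U : ℕ → Ω → 𝒰) (V : ℕ → Ω → 𝒱)
    (ρ : Measure (S × 𝒰 × 𝒱)) (P : Measure S) (PU : Measure 𝒰) (PV : Measure 𝒱) : Prop where
  measurable_X : ∀ i, Measurable (X i)
  measurable_U : ∀ i, Measurable (U i)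
  measurable_V : ∀ i, Measurable (V i)
  law : ∀ i, μ.map (fun ω => (X i ω, U i ω, V i ω)) = ρ
  law_X : ∀ i, μ.map (X i) = P
  law_U : ∀ i, μ.map (U i) = PU
  law_V : ∀ i, μ.map (V i) = PV
  iIndep : iIndepFun (fun i ω => (X i ω, U i ω, V i ω)) μ
  indep_U : IndepFun (fun ω i => X i ω) (fun ω i => U i ω) μ
  indep_V : IndepFun (fun ω i => X i ω) (fun ω i => V i ω) μ

/-- `Y n = O_ℙ(r n)` along the filter `l`. -/
def IsBigOP {E : Type*} [Norm E] (μ : Measure Ω) (l : Filter ℕ) (Y : ℕ → Ω → E) (r : ℕ → ℝ) :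
    Prop :=
  ∀ ε : ℝ, 0 < ε → ∃ M : ℝ, ∀ᶠ n in l, μ {ω | M * r n < ‖Y n ω‖} ≤ ENNReal.ofReal ε

/-- `n → ∞` through the even integers. -/
def evenAtTop : Filter ℕ := atTop ⊓ 𝓟 {n | Even n}

open Classical in
/-- `0` if `p` holds, and `v` otherwise. -/
def zeroIf {E : Type*} [Zero E] (p : Prop) (v : E) : E := if p then 0 else v

end Sampling

end MMDComparison

end

/-! Every estimator of the MMD here is a U-statistic of order two, on the sample or on the sample of
consecutive pairs, and its kernel is bounded because `k` is. The proof combines an expansion in the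
sample with an expansion in the parameter.

Sample. Hoeffding's decomposition writes a U-statistic as its mean, plus a normalized sum of i.i.d.
projections, plus a degenerate remainder. In the remainder the terms of essentially distinct pairs
are orthogonal, so that it is `O_ℙ(1 / n)`; the central limit theorem
`IIDSample.tendstoInDistribution_ustat₂` follows. Applied to the difference kernels `hDiff` and
`qDiff`, it identifies the laws of W and W_q, since the limits exist by assumption and limits in law
are unique.

Parameter. By Taylor's inequality, the U-statistic at α_n is the one at α⋆, plus the U-statistic of
the gradient applied to α_n - α⋆, plus a remainder bounded by ‖α_n - α⋆‖² times the U-statistic of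
the Hessian bound. With α_n - α⋆ of order n^(-1/2), the remainder is `O_ℙ(1 / n)`. Replacing the
averaged gradient by ∇MMD² costs another `O_ℙ(1 / n)` as soon as the gradient is square integrable.
This is where boundedness of the kernel enters: by Landau's inequality the squared gradient of a
bounded function is at most a constant times 1 + sup ‖Hessian‖, which is integrable. The result is
`SmoothFamily.isBigOP_ustat₂_sub_sub`, and the continuous mapping theorem concludes. At a minimizer
the gradient of MMD² vanishes, so only the rate of α_n matters.

Variance estimators. Up to normalization and a diagonal of lower order, the U-statistic of `triple c
f` is the sum of the squared row sums of the matrix f(zᵢ, zⱼ) (`ustat₃_triple_eq`). By orthogonality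
within a row, the row sums are close in ℓ² to multiples of the projections; estimating the parameter
moves the matrix by `O_ℙ(1 / n)` in mean square, again by Landau's inequality. This gives
consistency, and the rate 1 / n when the projection vanishes. The latter happens in (ii), where
moreover α⋆ and β⋆ are minimizers because MMD² is nonnegative.

Positivity in (iii). The indices in `q` are arranged so that the projection of `qDiff` is a sum of
functions of U₁, V₁, U₂, V₂ and X₂ separately. If (Uᵢ) and (Vᵢ) are independent, these five terms
are pairwise independent, so a vanishing variance makes each of them constant. -/

namespace MMDComparison

/-! ### Stochastic orders -/

section StochasticOrders

variable {Ω : Type*} [MeasurableSpace Ω] {μ : Measure Ω} {l : Filter ℕ}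
  {E E' : Type*} [SeminormedAddGroup E] [SeminormedAddGroup E']

/-- In the definition of `O_ℙ`, the constant may be taken positive. -/
theorem IsBigOP.exists_pos {Y : ℕ → Ω → E} {r : ℕ → ℝ} (h : IsBigOP μ l Y r) (hr : ∀ n, 0 ≤ r n)
    {ε : ℝ} (hε : 0 < ε) :
    ∃ M : ℝ, 0 < M ∧ ∀ᶠ n in l, μ {ω | M * r n < ‖Y n ω‖} ≤ ENNReal.ofReal ε := by
  obtain ⟨M, hM⟩ := h ε hε
  refine ⟨max M 1, by positivity, hM.mono fun n hn => le_trans (measure_mono ?_) hn⟩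
  intro ω hω
  exact lt_of_le_of_lt (mul_le_mul_of_nonneg_right (le_max_left _ _) (hr n)) hω

/-- The domination may fail on events of vanishing probability: half of ε pays for them. This allows
localization to the event that the estimated parameter is close to its limit. -/
theorem IsBigOP.of_norm_le_off {Y : ℕ → Ω → E} {Y' : ℕ → Ω → E'} {r : ℕ → ℝ}
    (h : IsBigOP μ l Y' r)
    (hY : Tendsto (fun n => μ {ω | ¬ ‖Y n ω‖ ≤ ‖Y' n ω‖}) l (𝓝 0)) : IsBigOP μ l Y r := by
  intro ε hε
  obtain ⟨M, hM⟩ := h (ε / 2) (by positivity)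
  refine ⟨M, ?_⟩
  have h2 : ∀ᶠ n in l, μ {ω | ¬ ‖Y n ω‖ ≤ ‖Y' n ω‖} ≤ ENNReal.ofReal (ε / 2) :=
    hY.eventually_le_const (by simpa using hε)
  filter_upwards [hM, h2] with n h1 h2
  calc μ {ω | M * r n < ‖Y n ω‖}
      ≤ μ ({ω | M * r n < ‖Y' n ω‖} ∪ {ω | ¬ ‖Y n ω‖ ≤ ‖Y' n ω‖}) := by
        refine measure_mono fun ω hω => ?_
        by_cases hc : ‖Y n ω‖ ≤ ‖Y' n ω‖
        · exact Or.inl (lt_of_lt_of_le hω hc)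
        · exact Or.inr hc
    _ ≤ _ := measure_union_le _ _
    _ ≤ ENNReal.ofReal (ε / 2) + ENNReal.ofReal (ε / 2) := add_le_add h1 h2
    _ = ENNReal.ofReal ε := by
        rw [← ENNReal.ofReal_add (by positivity) (by positivity), add_halves]

theorem IsBigOP.of_ae_norm_le {Y : ℕ → Ω → E} {Y' : ℕ → Ω → E'} {r : ℕ → ℝ}
    (h : IsBigOP μ l Y' r) (hY : ∀ᶠ n in l, ∀ᵐ ω ∂μ, ‖Y n ω‖ ≤ ‖Y' n ω‖) : IsBigOP μ l Y r :=
  h.of_norm_le_off <| tendsto_const_nhds.congr' <| hY.mono fun _ hn => (ae_iff.1 hn).symm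

theorem IsBigOP.of_norm_le_off_ae {Y : ℕ → Ω → E} {Y' : ℕ → Ω → E'} {r : ℕ → ℝ}
    {bad : ℕ → Set Ω} (h : IsBigOP μ l Y' r) (hbad : Tendsto (fun n => μ (bad n)) l (𝓝 0))
    (hY : ∀ᶠ n in l, ∀ᵐ ω ∂μ, ω ∉ bad n → ‖Y n ω‖ ≤ ‖Y' n ω‖) : IsBigOP μ l Y r := by
  refine h.of_norm_le_off (tendsto_of_tendsto_of_tendsto_of_le_of_le' tendsto_const_nhds hbad
    (Eventually.of_forall fun _ => zero_le) ?_)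
  filter_upwards [hY] with n hn
  refine measure_mono_ae ?_
  filter_upwards [hn] with ω hω hc
  by_contra hb
  exact hc (hω hb)

theorem IsBigOP.add {Y Y' : ℕ → Ω → E} {r : ℕ → ℝ}
    (h : IsBigOP μ l Y r) (h' : IsBigOP μ l Y' r) :
    IsBigOP μ l (fun n ω => Y n ω + Y' n ω) r := by
  intro ε hε
  obtain ⟨M, hM⟩ := h (ε / 2) (by positivity)
  obtain ⟨M', hM'⟩ := h' (ε / 2) (by positivity)
  refine ⟨M + M', ?_⟩
  filter_upwards [hM, hM'] with n h1 h2
  calc μ {ω | (M + M') * r n < ‖Y n ω + Y' n ω‖}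
      ≤ μ ({ω | M * r n < ‖Y n ω‖} ∪ {ω | M' * r n < ‖Y' n ω‖}) := by
        refine measure_mono fun ω hω => ?_
        by_contra hc
        simp only [Set.mem_union, Set.mem_ofPred_eq, not_or, not_lt] at hc hω
        have := norm_add_le (Y n ω) (Y' n ω)
        linarith [hc.1, hc.2]
    _ ≤ _ := measure_union_le _ _
    _ ≤ ENNReal.ofReal (ε / 2) + ENNReal.ofReal (ε / 2) := add_le_add h1 h2
    _ = ENNReal.ofReal ε := by
        rw [← ENNReal.ofReal_add (by positivity) (by positivity), add_halves]

theorem IsBigOP.sum {ι : Type*} (s : Finset ι) {Y : ι → ℕ → Ω → ℝ} {r : ℕ → ℝ}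
    (h : ∀ i ∈ s, IsBigOP μ l (Y i) r) :
    IsBigOP μ l (fun n ω => ∑ i ∈ s, Y i n ω) r := by
  classical
  induction s using Finset.induction_on with
  | empty =>
    intro ε hε
    refine ⟨0, Eventually.of_forall fun n => ?_⟩
    simp
  | insert a s ha ih =>
    simp_rw [Finset.sum_insert ha]
    exact (h a (Finset.mem_insert_self _ _)).add
      (ih fun i hi => h i (Finset.mem_insert_of_mem hi))

theorem IsBigOP.mul {Y Y' : ℕ → Ω → ℝ} {r s : ℕ → ℝ} (hr : ∀ n, 0 ≤ r n)
    (hs : ∀ n, 0 ≤ s n) (h : IsBigOP μ l Y r) (h' : IsBigOP μ l Y' s) :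
    IsBigOP μ l (fun n ω => Y n ω * Y' n ω) (fun n => r n * s n) := by
  intro ε hε
  obtain ⟨M, hM0, hM⟩ := h.exists_pos hr (half_pos hε)
  obtain ⟨M', hM0', hM'⟩ := h'.exists_pos hs (half_pos hε)
  refine ⟨M * M', ?_⟩
  filter_upwards [hM, hM'] with n h1 h2
  calc μ {ω | M * M' * (r n * s n) < ‖Y n ω * Y' n ω‖}
      ≤ μ ({ω | M * r n < ‖Y n ω‖} ∪ {ω | M' * s n < ‖Y' n ω‖}) := by
        refine measure_mono fun ω hω => ?_
        by_contra hc
        simp only [Set.mem_union, Set.mem_ofPred_eq, not_or, not_lt] at hc hω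
        rw [norm_mul] at hω
        have := mul_le_mul hc.1 hc.2 (norm_nonneg _) (mul_nonneg hM0.le (hr n))
        linarith
    _ ≤ _ := measure_union_le _ _
    _ ≤ ENNReal.ofReal (ε / 2) + ENNReal.ofReal (ε / 2) := add_le_add h1 h2
    _ = ENNReal.ofReal ε := by
        rw [← ENNReal.ofReal_add (by positivity) (by positivity), add_halves]

theorem IsBigOP.const_mul {Y : ℕ → Ω → ℝ} {r : ℕ → ℝ} (h : IsBigOP μ l Y r) (c : ℝ) :
    IsBigOP μ l (fun n ω => c * Y n ω) r := by
  intro ε hε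
  obtain ⟨M, hM⟩ := h ε hε
  refine ⟨|c| * M, hM.mono fun n hn => le_trans (measure_mono fun ω hω => ?_) hn⟩
  simp only [Set.mem_ofPred_eq, norm_mul, Real.norm_eq_abs] at hω ⊢
  rw [mul_assoc] at hω
  exact lt_of_mul_lt_mul_left hω (abs_nonneg c)

/-- Used to pass between the rates in n and in n / 2, and to simplify products of rates. -/
theorem IsBigOP.congr_rate {Y : ℕ → Ω → E} {r s : ℕ → ℝ} (h : IsBigOP μ l Y r) {c : ℝ}
    (hrs : ∀ᶠ n in l, r n = c * s n) : IsBigOP μ l Y s := by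
  intro ε hε
  obtain ⟨M, hM⟩ := h ε hε
  refine ⟨M * c, ?_⟩
  filter_upwards [hM, hrs] with n hn h2
  rwa [mul_assoc, ← h2]

theorem IsBigOP.sqrt {Y : ℕ → Ω → ℝ} {r : ℕ → ℝ} (hr : ∀ n, 0 ≤ r n) (h : IsBigOP μ l Y r) :
    IsBigOP μ l (fun n ω => √(Y n ω)) (fun n => √(r n)) := by
  intro ε hε
  obtain ⟨M, hM0, hM⟩ := h.exists_pos hr hε
  refine ⟨√M, hM.mono fun n hn => le_trans (measure_mono fun ω hω => ?_) hn⟩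
  simp only [Set.mem_ofPred_eq, Real.norm_eq_abs] at hω ⊢
  rw [abs_of_nonneg (Real.sqrt_nonneg _), ← Real.sqrt_mul hM0.le] at hω
  exact ((Real.sqrt_lt_sqrt_iff (mul_nonneg hM0.le (hr n))).1 hω).trans_le (le_abs_self _)

theorem IsBigOP.tendstoInMeasure {Y : ℕ → Ω → ℝ} {r : ℕ → ℝ}
    (h : IsBigOP μ l Y r) (hr : Tendsto r l (𝓝 0)) :
    TendstoInMeasure μ Y l (fun _ => (0 : ℝ)) := by
  rw [tendstoInMeasure_iff_norm]
  intro η hη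
  simp only [sub_zero]
  refine ENNReal.tendsto_nhds_zero.2 fun ε hε => ?_
  obtain ⟨ε', hε', hle⟩ : ∃ ε' : ℝ, 0 < ε' ∧ ENNReal.ofReal ε' ≤ ε := by
    rcases eq_or_ne ε ⊤ with rfl | hne
    · exact ⟨1, one_pos, le_top⟩
    · exact ⟨ε.toReal, ENNReal.toReal_pos hε.ne' hne, (ENNReal.ofReal_toReal hne).le⟩
  obtain ⟨M, hM⟩ := h ε' hε'
  have hMr : ∀ᶠ n in l, M * r n < η := by
    have : Tendsto (fun n => M * r n) l (𝓝 0) := by simpa using hr.const_mul M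
    exact this.eventually_lt_const hη
  filter_upwards [hM, hMr] with n h1 h2
  exact (measure_mono fun ω hω => lt_of_lt_of_le h2 hω).trans (h1.trans hle)

/-- Markov's inequality: a random sequence whose first absolute moments are `O(r n)` is
`O_ℙ(r n)`. -/
theorem isBigOP_of_integral_abs_le {Y : ℕ → Ω → ℝ} {r : ℕ → ℝ} {C : ℝ}
    (hr : ∀ᶠ n in l, 0 < r n) (hint : ∀ᶠ n in l, Integrable (Y n) μ)
    (h : ∀ᶠ n in l, ∫ ω, |Y n ω| ∂μ ≤ C * r n) : IsBigOP μ l Y r := by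
  intro ε hε
  -- With |C| + 1 in place of C the threshold is positive, hence can be cancelled in Markov's
  -- inequality.
  refine ⟨(|C| + 1) / ε, ?_⟩
  filter_upwards [hr, hint, h] with n h0 hi hn
  have hpos : 0 < (|C| + 1) / ε * r n := by positivity
  have hmeas := mul_meas_ge_le_lintegral₀ (μ := μ) hi.1.aemeasurable.enorm
    (ENNReal.ofReal ((|C| + 1) / ε * r n))
  have hle : ∫⁻ ω, ‖Y n ω‖ₑ ∂μ ≤ ENNReal.ofReal ((|C| + 1) * r n) := by
    rw [← ofReal_integral_norm_eq_lintegral_enorm hi]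
    refine ENNReal.ofReal_le_ofReal (hn.trans ?_)
    exact mul_le_mul_of_nonneg_right ((le_abs_self C).trans (by linarith)) h0.le
  have hset : μ {ω | (|C| + 1) / ε * r n < ‖Y n ω‖}
      ≤ μ {ω | ENNReal.ofReal ((|C| + 1) / ε * r n) ≤ ‖Y n ω‖ₑ} := by
    refine measure_mono fun ω hω => ?_
    simp only [Set.mem_ofPred_eq] at hω ⊢
    rw [← ofReal_norm]
    exact ENNReal.ofReal_le_ofReal hω.le
  refine hset.trans ?_
  have h3 := hmeas.trans hle
  have : ENNReal.ofReal ((|C| + 1) * r n)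
      = ENNReal.ofReal ((|C| + 1) / ε * r n) * ENNReal.ofReal ε := by
    rw [← ENNReal.ofReal_mul hpos.le]
    congr 1
    field_simp
  rw [this] at h3
  exact (ENNReal.mul_le_mul_iff_right (by simpa using hpos) ENNReal.ofReal_ne_top).1 h3

/-- Chebyshev's inequality: a random sequence whose second moments are `O(r n ^ 2)` is
`O_ℙ(r n)`. -/
theorem isBigOP_of_integral_sq_le [IsProbabilityMeasure μ] {Y : ℕ → Ω → ℝ} {r : ℕ → ℝ} {C : ℝ}
    (hr : ∀ᶠ n in l, 0 < r n) (hr0 : ∀ n, 0 ≤ r n)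
    (hint : ∀ᶠ n in l, Integrable (fun ω => Y n ω ^ 2) μ)
    (h : ∀ᶠ n in l, ∫ ω, Y n ω ^ 2 ∂μ ≤ C * r n ^ 2) : IsBigOP μ l Y r := by
  have h1 : IsBigOP μ l (fun n ω => Y n ω ^ 2) (fun n => r n ^ 2) :=
    isBigOP_of_integral_abs_le (C := C) (hr.mono fun n hn => by positivity) hint
      (by simpa using h)
  have h2 := h1.sqrt fun n => sq_nonneg _
  simp only [Real.sqrt_sq (hr0 _), Real.sqrt_sq_eq_abs] at h2
  exact h2.of_ae_norm_le (Eventually.of_forall fun n => ae_of_all _ fun ω => by simp)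

theorem IsBigOP.mono_rate {Y : ℕ → Ω → E} {r s : ℕ → ℝ} (h : IsBigOP μ l Y r)
    (hr : ∀ n, 0 ≤ r n) (hrs : ∀ᶠ n in l, r n ≤ s n) : IsBigOP μ l Y s := by
  intro ε hε
  obtain ⟨M, hM0, hM⟩ := h.exists_pos hr hε
  refine ⟨M, ?_⟩
  filter_upwards [hM, hrs] with n hn h2
  exact (measure_mono fun ω hω => (mul_le_mul_of_nonneg_left h2 hM0.le).trans_lt hω).trans hn

theorem isBigOP_of_norm_le {Y : ℕ → Ω → E} {r : ℕ → ℝ} {C : ℝ}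
    (h : ∀ᶠ n in l, ∀ ω, ‖Y n ω‖ ≤ C * r n) : IsBigOP μ l Y r := by
  intro ε hε
  refine ⟨C, h.mono fun n hn => ?_⟩
  have : {ω | C * r n < ‖Y n ω‖} = ∅ := by
    ext ω
    simpa using hn ω
  simp [this]

theorem IsBigOP.norm_of {Y : ℕ → Ω → E} {r : ℕ → ℝ} (h : IsBigOP μ l Y r) :
    IsBigOP μ l (fun n ω => ‖Y n ω‖) r :=
  h.of_ae_norm_le (Eventually.of_forall fun n => ae_of_all _ fun ω => by simp)

end StochasticOrders

/-! ### Second moments of sums over pairs of observations -/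

section SecondMoments

variable {Ω T : Type*} [MeasurableSpace Ω] {μ : Measure Ω} [MeasurableSpace T] {ν : Measure T}

/-- A finite sum of square integrable variables, each orthogonal to all but at most `c` others. -/
theorem integral_sum_sq_le {ι : Type*} (I : Finset ι) (N : ι → Finset ι) (W : ι → Ω → ℝ)
    {K : ℝ} {c : ℕ} (hK0 : 0 ≤ K) (hW : ∀ p ∈ I, MemLp (W p) 2 μ)
    (hK : ∀ p ∈ I, ∫ ω, W p ω ^ 2 ∂μ ≤ K) (hN : ∀ p ∈ I, (N p).card ≤ c)
    (horth : ∀ p ∈ I, ∀ q ∈ I, q ∉ N p → ∫ ω, W p ω * W q ω ∂μ = 0) :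
    ∫ ω, (∑ p ∈ I, W p ω) ^ 2 ∂μ ≤ I.card * c * K := by
  classical
  have hint : ∀ p ∈ I, ∀ q ∈ I, Integrable (fun ω => W p ω * W q ω) μ := fun p hp q hq =>
    (hW p hp).integrable_mul (hW q hq)
  have hsq : ∀ p ∈ I, Integrable (fun ω => W p ω ^ 2) μ := fun p hp => (hW p hp).integrable_sq
  -- Neighbouring terms contribute at most K, by 2ab ≤ a² + b²; all other terms vanish. Hence at
  -- most c terms count for each p.
  have hle : ∀ p ∈ I, ∀ q ∈ I, ∫ ω, W p ω * W q ω ∂μ ≤ if q ∈ N p then K else 0 := by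
    intro p hp q hq
    split_ifs with h
    · calc ∫ ω, W p ω * W q ω ∂μ ≤ ∫ ω, (W p ω ^ 2 + W q ω ^ 2) / 2 ∂μ := by
            refine integral_mono (hint p hp q hq) (((hsq p hp).add (hsq q hq)).div_const 2) ?_
            intro ω
            beta_reduce
            nlinarith [sq_nonneg (W p ω - W q ω)]
        _ = (∫ ω, W p ω ^ 2 ∂μ + ∫ ω, W q ω ^ 2 ∂μ) / 2 := by
            rw [integral_div, integral_add (hsq p hp) (hsq q hq)]
        _ ≤ K := by linarith [hK p hp, hK q hq]
    · exact (horth p hp q hq h).le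
  calc ∫ ω, (∑ p ∈ I, W p ω) ^ 2 ∂μ = ∑ p ∈ I, ∑ q ∈ I, ∫ ω, W p ω * W q ω ∂μ := by
        simp_rw [sq, Finset.sum_mul_sum]
        rw [integral_finsetSum _ fun p hp => integrable_finsetSum _ fun q hq => hint p hp q hq]
        exact Finset.sum_congr rfl fun p hp => integral_finsetSum _ fun q hq => hint p hp q hq
    _ ≤ ∑ p ∈ I, ∑ q ∈ I, if q ∈ N p then K else 0 :=
        Finset.sum_le_sum fun p hp => Finset.sum_le_sum fun q hq => hle p hp q hq
    _ ≤ ∑ p ∈ I, (c : ℝ) * K := by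
        refine Finset.sum_le_sum fun p hp => ?_
        rw [← Finset.sum_filter, Finset.sum_const, nsmul_eq_mul]
        refine mul_le_mul_of_nonneg_right ?_ hK0
        have : (I.filter (· ∈ N p)).card ≤ (N p).card :=
          Finset.card_le_card fun q hq => (Finset.mem_filter.1 hq).2
        exact_mod_cast this.trans (hN p hp)
    _ = I.card * c * K := by rw [Finset.sum_const, nsmul_eq_mul, mul_assoc]

/-- The variables `Z i` are i.i.d. with law `ν`. -/
structure IIDSample (μ : Measure Ω) (Z : ℕ → Ω → T) (ν : Measure T) : Prop where
  measurable : ∀ i, Measurable (Z i)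
  law : ∀ i, μ.map (Z i) = ν
  iIndep : iIndepFun Z μ

namespace IIDSample

variable {Z : ℕ → Ω → T} [IsProbabilityMeasure μ] [IsProbabilityMeasure ν]

theorem measurePreserving (h : IIDSample μ Z ν) (i : ℕ) : MeasurePreserving (Z i) μ ν :=
  ⟨h.measurable i, h.law i⟩

theorem measurePreserving_pair (h : IIDSample μ Z ν) {i j : ℕ} (hij : i ≠ j) :
    MeasurePreserving (fun ω => (Z i ω, Z j ω)) μ (ν.prod ν) := by
  refine ⟨(h.measurable i).prodMk (h.measurable j), ?_⟩
  rw [(h.iIndep.indepFun hij).map_prod_eq_prod_map_map (h.measurable i).aemeasurable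
    (h.measurable j).aemeasurable, h.law, h.law]

theorem integral_comp_pair (h : IIDSample μ Z ν) {i j : ℕ} (hij : i ≠ j) {f : T × T → ℝ}
    (hf : AEStronglyMeasurable f (ν.prod ν)) :
    ∫ ω, f (Z i ω, Z j ω) ∂μ = ∫ z, f z ∂(ν.prod ν) := by
  have hp := h.measurePreserving_pair hij
  rw [← hp.map_eq] at hf ⊢
  rw [integral_map hp.measurable.aemeasurable hf]

theorem integral_comp (h : IIDSample μ Z ν) (i : ℕ) {f : T → ℝ}
    (hf : AEStronglyMeasurable f ν) : ∫ ω, f (Z i ω) ∂μ = ∫ z, f z ∂ν := by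
  have hp := h.measurePreserving i
  rw [← hp.map_eq] at hf ⊢
  rw [integral_map hp.measurable.aemeasurable hf]

theorem integral_mul_eq_zero_of_disjoint (h : IIDSample μ Z ν) {f : T × T → ℝ}
    (hf : AEStronglyMeasurable f (ν.prod ν)) (h0 : ∫ z, f z ∂(ν.prod ν) = 0) {i j k l : ℕ}
    (hij : i ≠ j) (hkl : k ≠ l) (hik : i ≠ k) (hil : i ≠ l) (hjk : j ≠ k) (hjl : j ≠ l) :
    ∫ ω, f (Z i ω, Z j ω) * f (Z k ω, Z l ω) ∂μ = 0 := by
  have hp := h.measurePreserving_pair hij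
  have hp' := h.measurePreserving_pair hkl
  have hind := (h.iIndep.indepFun_prodMk_prodMk h.measurable i j k l hik hil hjk hjl).comp₀
    hp.measurable.aemeasurable hp'.measurable.aemeasurable
    (φ := f) (ψ := f) (by rw [hp.map_eq]; exact hf.aemeasurable)
    (by rw [hp'.map_eq]; exact hf.aemeasurable)
  have := hind.integral_fun_mul_eq_mul_integral (hf.comp_measurePreserving hp)
    (hf.comp_measurePreserving hp')
  simp only [Function.comp_apply] at this
  rw [this, h.integral_comp_pair hij hf, h0, zero_mul]

/-- The observation of index l enters only through the last argument, so integrating over it first,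
with the three others fixed, gives zero. The indices i, j, k may coincide, which is why independence
is taken from the finite set {i, j, k}. -/
theorem integral_mul_eq_zero_of_notMem (h : IIDSample μ Z ν) {f : T → T → ℝ} {C : ℝ}
    (hf : Measurable fun z : T × T => f z.1 z.2) (hC : ∀ a b, |f a b| ≤ C)
    (h0 : ∀ a, ∫ b, f a b ∂ν = 0) {i j k l : ℕ} (hil : i ≠ l) (hjl : j ≠ l) (hkl : k ≠ l) :
    ∫ ω, f (Z i ω) (Z j ω) * f (Z k ω) (Z l ω) ∂μ = 0 := by
  have hind : IndepFun (fun ω => (Z i ω, Z j ω, Z k ω)) (Z l) μ := by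
    have h1 := h.iIndep.indepFun_finset {i, j, k} {l} (by simp [hil.symm, hjl.symm, hkl.symm])
      h.measurable
    exact h1.comp
      (φ := fun x : (({i, j, k} : Finset ℕ) → T) =>
        (x ⟨i, by simp⟩, x ⟨j, by simp⟩, x ⟨k, by simp⟩))
      (ψ := fun x : (({l} : Finset ℕ) → T) => x ⟨l, by simp⟩) (by fun_prop) (by fun_prop)
  have hm : Measurable (fun ω => (Z i ω, Z j ω, Z k ω)) :=
    (h.measurable i).prodMk ((h.measurable j).prodMk (h.measurable k))
  have hmap := hind.map_prod_eq_prod_map_map hm.aemeasurable (h.measurable l).aemeasurable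
  rw [h.law] at hmap
  have hψ : Measurable (fun z : (T × T × T) × T => f z.1.1 z.1.2.1 * f z.1.2.2 z.2) := by
    have h1 : Measurable (fun z : (T × T × T) × T => f z.1.1 z.1.2.1) :=
      hf.comp (f := fun z : (T × T × T) × T => (z.1.1, z.1.2.1)) (by fun_prop)
    have h2 : Measurable (fun z : (T × T × T) × T => f z.1.2.2 z.2) :=
      hf.comp (f := fun z : (T × T × T) × T => (z.1.2.2, z.2)) (by fun_prop)
    exact h1.mul h2
  have hP : IsProbabilityMeasure (μ.map (fun ω => (Z i ω, Z j ω, Z k ω))) :=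
    Measure.isProbabilityMeasure_map hm.aemeasurable
  have hC0 : ∀ a b, 0 ≤ C := fun a b => (abs_nonneg _).trans (hC a b)
  calc ∫ ω, f (Z i ω) (Z j ω) * f (Z k ω) (Z l ω) ∂μ
      = ∫ z, f z.1.1 z.1.2.1 * f z.1.2.2 z.2
          ∂(μ.map (fun ω => ((Z i ω, Z j ω, Z k ω), Z l ω))) :=
        (integral_map (hm.prodMk (h.measurable l)).aemeasurable hψ.aestronglyMeasurable).symm
    _ = ∫ z, ∫ d, f z.1 z.2.1 * f z.2.2 d ∂ν ∂(μ.map (fun ω => (Z i ω, Z j ω, Z k ω))) := by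
        rw [hmap, integral_prod]
        refine Integrable.of_bound hψ.aestronglyMeasurable (C * C) (ae_of_all _ fun z => ?_)
        rw [norm_mul]
        exact mul_le_mul (hC _ _) (hC _ _) (norm_nonneg _) (hC0 z.2 z.2)
    _ = 0 := by simp [integral_const_mul, h0]

/-- Second moment of the sum over pairs, for a centered square integrable kernel. -/
theorem integral_offDiag_sum_sq_le (h : IIDSample μ Z ν) {f : T → T → ℝ}
    (hf : MemLp (fun z : T × T => f z.1 z.2) 2 (ν.prod ν))
    (h0 : ∫ z, f z.1 z.2 ∂(ν.prod ν) = 0) (m : ℕ) :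
    ∫ ω, (∑ p ∈ (Finset.range m).offDiag, f (Z p.1 ω) (Z p.2 ω)) ^ 2 ∂μ
      ≤ 4 * (m : ℝ) ^ 3 * ∫ z, f z.1 z.2 ^ 2 ∂(ν.prod ν) := by
  classical
  set K := ∫ z, f z.1 z.2 ^ 2 ∂(ν.prod ν) with hKdef
  have hK0 : 0 ≤ K := integral_nonneg fun _ => sq_nonneg _
  -- The pairs that share an index with p, at most 4m of them. With at most m² pairs p, this gives
  -- the factor 4m³.
  let N : ℕ × ℕ → Finset (ℕ × ℕ) := fun p =>
    (({p.1, p.2} : Finset ℕ) ×ˢ Finset.range m) ∪ (Finset.range m ×ˢ ({p.1, p.2} : Finset ℕ))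
  have key := integral_sum_sq_le (μ := μ) (Finset.range m).offDiag N
    (fun p ω => f (Z p.1 ω) (Z p.2 ω)) (K := K) (c := 4 * m) hK0 ?_ ?_ ?_ ?_
  · refine key.trans ?_
    have hc : (((Finset.range m).offDiag.card : ℕ) : ℝ) ≤ (m : ℝ) * m := by
      rw [Finset.offDiag_card, Finset.card_range]
      exact_mod_cast Nat.sub_le _ _
    push_cast
    calc ((Finset.range m).offDiag.card : ℝ) * (4 * m) * K ≤ ((m : ℝ) * m) * (4 * m) * K := by
          gcongr
      _ = _ := by ring
  · intro p hp
    exact hf.comp_measurePreserving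
      (h.measurePreserving_pair (Finset.mem_offDiag.1 hp).2.2)
  · intro p hp
    exact (h.integral_comp_pair (Finset.mem_offDiag.1 hp).2.2
      (f := fun z => f z.1 z.2 ^ 2) (hf.1.pow 2)).le
  · intro p _
    refine (Finset.card_union_le _ _).trans ?_
    rw [Finset.card_product, Finset.card_product, Finset.card_range]
    have : ({p.1, p.2} : Finset ℕ).card ≤ 2 := Finset.card_le_two
    nlinarith
  · intro p hp q hq hqN
    obtain ⟨_, _, hpne⟩ := Finset.mem_offDiag.1 hp
    obtain ⟨hq1, hq2, hqne⟩ := Finset.mem_offDiag.1 hq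
    have hN : ¬ (q.1 = p.1 ∨ q.1 = p.2) ∧ ¬ (q.2 = p.1 ∨ q.2 = p.2) := by
      constructor
      · intro hc
        exact hqN (Finset.mem_union_left _ (Finset.mem_product.2 ⟨by simpa using hc, hq2⟩))
      · intro hc
        exact hqN (Finset.mem_union_right _ (Finset.mem_product.2 ⟨hq1, by simpa using hc⟩))
    obtain ⟨hN1, hN2⟩ := hN
    push Not at hN1 hN2
    exact h.integral_mul_eq_zero_of_disjoint (f := fun z => f z.1 z.2) hf.1 h0 hpne hqne
      hN1.1.symm hN2.1.symm hN1.2.symm hN2.2.symm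

theorem memLp_of_bounded {f : T → T → ℝ} {C : ℝ} {κ : Measure (T × T)} [IsFiniteMeasure κ]
    (hf : Measurable fun z : T × T => f z.1 z.2) (hC : ∀ a b, |f a b| ≤ C) :
    MemLp (fun z : T × T => f z.1 z.2) 2 κ :=
  MemLp.of_bound hf.aestronglyMeasurable C (ae_of_all _ fun z => hC z.1 z.2)

theorem integral_sq_le_of_bounded {f : T → T → ℝ} {C : ℝ} {i j : ℕ}
    (hC : ∀ a b, |f a b| ≤ C) : ∫ ω, f (Z i ω) (Z j ω) ^ 2 ∂μ ≤ C ^ 2 := by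
  have := norm_integral_le_of_norm_le_const (μ := μ) (C := C ^ 2)
    (f := fun ω => f (Z i ω) (Z j ω) ^ 2) (ae_of_all _ fun ω => ?_)
  · simpa using (le_abs_self _).trans this
  · rw [norm_pow]
    exact pow_le_pow_left₀ (norm_nonneg _) (hC _ _) 2

/-- Second moment of the sum over pairs, for a degenerate symmetric kernel. -/
theorem integral_offDiag_sum_sq_le_of_degenerate (h : IIDSample μ Z ν) {f : T → T → ℝ} {C : ℝ}
    (hf : Measurable fun z : T × T => f z.1 z.2) (hC : ∀ a b, |f a b| ≤ C)
    (hsymm : ∀ a b, f a b = f b a) (h0 : ∀ a, ∫ b, f a b ∂ν = 0) (m : ℕ) :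
    ∫ ω, (∑ p ∈ (Finset.range m).offDiag, f (Z p.1 ω) (Z p.2 ω)) ^ 2 ∂μ
      ≤ 2 * (m : ℝ) ^ 2 * C ^ 2 := by
  classical
  -- For a degenerate kernel a pair is orthogonal to every pair but itself and its transpose, so the
  -- second moment is of order m² instead of m³.
  have key := integral_sum_sq_le (μ := μ) (Finset.range m).offDiag
    (fun p => {p, (p.2, p.1)}) (fun p ω => f (Z p.1 ω) (Z p.2 ω)) (K := C ^ 2) (c := 2)
    (sq_nonneg C) ?_ ?_ ?_ ?_
  · refine key.trans ?_
    have hc : (((Finset.range m).offDiag.card : ℕ) : ℝ) ≤ (m : ℝ) * m := by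
      rw [Finset.offDiag_card, Finset.card_range]
      exact_mod_cast Nat.sub_le _ _
    push_cast
    calc ((Finset.range m).offDiag.card : ℝ) * 2 * C ^ 2 ≤ ((m : ℝ) * m) * 2 * C ^ 2 := by
          gcongr
      _ = _ := by ring
  · intro p hp
    exact (memLp_of_bounded hf hC).comp_measurePreserving
      (h.measurePreserving_pair (Finset.mem_offDiag.1 hp).2.2)
  · intro p hp
    exact integral_sq_le_of_bounded hC
  · intro p _
    exact Finset.card_le_two
  · rintro ⟨i, j⟩ hp ⟨k, l⟩ hq hqN
    obtain ⟨_, _, hij⟩ := Finset.mem_offDiag.1 hp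
    obtain ⟨_, _, hkl⟩ := Finset.mem_offDiag.1 hq
    simp only [ne_eq, Finset.mem_insert, Finset.mem_singleton, Prod.mk.injEq, not_or] at *
    -- Unless (k, l) is (i, j) or its transpose, one of k, l lies outside {i, j}. If it is l,
    -- integrate over it; otherwise it is k, which symmetry of the kernel moves to the last place.
    by_cases hl : i ≠ l ∧ j ≠ l
    · exact h.integral_mul_eq_zero_of_notMem hf hC h0 hl.1 hl.2 hkl
    · have hk : i ≠ k ∧ j ≠ k := by
        constructor
        · rintro rfl; exact hl ⟨hkl, fun hj => hqN.1 ⟨rfl, hj.symm⟩⟩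
        · rintro rfl; exact hl ⟨fun hi => hqN.2 ⟨rfl, hi.symm⟩, hkl⟩
      simp_rw [hsymm (Z k _) (Z l _)]
      exact h.integral_mul_eq_zero_of_notMem hf hC h0 hk.1 hk.2 (Ne.symm hkl)

/-- Second moment of the partial sums with one fixed index. -/
theorem integral_erase_sum_sq_le (h : IIDSample μ Z ν) {f : T → T → ℝ} {C : ℝ}
    (hf : Measurable fun z : T × T => f z.1 z.2) (hC : ∀ a b, |f a b| ≤ C)
    (h0 : ∀ a, ∫ b, f a b ∂ν = 0) (m i : ℕ) :
    ∫ ω, (∑ j ∈ (Finset.range m).erase i, f (Z i ω) (Z j ω)) ^ 2 ∂μ ≤ m * C ^ 2 := by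
  classical
  have key := integral_sum_sq_le (μ := μ) ((Finset.range m).erase i)
    (fun j => {j}) (fun j ω => f (Z i ω) (Z j ω)) (K := C ^ 2) (c := 1)
    (sq_nonneg C) ?_ ?_ ?_ ?_
  · refine key.trans ?_
    have hc : ((((Finset.range m).erase i).card : ℕ) : ℝ) ≤ m := by
      have := (Finset.card_erase_le (s := Finset.range m) (a := i))
      rw [Finset.card_range] at this
      exact_mod_cast this
    push_cast
    rw [mul_one]
    gcongr
  · intro j hj
    exact (memLp_of_bounded hf hC).comp_measurePreserving
      (h.measurePreserving_pair (Finset.ne_of_mem_erase hj).symm)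
  · intro j hj
    exact integral_sq_le_of_bounded hC
  · intro p _
    simp
  · intro j hj l hl hne
    exact h.integral_mul_eq_zero_of_notMem hf hC h0 (Finset.ne_of_mem_erase hl).symm
      (fun hh => hne (by simp [hh])) (Finset.ne_of_mem_erase hl).symm

end IIDSample

end SecondMoments

/-! ### U-statistics as sums over pairs -/

section Algebra

variable {T : Type*}

theorem offDiag_sum_eq_sum_erase {M : Type*} [AddCommMonoid M] (m : ℕ) (a : ℕ → ℕ → M) :
    ∑ p ∈ (Finset.range m).offDiag, a p.1 p.2
      = ∑ i ∈ Finset.range m, ∑ j ∈ (Finset.range m).erase i, a i j := by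
  rw [Finset.sum_sigma']
  refine Finset.sum_bij' (fun p _ => ⟨p.1, p.2⟩) (fun p _ => (p.1, p.2)) ?_ ?_ ?_ ?_ ?_
  · rintro ⟨i, j⟩ h
    simp only [Finset.mem_offDiag, Finset.mem_sigma, Finset.mem_erase] at *
    exact ⟨h.1, Ne.symm h.2.2, h.2.1⟩
  · rintro ⟨i, j⟩ h
    simp only [Finset.mem_offDiag, Finset.mem_sigma, Finset.mem_erase] at *
    exact ⟨h.1, h.2.2, Ne.symm h.2.1⟩
  all_goals intros; rfl

theorem sum_erase_eq_sum_ite (m i : ℕ) (a : ℕ → ℝ) :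
    ∑ j ∈ (Finset.range m).erase i, a j
      = ∑ j ∈ Finset.range m, if i ≠ j then a j else 0 := by
  rw [← Finset.sum_filter]
  refine Finset.sum_congr ?_ fun _ _ => rfl
  ext j
  simp only [Finset.mem_erase, Finset.mem_filter]
  tauto

theorem ustat₂_eq (f : T → T → ℝ) (m : ℕ) (z : ℕ → T) :
    ustat₂ f m z = ((m : ℝ) * (m - 1))⁻¹
      * ∑ p ∈ (Finset.range m).offDiag, f (z p.1) (z p.2) := by
  rw [ustat₂, one_div, offDiag_sum_eq_sum_erase m fun i j => f (z i) (z j)]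
  simp_rw [sum_erase_eq_sum_ite]

theorem card_offDiag_range (m : ℕ) : ((Finset.range m).offDiag.card : ℝ) = (m : ℝ) * (m - 1) := by
  rw [Finset.offDiag_card, Finset.card_range, Nat.cast_sub (Nat.le_mul_self m)]
  push_cast
  ring

theorem ustat₂_add (f g : T → T → ℝ) (m : ℕ) (z : ℕ → T) :
    ustat₂ (fun a b => f a b + g a b) m z = ustat₂ f m z + ustat₂ g m z := by
  simp_rw [ustat₂_eq, Finset.sum_add_distrib, mul_add]

theorem ustat₂_sub (f g : T → T → ℝ) (m : ℕ) (z : ℕ → T) :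
    ustat₂ (fun a b => f a b - g a b) m z = ustat₂ f m z - ustat₂ g m z := by
  simp_rw [ustat₂_eq, Finset.sum_sub_distrib, mul_sub]

theorem ustat₂_const_mul (c : ℝ) (f : T → T → ℝ) (m : ℕ) (z : ℕ → T) :
    ustat₂ (fun a b => c * f a b) m z = c * ustat₂ f m z := by
  simp_rw [ustat₂_eq, ← Finset.mul_sum]
  ring

theorem ustat₂_const (c : ℝ) {m : ℕ} (hm : 2 ≤ m) (z : ℕ → T) :
    ustat₂ (fun _ _ => c) m z = c := by
  have hm' : (2 : ℝ) ≤ m := by exact_mod_cast hm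
  have h1 : (m : ℝ) - 1 ≠ 0 := by linarith
  rw [ustat₂_eq, Finset.sum_const, nsmul_eq_mul, card_offDiag_range]
  field_simp

theorem ustat₂_fst (f : T → ℝ) {m : ℕ} (hm : 2 ≤ m) (z : ℕ → T) :
    ustat₂ (fun a _ => f a) m z = (m : ℝ)⁻¹ * ∑ i ∈ Finset.range m, f (z i) := by
  have hm' : (2 : ℝ) ≤ m := by exact_mod_cast hm
  have h1 : (m : ℝ) - 1 ≠ 0 := by linarith
  have h0 : (m : ℝ) ≠ 0 := by linarith
  have : ∀ i ∈ Finset.range m,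
      ∑ j ∈ (Finset.range m).erase i, f (z i) = ((m : ℝ) - 1) * f (z i) := by
    intro i hi
    rw [Finset.sum_const, Finset.card_erase_of_mem hi, Finset.card_range, nsmul_eq_mul,
      Nat.cast_sub (by omega), Nat.cast_one]
  rw [ustat₂_eq, offDiag_sum_eq_sum_erase m fun i _ => f (z i), Finset.sum_congr rfl this,
    ← Finset.mul_sum]
  field_simp

theorem ustat₂_swap (f : T → T → ℝ) (m : ℕ) (z : ℕ → T) :
    ustat₂ (fun a b => f b a) m z = ustat₂ f m z := by
  rw [ustat₂, ustat₂, Finset.sum_comm]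
  simp_rw [ne_comm]

theorem ustat₂_mono {f g : T → T → ℝ} {m : ℕ} {z : ℕ → T}
    (h : ∀ i j, i ≠ j → f (z i) (z j) ≤ g (z i) (z j)) : ustat₂ f m z ≤ ustat₂ g m z := by
  rw [ustat₂_eq, ustat₂_eq]
  refine mul_le_mul_of_nonneg_left (Finset.sum_le_sum fun p hp =>
    h _ _ (Finset.mem_offDiag.1 hp).2.2) ?_
  rw [← card_offDiag_range]
  positivity

theorem abs_ustat₂_le (f : T → T → ℝ) (m : ℕ) (z : ℕ → T) :
    |ustat₂ f m z| ≤ ustat₂ (fun a b => |f a b|) m z := by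
  rw [ustat₂_eq, ustat₂_eq, abs_mul, ← card_offDiag_range, abs_of_nonneg (by positivity)]
  gcongr
  exact Finset.abs_sum_le_sum_abs _ _

theorem inv_pairs_le {m : ℕ} (hm : 2 ≤ m) : ((m : ℝ) * (m - 1))⁻¹ ≤ 2 * ((m : ℝ) ^ 2)⁻¹ := by
  have hm' : (2 : ℝ) ≤ m := by exact_mod_cast hm
  rw [← div_eq_mul_inv, inv_eq_one_div, div_le_div_iff₀ (by nlinarith) (by positivity)]
  nlinarith

theorem inv_triples_le {m : ℕ} (hm : 4 ≤ m) :
    ((m : ℝ) * (m - 1) * (m - 2))⁻¹ ≤ 4 * ((m : ℝ) ^ 3)⁻¹ := by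
  have hm' : (4 : ℝ) ≤ m := by exact_mod_cast hm
  have h1 : (m : ℝ) / 2 ≤ m - 1 := by linarith
  have h2 : (m : ℝ) / 2 ≤ m - 2 := by linarith
  have h0 : 0 ≤ (m : ℝ) * (m - 1) := mul_nonneg (by linarith) (by linarith)
  have h3 : (m : ℝ) * (m / 2) * (m / 2) ≤ (m : ℝ) * (m - 1) * (m - 2) := by gcongr
  calc ((m : ℝ) * (m - 1) * (m - 2))⁻¹ ≤ ((m : ℝ) * (m / 2) * (m / 2))⁻¹ :=
        inv_anti₀ (by positivity) h3
    _ = 4 * ((m : ℝ) ^ 3)⁻¹ := by field_simp; norm_num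

/-- Each product in `triple` multiplies two entries of one row of the matrix f(zᵢ, zⱼ), and
relabelling the indices shows that the three products have the same sum. For row i, summing over j ≠
l gives the squared row sum minus its diagonal. Variance estimators are thereby studied through row
sums only. -/
theorem ustat₃_triple_eq (c : ℝ) (f : T → T → ℝ) (m : ℕ) (z : ℕ → T) :
    ustat₃ (triple c f) m z = c * ((m : ℝ) * (m - 1) * (m - 2))⁻¹
      * (∑ i ∈ Finset.range m, (∑ j ∈ (Finset.range m).erase i, f (z i) (z j)) ^ 2
        - ∑ p ∈ (Finset.range m).offDiag, f (z p.1) (z p.2) ^ 2) := by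
  let s := Finset.range m
  let a : ℕ → ℕ → ℕ → ℝ := fun i j l =>
    if i ≠ j ∧ i ≠ l ∧ l ≠ j then f (z i) (z j) * f (z i) (z l) else 0
  have hsplit : ∀ i j l, (if i ≠ j ∧ i ≠ l ∧ l ≠ j then triple c f (z i) (z j) (z l) else 0)
      = c / 3 * (a i j l + a j i l + a l j i) := by
    intro i j l
    by_cases hd : i ≠ j ∧ i ≠ l ∧ l ≠ j
    · have h1 : j ≠ i ∧ j ≠ l ∧ l ≠ i := ⟨hd.1.symm, hd.2.2.symm, hd.2.1.symm⟩
      have h2 : l ≠ j ∧ l ≠ i ∧ i ≠ j := ⟨hd.2.2, hd.2.1.symm, hd.1⟩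
      simp only [a, if_pos hd, if_pos h1, if_pos h2, triple]
    · have h1 : ¬ (j ≠ i ∧ j ≠ l ∧ l ≠ i) := by tauto
      have h2 : ¬ (l ≠ j ∧ l ≠ i ∧ i ≠ j) := by tauto
      simp only [a, if_neg hd, if_neg h1, if_neg h2]
      ring
  have hcomm1 : ∑ i ∈ s, ∑ j ∈ s, ∑ l ∈ s, a j i l = ∑ i ∈ s, ∑ j ∈ s, ∑ l ∈ s, a i j l :=
    Finset.sum_comm
  have hcomm2 : ∑ i ∈ s, ∑ j ∈ s, ∑ l ∈ s, a l j i = ∑ i ∈ s, ∑ j ∈ s, ∑ l ∈ s, a i j l := by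
    calc ∑ i ∈ s, ∑ j ∈ s, ∑ l ∈ s, a l j i = ∑ i ∈ s, ∑ l ∈ s, ∑ j ∈ s, a l j i :=
          Finset.sum_congr rfl fun i _ => Finset.sum_comm
      _ = ∑ l ∈ s, ∑ i ∈ s, ∑ j ∈ s, a l j i := Finset.sum_comm
      _ = _ := Finset.sum_congr rfl fun i _ => Finset.sum_comm
  have hinner : ∀ i, ∑ j ∈ s, ∑ l ∈ s, a i j l
      = (∑ j ∈ s.erase i, f (z i) (z j)) ^ 2 - ∑ j ∈ s.erase i, f (z i) (z j) ^ 2 := by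
    intro i
    rw [sum_erase_eq_sum_ite, sum_erase_eq_sum_ite, sq, Finset.sum_mul_sum,
      ← Finset.sum_sub_distrib]
    refine Finset.sum_congr rfl fun j hj => ?_
    rw [← Finset.sum_erase_add s _ hj, ← Finset.sum_erase_add (Finset.range m) _ hj]
    have hdiag : a i j j = 0 := by simp [a]
    rw [hdiag]
    have : ∑ l ∈ s.erase j, a i j l = ∑ l ∈ s.erase j,
        (if i ≠ j then f (z i) (z j) else 0) * (if i ≠ l then f (z i) (z l) else 0) := by
      refine Finset.sum_congr rfl fun l hl => ?_
      have hlj := Finset.ne_of_mem_erase hl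
      by_cases h1 : i = j <;> by_cases h2 : i = l <;> simp [a, h1, h2, hlj]
    rw [this]
    by_cases h1 : i = j <;> simp [h1, s, sq]
  have hoff := offDiag_sum_eq_sum_erase m fun i j => f (z i) (z j) ^ 2
  rw [hoff, ← Finset.sum_sub_distrib, ustat₃]
  simp_rw [hsplit, ← Finset.mul_sum, Finset.sum_add_distrib]
  change 1 / ((m : ℝ) * (m - 1) * (m - 2)) * (c / 3 * (∑ i ∈ s, ∑ j ∈ s, ∑ l ∈ s, a i j l
    + ∑ i ∈ s, ∑ j ∈ s, ∑ l ∈ s, a j i l + ∑ i ∈ s, ∑ j ∈ s, ∑ l ∈ s, a l j i)) = _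
  rw [hcomm1, hcomm2]
  simp_rw [hinner]
  ring

end Algebra

/-! ### Asymptotics of U-statistics of i.i.d. samples -/

section Asymptotics

variable {Ω T : Type*} [MeasurableSpace Ω] {μ : Measure Ω} [IsProbabilityMeasure μ]
  [MeasurableSpace T] {ν : Measure T} [IsProbabilityMeasure ν] {Z : ℕ → Ω → T}
  {l : Filter ℕ} {m : ℕ → ℕ}

theorem measurable_ustat₂ {f : Ω → T → T → ℝ}
    (hf : ∀ i j, Measurable fun ω => f ω (Z i ω) (Z j ω)) (n : ℕ) :
    Measurable fun ω => ustat₂ (f ω) n (fun i => Z i ω) := by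
  simp_rw [ustat₂_eq]
  exact (Finset.measurable_fun_sum _ fun p _ => hf p.1 p.2).const_mul _

theorem IIDSample.measurable_ustat₂ (h : IIDSample μ Z ν) {f : T → T → ℝ}
    (hf : Measurable fun z : T × T => f z.1 z.2) (n : ℕ) :
    Measurable fun ω => ustat₂ f n (fun i => Z i ω) :=
  MMDComparison.measurable_ustat₂
    (fun i j => hf.comp ((h.measurable i).prodMk (h.measurable j))) n

theorem IIDSample.integrable_ustat₂ (h : IIDSample μ Z ν) {f : T → T → ℝ}
    (hf : Integrable (fun z : T × T => f z.1 z.2) (ν.prod ν)) (n : ℕ) :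
    Integrable (fun ω => ustat₂ f n (fun i => Z i ω)) μ := by
  simp_rw [ustat₂_eq]
  refine (integrable_finsetSum _ fun p hp => ?_).const_mul _
  exact (h.measurePreserving_pair (Finset.mem_offDiag.1 hp).2.2).integrable_comp_of_integrable hf

theorem IIDSample.integral_ustat₂ (h : IIDSample μ Z ν) {f : T → T → ℝ}
    (hf : Integrable (fun z : T × T => f z.1 z.2) (ν.prod ν)) {n : ℕ} (hn : 2 ≤ n) :
    ∫ ω, ustat₂ f n (fun i => Z i ω) ∂μ = ∫ z, f z.1 z.2 ∂(ν.prod ν) := by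
  have hi : ∀ p ∈ (Finset.range n).offDiag, Integrable (fun ω => f (Z p.1 ω) (Z p.2 ω)) μ :=
    fun p hp =>
      (h.measurePreserving_pair (Finset.mem_offDiag.1 hp).2.2).integrable_comp_of_integrable hf
  have hm' : (2 : ℝ) ≤ n := by exact_mod_cast hn
  have h1 : (n : ℝ) - 1 ≠ 0 := by linarith
  simp_rw [ustat₂_eq]
  rw [integral_const_mul, integral_finsetSum _ hi, Finset.sum_congr rfl fun p hp =>
    h.integral_comp_pair (Finset.mem_offDiag.1 hp).2.2 (f := fun z => f z.1 z.2) hf.1,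
    Finset.sum_const, nsmul_eq_mul, card_offDiag_range]
  field_simp

/-- Only a first moment is needed, which is all that is assumed of the Hessian bounds. -/
theorem IIDSample.isBigOP_ustat₂ (h : IIDSample μ Z ν) (hm : Tendsto m l atTop) {f : T → T → ℝ}
    (hf : Integrable (fun z : T × T => f z.1 z.2) (ν.prod ν)) :
    IsBigOP μ l (fun n ω => ustat₂ (fun a b => |f a b|) (m n) (fun i => Z i ω))
      (fun _ => 1) := by
  refine isBigOP_of_integral_abs_le (C := ∫ z, |f z.1 z.2| ∂(ν.prod ν)) (by simp)
    (Eventually.of_forall fun n => h.integrable_ustat₂ hf.abs _) ?_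
  filter_upwards [hm.eventually_ge_atTop 2] with n hn
  rw [mul_one, ← h.integral_ustat₂ (f := fun a b => |f a b|) hf.abs hn]
  refine (integral_congr_ae (ae_of_all _ fun ω => ?_)).le
  refine abs_of_nonneg ?_
  rw [ustat₂_eq, ← card_offDiag_range]
  positivity

theorem tendsto_inv_sqrt (hm : Tendsto m l atTop) :
    Tendsto (fun n => (√(m n : ℝ))⁻¹) l (𝓝 0) :=
  tendsto_inv_atTop_zero.comp
    (Real.tendsto_sqrt_atTop.comp (tendsto_natCast_atTop_atTop.comp hm))

theorem inv_le_inv_sqrt (hm : Tendsto m l atTop) :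
    ∀ᶠ n in l, ((m n : ℝ))⁻¹ ≤ (√(m n : ℝ))⁻¹ := by
  filter_upwards [hm.eventually_ge_atTop 1] with n hn
  have h1 : (1 : ℝ) ≤ m n := by exact_mod_cast hn
  refine inv_anti₀ (by positivity) ?_
  rw [Real.sqrt_le_left (by linarith)]
  nlinarith

/-- Weak law of large numbers with rate, for a square integrable kernel. -/
theorem IIDSample.isBigOP_ustat₂_sub (h : IIDSample μ Z ν) (hm : Tendsto m l atTop)
    {f : T → T → ℝ} (hf : MemLp (fun z : T × T => f z.1 z.2) 2 (ν.prod ν)) :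
    IsBigOP μ l (fun n ω => ustat₂ f (m n) (fun i => Z i ω) - ∫ z, f z.1 z.2 ∂(ν.prod ν))
      (fun n => (√(m n : ℝ))⁻¹) := by
  set θ := ∫ z, f z.1 z.2 ∂(ν.prod ν) with hθ
  have hf' : MemLp (fun z : T × T => f z.1 z.2 - θ) 2 (ν.prod ν) := hf.sub (memLp_const θ)
  have h0 : ∫ z, (f z.1 z.2 - θ) ∂(ν.prod ν) = 0 := by
    rw [integral_sub (hf.integrable (by norm_num)) (integrable_const _)]
    simp [hθ]
  set K := ∫ z, (f z.1 z.2 - θ) ^ 2 ∂(ν.prod ν) with hK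
  have hK0 : 0 ≤ K := integral_nonneg fun _ => sq_nonneg _
  have hmem : ∀ n, MemLp (fun ω => ∑ p ∈ (Finset.range n).offDiag,
      (f (Z p.1 ω) (Z p.2 ω) - θ)) 2 μ := fun n =>
    memLp_finsetSum _ fun p hp => hf'.comp_measurePreserving
      (h.measurePreserving_pair (Finset.mem_offDiag.1 hp).2.2)
  have heq : ∀ n, 2 ≤ n → ∀ ω, ustat₂ f n (fun i => Z i ω) - θ
      = ((n : ℝ) * (n - 1))⁻¹ * ∑ p ∈ (Finset.range n).offDiag,
        (f (Z p.1 ω) (Z p.2 ω) - θ) := by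
    intro n hn ω
    rw [← ustat₂_const θ hn (fun i => Z i ω), ← ustat₂_sub, ustat₂_eq, ustat₂_const θ hn]
  -- The constant is that of (2 / m²)² · 4m³ K = 16 K / m.
  refine isBigOP_of_integral_sq_le (C := 16 * K) ?_ (fun n => by positivity) ?_ ?_
  · filter_upwards [hm.eventually_ge_atTop 2] with n hn
    have : (0 : ℝ) < m n := by exact_mod_cast (by omega : 0 < m n)
    positivity
  · filter_upwards [hm.eventually_ge_atTop 2] with n hn
    simp_rw [heq (m n) hn]
    exact ((hmem (m n)).const_mul _).integrable_sq
  · filter_upwards [hm.eventually_ge_atTop 2] with n hn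
    have hpos : (0 : ℝ) < m n := by exact_mod_cast (by omega : 0 < m n)
    have h1 : (1 : ℝ) ≤ m n := by exact_mod_cast (by omega : 1 ≤ m n)
    simp_rw [heq (m n) hn, mul_pow]
    rw [integral_const_mul]
    have hS := h.integral_offDiag_sum_sq_le (f := fun a b => f a b - θ) hf' h0 (m n)
    have hi : (((m n : ℝ) * (m n - 1))⁻¹) ^ 2 ≤ (2 * ((m n : ℝ) ^ 2)⁻¹) ^ 2 :=
      pow_le_pow_left₀ (inv_nonneg.2 (mul_nonneg hpos.le (by linarith))) (inv_pairs_le hn) 2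
    calc _ ≤ (2 * ((m n : ℝ) ^ 2)⁻¹) ^ 2 * (4 * (m n : ℝ) ^ 3 * K) :=
          mul_le_mul hi hS (integral_nonneg fun _ => sq_nonneg _) (by positivity)
      _ = 16 * K * ((√(m n : ℝ))⁻¹) ^ 2 := by
          rw [inv_pow, Real.sq_sqrt hpos.le]
          field_simp
          ring

/-- U-statistics with a degenerate symmetric kernel are of order `1 / n`. -/
theorem IIDSample.isBigOP_ustat₂_of_degenerate (h : IIDSample μ Z ν) (hm : Tendsto m l atTop)
    {f : T → T → ℝ} {C : ℝ} (hf : Measurable fun z : T × T => f z.1 z.2)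
    (hC : ∀ a b, |f a b| ≤ C) (hsymm : ∀ a b, f a b = f b a) (h0 : ∀ a, ∫ b, f a b ∂ν = 0) :
    IsBigOP μ l (fun n ω => ustat₂ f (m n) (fun i => Z i ω)) (fun n => (m n : ℝ)⁻¹) := by
  have hmem : ∀ n, MemLp (fun ω => ∑ p ∈ (Finset.range n).offDiag,
      f (Z p.1 ω) (Z p.2 ω)) 2 μ := fun n =>
    memLp_finsetSum _ fun p hp => (memLp_of_bounded hf hC).comp_measurePreserving
      (h.measurePreserving_pair (Finset.mem_offDiag.1 hp).2.2)
  -- The constant is that of (2 / m²)² · 2m² C² = 8 C² / m².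
  refine isBigOP_of_integral_sq_le (C := 8 * C ^ 2) ?_ (fun n => by positivity) ?_ ?_
  · filter_upwards [hm.eventually_ge_atTop 2] with n hn
    have : (0 : ℝ) < m n := by exact_mod_cast (by omega : 0 < m n)
    positivity
  · refine Eventually.of_forall fun n => ?_
    simp_rw [ustat₂_eq]
    exact ((hmem (m n)).const_mul _).integrable_sq
  · filter_upwards [hm.eventually_ge_atTop 2] with n hn
    have hpos : (0 : ℝ) < m n := by exact_mod_cast (by omega : 0 < m n)
    have h1 : (1 : ℝ) ≤ m n := by exact_mod_cast (by omega : 1 ≤ m n)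
    simp_rw [ustat₂_eq, mul_pow]
    rw [integral_const_mul]
    have hS := h.integral_offDiag_sum_sq_le_of_degenerate hf hC hsymm h0 (m n)
    have hi : (((m n : ℝ) * (m n - 1))⁻¹) ^ 2 ≤ (2 * ((m n : ℝ) ^ 2)⁻¹) ^ 2 :=
      pow_le_pow_left₀ (inv_nonneg.2 (mul_nonneg hpos.le (by linarith))) (inv_pairs_le hn) 2
    calc _ ≤ (2 * ((m n : ℝ) ^ 2)⁻¹) ^ 2 * (2 * (m n : ℝ) ^ 2 * C ^ 2) :=
          mul_le_mul hi hS (integral_nonneg fun _ => sq_nonneg _) (by positivity)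
      _ = 8 * C ^ 2 * ((m n : ℝ)⁻¹) ^ 2 := by
          field_simp
          ring

theorem measurable_proj {f : T → T → ℝ} (hf : Measurable fun z : T × T => f z.1 z.2) :
    Measurable fun a => ∫ b, f a b ∂ν :=
  (hf.stronglyMeasurable.integral_prod_right (ν := ν)).measurable

theorem abs_proj_le {f : T → T → ℝ} {C : ℝ} (hC : ∀ a b, |f a b| ≤ C) (a : T) :
    |∫ b, f a b ∂ν| ≤ C := by
  simpa using norm_integral_le_of_norm_le_const (μ := ν) (C := C)
    (f := fun b => f a b) (ae_of_all _ fun b => hC a b)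

theorem integrable_of_abs_le {κ : Measure T} [IsFiniteMeasure κ] {f : T → ℝ} {C : ℝ}
    (hf : Measurable f) (hC : ∀ a, |f a| ≤ C) : Integrable f κ :=
  Integrable.of_bound hf.aestronglyMeasurable C (ae_of_all _ fun a => hC a)

theorem integrable_section {f : T → T → ℝ} {C : ℝ} (hf : Measurable fun z : T × T => f z.1 z.2)
    (hC : ∀ a b, |f a b| ≤ C) (a : T) : Integrable (fun b => f a b) ν :=
  integrable_of_abs_le (hf.comp (measurable_const.prodMk measurable_id)) (hC a)

/-- Central limit theorem for U-statistics of order two with a bounded symmetric kernel. -/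
theorem IIDSample.tendstoInDistribution_ustat₂ (h : IIDSample μ Z ν) [l.IsCountablyGenerated]
    (hm : Tendsto m l atTop)
    {f : T → T → ℝ} {C : ℝ} (hf : Measurable fun z : T × T => f z.1 z.2)
    (hC : ∀ a b, |f a b| ≤ C) (hsymm : ∀ a b, f a b = f b a) :
    TendstoInDistribution
      (fun n ω => √(m n : ℝ) * (ustat₂ f (m n) (fun i => Z i ω) - ∫ z, f z.1 z.2 ∂(ν.prod ν)))
      l id (fun _ => μ)
      (gaussianReal 0 (variance (fun a => 2 * ∫ b, f a b ∂ν) ν).toNNReal) := by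
  set θ := ∫ z, f z.1 z.2 ∂(ν.prod ν) with hθ
  set φ : T → ℝ := fun a => ∫ b, f a b ∂ν with hφ
  have hφm : Measurable φ := measurable_proj hf
  have hφC : ∀ a, |φ a| ≤ C := abs_proj_le hC
  have hφi : ∫ a, φ a ∂ν = θ :=
    (integral_prod _ (integrable_of_abs_le hf fun z => hC z.1 z.2)).symm
  -- The projection φ appears once for each argument of the symmetric kernel, hence the factor 2.
  -- The classical central limit theorem applies to these i.i.d. variables.
  set X : ℕ → Ω → ℝ := fun i ω => 2 * φ (Z i ω) with hX
  have hident : ∀ i, IdentDistrib (X i) (X 0) μ μ := by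
    intro i
    have : IdentDistrib (Z i) (Z 0) μ μ :=
      ⟨(h.measurable i).aemeasurable, (h.measurable 0).aemeasurable, by rw [h.law, h.law]⟩
    exact this.comp (u := fun a => 2 * φ a) (by fun_prop)
  have hindep : iIndepFun X μ := h.iIndep.comp (fun _ a => 2 * φ a) (fun _ => by fun_prop)
  have hX2 : MemLp (X 0) 2 μ := by
    refine MemLp.of_bound (Measurable.aestronglyMeasurable ?_) (2 * C) (ae_of_all _ fun ω => ?_)
    · exact (hφm.comp (h.measurable 0)).const_mul 2
    · simpa [hX, abs_mul] using hφC (Z 0 ω)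
  have hvar : Var[X 0; μ] = variance (fun a => 2 * φ a) ν := by
    rw [← h.law 0, variance_map (by fun_prop) (h.measurable 0).aemeasurable]
    rfl
  have hmean : ∫ ω, X 0 ω ∂μ = 2 * θ := by
    rw [hX, integral_const_mul, h.integral_comp 0 hφm.aestronglyMeasurable, hφi]
  have hclt := tendstoInDistribution_inv_sqrt_mul_sum_sub (P := μ) (X := X) (Y := id)
    (P' := gaussianReal 0 (variance (fun a => 2 * φ a) ν).toNNReal)
    (by rw [hvar]; exact ⟨aemeasurable_id, Measure.map_id⟩) hX2 hindep hident
  have hclt' : TendstoInDistribution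
      (fun n ω => (√(m n : ℝ))⁻¹ * (∑ k ∈ Finset.range (m n), X k ω - (m n) * ∫ ω, X 0 ω ∂μ))
      l id (fun _ => μ) (gaussianReal 0 (variance (fun a => 2 * φ a) ν).toNNReal) :=
    ⟨fun n => hclt.forall_aemeasurable (m n), hclt.aemeasurable_limit, hclt.tendsto.comp hm⟩
  -- The degenerate part of Hoeffding's decomposition: its integral over either argument is zero.
  let f' : T → T → ℝ := fun a b => f a b - (φ a + φ b) + θ
  have hφC' : 0 ≤ C := by
    obtain ⟨a⟩ : Nonempty T := ν.nonempty_of_neZero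
    exact (abs_nonneg _).trans (hφC a)
  have hθC : |θ| ≤ C := by
    simpa using norm_integral_le_of_norm_le_const (μ := ν.prod ν) (C := C)
      (f := fun z : T × T => f z.1 z.2) (ae_of_all _ fun z => hC z.1 z.2)
  have hf'm : Measurable fun z : T × T => f' z.1 z.2 := by
    have h1 : Measurable fun z : T × T => φ z.1 := hφm.comp measurable_fst
    have h2 : Measurable fun z : T × T => φ z.2 := hφm.comp measurable_snd
    exact (hf.sub (h1.add h2)).add_const θ
  have hf'C : ∀ a b, |f' a b| ≤ 4 * C := by
    intro a b
    have := hC a b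
    have := hφC a
    have := hφC b
    simp only [f', abs_le] at *
    constructor <;> linarith
  have hf'0 : ∀ a, ∫ b, f' a b ∂ν = 0 := by
    intro a
    have hi := integrable_section (ν := ν) hf hC a
    have hi2 : Integrable φ ν := integrable_of_abs_le hφm hφC
    have e : ∀ b, f' a b = (f a b - φ b) + (θ - φ a) := fun b => by simp only [f']; ring
    simp_rw [e]
    rw [integral_add (f := fun b => f a b - φ b) (hi.sub hi2) (integrable_const _),
      integral_sub hi hi2, hφi]
    simp [hφ]
  have hdeg := (h.isBigOP_ustat₂_of_degenerate hm hf'm hf'C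
    (fun a b => by simp only [f', hsymm a b, add_comm (φ a)]) hf'0)
  refine tendstoInDistribution_of_tendstoInMeasure_sub _ _ hclt' ?_ ?_
  -- Slutsky: the degenerate part is `O_ℙ(1 / m)`, hence negligible after multiplication by √m.
  · have hsq : IsBigOP μ l (fun n (_ : Ω) => √(m n : ℝ)) (fun n => √(m n : ℝ)) :=
      isBigOP_of_norm_le (C := 1) (Eventually.of_forall fun n ω => by
        rw [Real.norm_eq_abs, abs_of_nonneg (Real.sqrt_nonneg _), one_mul])
    have hprod := hsq.mul (fun n => by positivity) (fun n => by positivity) hdeg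
    have hrate : Tendsto (fun n => √(m n : ℝ) * (m n : ℝ)⁻¹) l (𝓝 0) := by
      refine (tendsto_inv_sqrt hm).congr fun n => ?_
      rw [← div_eq_mul_inv, Real.sqrt_div_self', one_div]
    refine TendstoInMeasure.congr' ?_ (ae_eq_refl _) (hprod.tendstoInMeasure hrate)
    filter_upwards [hm.eventually_ge_atTop 2] with n hn
    refine ae_of_all _ fun ω => ?_
    have hpos : (0 : ℝ) < m n := by exact_mod_cast (by omega : 0 < m n)
    have e1 : ustat₂ f' (m n) (fun i => Z i ω) = ustat₂ f (m n) (fun i => Z i ω)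
        - 2 * ((m n : ℝ)⁻¹ * ∑ i ∈ Finset.range (m n), φ (Z i ω)) + θ := by
      have e2 := ustat₂_fst φ hn (fun i => Z i ω)
      have e3 := (ustat₂_swap (fun a _ => φ a) (m n) (fun i => Z i ω)).trans e2
      simp only [f']
      rw [ustat₂_add, ustat₂_sub, ustat₂_add, ustat₂_const θ hn, e2, e3]
      ring
    simp only [Pi.sub_apply]
    rw [e1, hmean, hX, ← Finset.mul_sum]
    have hs : √(m n : ℝ) * √(m n : ℝ) = m n := Real.mul_self_sqrt hpos.le
    have hs0 : √(m n : ℝ) ≠ 0 := (Real.sqrt_pos.2 hpos).ne'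
    have e4 : (√(m n : ℝ))⁻¹ = √(m n : ℝ) * (m n : ℝ)⁻¹ := by
      rw [← div_eq_mul_inv, Real.sqrt_div_self', one_div]
    rw [e4]
    field_simp
    ring
  · intro n
    exact (((h.measurable_ustat₂ hf (m n)).sub_const _).const_mul _).aemeasurable

end Asymptotics

/-! ### U-statistics of order three with perturbed kernels -/

section Triples

variable {Ω T : Type*} [MeasurableSpace Ω] {μ : Measure Ω} [IsProbabilityMeasure μ]
  [MeasurableSpace T] {ν : Measure T} [IsProbabilityMeasure ν] {Z : ℕ → Ω → T}
  {l : Filter ℕ} {m : ℕ → ℕ}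

/-- The sum over `i < m` of the squares of the sums over `j ≠ i` of `f(zᵢ, zⱼ)`. -/
def rowSq (f : T → T → ℝ) (m : ℕ) (z : ℕ → T) : ℝ :=
  ∑ i ∈ Finset.range m, (∑ j ∈ (Finset.range m).erase i, f (z i) (z j)) ^ 2

/-- The average of the squared differences of `f` and `f'` over all pairs. -/
noncomputable def sqDist (f f' : T → T → ℝ) (m : ℕ) (z : ℕ → T) : ℝ :=
  ((m : ℝ) ^ 2)⁻¹ * ∑ p ∈ (Finset.range m).offDiag, (f (z p.1) (z p.2) - f' (z p.1) (z p.2)) ^ 2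

theorem rowSq_nonneg (f : T → T → ℝ) (m : ℕ) (z : ℕ → T) : 0 ≤ rowSq f m z :=
  Finset.sum_nonneg fun _ _ => sq_nonneg _

theorem sqDist_nonneg (f f' : T → T → ℝ) (m : ℕ) (z : ℕ → T) : 0 ≤ sqDist f f' m z :=
  mul_nonneg (by positivity) (Finset.sum_nonneg fun _ _ => sq_nonneg _)

theorem card_erase_range_le (m i : ℕ) : ((((Finset.range m).erase i).card : ℕ) : ℝ) ≤ m := by
  have := (Finset.card_erase_le (s := Finset.range m) (a := i))
  rw [Finset.card_range] at this
  exact_mod_cast this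

theorem rowSq_add_le (f f' : T → T → ℝ) (m : ℕ) (z : ℕ → T) :
    rowSq (fun a b => f a b + f' a b) m z ≤ 2 * rowSq f m z + 2 * rowSq f' m z := by
  simp only [rowSq, Finset.mul_sum, ← Finset.sum_add_distrib]
  refine Finset.sum_le_sum fun i _ => ?_
  rw [Finset.sum_add_distrib]
  nlinarith [sq_nonneg (∑ j ∈ (Finset.range m).erase i, f (z i) (z j)
    - ∑ j ∈ (Finset.range m).erase i, f' (z i) (z j))]

/-- Cauchy-Schwarz in each row, which has at most m entries. -/
theorem rowSq_sub_le_sqDist (f f' : T → T → ℝ) {m : ℕ} (hm : 0 < m) (z : ℕ → T) :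
    rowSq (fun a b => f a b - f' a b) m z ≤ (m : ℝ) ^ 3 * sqDist f f' m z := by
  have hpos : (0 : ℝ) < m := by exact_mod_cast hm
  have h1 : (m : ℝ) ^ 3 * sqDist f f' m z
      = m * ∑ i ∈ Finset.range m, ∑ j ∈ (Finset.range m).erase i,
        (f (z i) (z j) - f' (z i) (z j)) ^ 2 := by
    rw [sqDist, offDiag_sum_eq_sum_erase m fun i j => (f (z i) (z j) - f' (z i) (z j)) ^ 2]
    field_simp
  rw [h1, rowSq, Finset.mul_sum]
  refine Finset.sum_le_sum fun i _ => sq_sum_le_card_mul_sum_sq.trans ?_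
  exact mul_le_mul_of_nonneg_right (card_erase_range_le m i)
    (Finset.sum_nonneg fun _ _ => sq_nonneg _)

theorem rowSq_le_of_bounded {f : T → T → ℝ} {C : ℝ} (hC : ∀ a b, |f a b| ≤ C) (m : ℕ)
    (z : ℕ → T) : rowSq f m z ≤ (m : ℝ) ^ 3 * C ^ 2 := by
  have : ∀ i ∈ Finset.range m,
      (∑ j ∈ (Finset.range m).erase i, f (z i) (z j)) ^ 2 ≤ (m : ℝ) ^ 2 * C ^ 2 := by
    intro i _
    rw [← mul_pow, sq_le_sq]
    refine (Finset.abs_sum_le_sum_abs _ _).trans ((Finset.sum_le_sum fun j _ => hC _ _).trans ?_)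
    rw [Finset.sum_const, nsmul_eq_mul]
    refine (mul_le_mul_of_nonneg_right (card_erase_range_le m i)
      ((abs_nonneg _).trans (hC (z 0) (z 0)))).trans (le_abs_self _)
  refine (Finset.sum_le_sum this).trans (le_of_eq ?_)
  rw [Finset.sum_const, Finset.card_range, nsmul_eq_mul]
  ring

/-- Continuity of `rowSq`, a consequence of the Cauchy-Schwarz inequality. -/
theorem abs_rowSq_sub_le (f f' : T → T → ℝ) (m : ℕ) (z : ℕ → T) :
    |rowSq f m z - rowSq f' m z|
      ≤ 2 * √(rowSq f' m z * rowSq (fun a b => f a b - f' a b) m z)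
        + rowSq (fun a b => f a b - f' a b) m z := by
  set x : ℕ → ℝ := fun i => ∑ j ∈ (Finset.range m).erase i, f (z i) (z j)
  set y : ℕ → ℝ := fun i => ∑ j ∈ (Finset.range m).erase i, f' (z i) (z j)
  have hd : rowSq (fun a b => f a b - f' a b) m z = ∑ i ∈ Finset.range m, (x i - y i) ^ 2 := by
    simp only [rowSq, Finset.sum_sub_distrib, x, y]
  have hx : rowSq f m z = ∑ i ∈ Finset.range m, x i ^ 2 := rfl
  have hy : rowSq f' m z = ∑ i ∈ Finset.range m, y i ^ 2 := rfl
  have hdiff : rowSq f m z - rowSq f' m z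
      = 2 * ∑ i ∈ Finset.range m, y i * (x i - y i)
        + ∑ i ∈ Finset.range m, (x i - y i) ^ 2 := by
    rw [hx, hy, ← Finset.sum_sub_distrib, Finset.mul_sum, ← Finset.sum_add_distrib]
    exact Finset.sum_congr rfl fun i _ => by ring
  have hcs : |∑ i ∈ Finset.range m, y i * (x i - y i)|
      ≤ √((∑ i ∈ Finset.range m, y i ^ 2) * ∑ i ∈ Finset.range m, (x i - y i) ^ 2) :=
    Real.abs_le_sqrt (Finset.sum_mul_sq_le_sq_mul_sq _ _ _)
  rw [hdiff, hd, hy]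
  refine (abs_add_le _ _).trans ?_
  rw [abs_mul, abs_two, abs_of_nonneg (Finset.sum_nonneg fun i _ => sq_nonneg (x i - y i))]
  linarith

/-- When f(a, ·) is centered, the terms of a row are orthogonal, so a squared row sum has mean at
most m C² instead of m² C². The m rows together, divided by m³, are of order 1 / m. -/
theorem IIDSample.isBigOP_rowSq (h : IIDSample μ Z ν) (hm : Tendsto m l atTop)
    {f : T → T → ℝ} {C : ℝ} (hf : Measurable fun z : T × T => f z.1 z.2)
    (hC : ∀ a b, |f a b| ≤ C) (h0 : ∀ a, ∫ b, f a b ∂ν = 0) :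
    IsBigOP μ l (fun n ω => ((m n : ℝ) ^ 3)⁻¹ * rowSq f (m n) (fun i => Z i ω))
      (fun n => (m n : ℝ)⁻¹) := by
  have hmem : ∀ n i, MemLp (fun ω => ∑ j ∈ (Finset.range n).erase i,
      f (Z i ω) (Z j ω)) 2 μ := fun n i =>
    memLp_finsetSum _ fun j hj => (memLp_of_bounded hf hC).comp_measurePreserving
      (h.measurePreserving_pair (Finset.ne_of_mem_erase hj).symm)
  refine isBigOP_of_integral_abs_le (C := C ^ 2) ?_ ?_ ?_
  · filter_upwards [hm.eventually_ge_atTop 1] with n hn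
    have : (0 : ℝ) < m n := by exact_mod_cast (by omega : 0 < m n)
    positivity
  · refine Eventually.of_forall fun n => ?_
    simp_rw [rowSq]
    exact (integrable_finsetSum _ fun i _ => (hmem (m n) i).integrable_sq).const_mul _
  · filter_upwards [hm.eventually_ge_atTop 1] with n hn
    have hpos : (0 : ℝ) < m n := by exact_mod_cast (by omega : 0 < m n)
    have e : ∀ ω, |((m n : ℝ) ^ 3)⁻¹ * rowSq f (m n) (fun i => Z i ω)|
        = ((m n : ℝ) ^ 3)⁻¹ * rowSq f (m n) (fun i => Z i ω) := fun ω =>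
      abs_of_nonneg (mul_nonneg (by positivity) (rowSq_nonneg _ _ _))
    simp_rw [e, rowSq]
    rw [integral_const_mul, integral_finsetSum _ fun i _ => (hmem (m n) i).integrable_sq]
    calc _ ≤ ((m n : ℝ) ^ 3)⁻¹ * ∑ i ∈ Finset.range (m n), (m n : ℝ) * C ^ 2 := by
          gcongr with i hi
          exact h.integral_erase_sum_sq_le hf hC h0 (m n) i
      _ = C ^ 2 * (m n : ℝ)⁻¹ := by
          rw [Finset.sum_const, Finset.card_range, nsmul_eq_mul]
          field_simp

theorem sum_sq_le_of_bounded {f : T → T → ℝ} {C : ℝ} (hC : ∀ a b, |f a b| ≤ C) (m : ℕ)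
    (z : ℕ → T) :
    ∑ p ∈ (Finset.range m).offDiag, f (z p.1) (z p.2) ^ 2 ≤ (m : ℝ) ^ 2 * C ^ 2 := by
  calc ∑ p ∈ (Finset.range m).offDiag, f (z p.1) (z p.2) ^ 2
      ≤ ∑ p ∈ (Finset.range m).offDiag, C ^ 2 := by
        refine Finset.sum_le_sum fun p _ => ?_
        rw [← sq_abs]
        exact pow_le_pow_left₀ (abs_nonneg _) (hC _ _) 2
    _ ≤ (m : ℝ) ^ 2 * C ^ 2 := by
        rw [Finset.sum_const, nsmul_eq_mul, card_offDiag_range]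
        have : (0 : ℝ) ≤ m := Nat.cast_nonneg m
        gcongr
        nlinarith

variable {f : T → T → ℝ} {φ : ℕ → Ω → T → T → ℝ} {C : ℝ}

/-- The centered rows of a kernel close to `f` are small. -/
theorem IIDSample.isBigOP_rowSq_sub_proj (h : IIDSample μ Z ν) (hm : Tendsto m l atTop)
    (hf : Measurable fun z : T × T => f z.1 z.2) (hC : ∀ a b, |f a b| ≤ C)
    (hD : IsBigOP μ l (fun n ω => sqDist (φ n ω) f (m n) (fun i => Z i ω))
      (fun n => (m n : ℝ)⁻¹)) :
    IsBigOP μ l (fun n ω => ((m n : ℝ) ^ 3)⁻¹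
        * rowSq (fun a b => φ n ω a b - ∫ c, f a c ∂ν) (m n) (fun i => Z i ω))
      (fun n => (m n : ℝ)⁻¹) := by
  have hf1 := measurable_proj (ν := ν) hf
  -- Write φ - ψ = (φ - f) + (f - ψ) with ψ the projection of f. The first part is controlled by
  -- `sqDist`; the second is centered in its second argument, so its rows have orthogonal terms.
  have h1 := h.isBigOP_rowSq hm (f := fun a b => f a b - ∫ c, f a c ∂ν) (C := 2 * C)
    (hf.sub (hf1.comp measurable_fst)) (fun a b => by
      have := hC a b
      have := abs_proj_le (ν := ν) hC a
      simp only [abs_le] at *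
      constructor <;> linarith)
    (fun a => by
      rw [integral_sub (integrable_section hf hC a) (integrable_const _)]
      simp)
  refine ((hD.const_mul 2).add (h1.const_mul 2)).of_ae_norm_le ?_
  filter_upwards [hm.eventually_ge_atTop 1] with n hn
  refine ae_of_all _ fun ω => ?_
  have hpos : (0 : ℝ) < m n := by exact_mod_cast (by omega : 0 < m n)
  have e1 := rowSq_add_le (fun a b => φ n ω a b - f a b) (fun a b => f a b - ∫ c, f a c ∂ν)
    (m n) (fun i => Z i ω)
  have e2 := rowSq_sub_le_sqDist (φ n ω) f (by omega : 0 < m n) (fun i => Z i ω)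
  simp only [sub_add_sub_cancel] at e1
  refine (Real.norm_of_nonneg (mul_nonneg (by positivity) (rowSq_nonneg _ _ _))).le.trans
    (le_trans ?_ (le_abs_self _))
  rw [inv_mul_le_iff₀ (by positivity)]
  have e3 : (m n : ℝ) ^ 3 * (2 * (((m n : ℝ) ^ 3)⁻¹
      * rowSq (fun a b => f a b - ∫ c, f a c ∂ν) (m n) (fun i => Z i ω)))
      = 2 * rowSq (fun a b => f a b - ∫ c, f a c ∂ν) (m n) (fun i => Z i ω) := by
    field_simp
  rw [mul_add, e3]
  linarith

/-- The variance estimator is of order `1 / n` in the degenerate case. -/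
theorem IIDSample.isBigOP_ustat₃_of_degenerate (h : IIDSample μ Z ν) (hm : Tendsto m l atTop)
    (c : ℝ) (hf : Measurable fun z : T × T => f z.1 z.2) (hC : ∀ a b, |f a b| ≤ C)
    (hφC : ∀ n ω a b, |φ n ω a b| ≤ C)
    (hD : IsBigOP μ l (fun n ω => sqDist (φ n ω) f (m n) (fun i => Z i ω))
      (fun n => (m n : ℝ)⁻¹)) (h0 : ∀ a, ∫ b, f a b ∂ν = 0) :
    IsBigOP μ l (fun n ω => ustat₃ (triple c (φ n ω)) (m n) (fun i => Z i ω))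
      (fun n => (m n : ℝ)⁻¹) := by
  have h1 := h.isBigOP_rowSq_sub_proj hm hf hC hD
  simp only [h0, sub_zero] at h1
  -- The diagonal subtracted in `ustat₃_triple_eq`, at most m² C², divided by m³.
  have h2 : IsBigOP μ l (fun n (_ : Ω) => C ^ 2 * (m n : ℝ)⁻¹) (fun n => (m n : ℝ)⁻¹) :=
    isBigOP_of_norm_le (C := C ^ 2) (Eventually.of_forall fun n ω => by
      rw [Real.norm_of_nonneg (by positivity)])
  refine ((h1.add h2).const_mul (4 * |c|)).of_ae_norm_le ?_
  filter_upwards [hm.eventually_ge_atTop 4] with n hn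
  refine ae_of_all _ fun ω => ?_
  have hpos : (0 : ℝ) < m n := by exact_mod_cast (by omega : 0 < m n)
  have hr := rowSq_nonneg (φ n ω) (m n) (fun i => Z i ω)
  have hs := sum_sq_le_of_bounded (hφC n ω) (m n) (fun i => Z i ω)
  have hs0 : 0 ≤ ∑ p ∈ (Finset.range (m n)).offDiag, φ n ω (Z p.1 ω) (Z p.2 ω) ^ 2 :=
    Finset.sum_nonneg fun _ _ => sq_nonneg _
  rw [ustat₃_triple_eq]
  refine le_trans ?_ (le_abs_self _)
  change |c * ((m n : ℝ) * (m n - 1) * (m n - 2))⁻¹ * (rowSq (φ n ω) (m n) (fun i => Z i ω)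
    - ∑ p ∈ (Finset.range (m n)).offDiag, φ n ω (Z p.1 ω) (Z p.2 ω) ^ 2)| ≤ _
  have h4 : (4 : ℝ) ≤ m n := by exact_mod_cast hn
  have hinv : 0 ≤ ((m n : ℝ) * (m n - 1) * (m n - 2))⁻¹ :=
    inv_nonneg.2 (mul_nonneg (mul_nonneg hpos.le (by linarith)) (by linarith))
  rw [abs_mul, abs_mul, abs_of_nonneg hinv]
  calc _ ≤ |c| * (4 * ((m n : ℝ) ^ 3)⁻¹) * (rowSq (φ n ω) (m n) (fun i => Z i ω)
        + (m n : ℝ) ^ 2 * C ^ 2) := by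
        gcongr
        · exact inv_triples_le hn
        · rw [abs_le]
          constructor <;> linarith
    _ = _ := by field_simp

/-- Consistency of the variance estimator, with rate. -/
theorem IIDSample.isBigOP_ustat₃_sub (h : IIDSample μ Z ν) (hm : Tendsto m l atTop)
    (c : ℝ) (hf : Measurable fun z : T × T => f z.1 z.2) (hC : ∀ a b, |f a b| ≤ C)
    (hφC : ∀ n ω a b, |φ n ω a b| ≤ C)
    (hD : IsBigOP μ l (fun n ω => sqDist (φ n ω) f (m n) (fun i => Z i ω))
      (fun n => (m n : ℝ)⁻¹)) :
    IsBigOP μ l (fun n ω => ustat₃ (triple c (φ n ω)) (m n) (fun i => Z i ω)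
      - c * ∫ a, (∫ b, f a b ∂ν) ^ 2 ∂ν) (fun n => (√(m n : ℝ))⁻¹) := by
  set ψ : T → ℝ := fun a => ∫ b, f a b ∂ν with hψ
  have hψm : Measurable ψ := measurable_proj hf
  have hψC : ∀ a, |ψ a| ≤ C := abs_proj_le hC
  have hC0 : 0 ≤ C := by
    obtain ⟨a⟩ : Nonempty T := ν.nonempty_of_neZero
    exact (abs_nonneg _).trans (hψC a)
  -- The normalized squared ℓ² distance between the row sums of φ and those of the projection. It is
  -- of order 1 / m, but enters through its square root in `abs_rowSq_sub_le`, hence the final rate.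
  set G : ℕ → Ω → ℝ := fun n ω => ((m n : ℝ) ^ 3)⁻¹
    * rowSq (fun a b => φ n ω a b - ψ a) (m n) (fun i => Z i ω) with hG
  have hGO : IsBigOP μ l G (fun n => (m n : ℝ)⁻¹) := h.isBigOP_rowSq_sub_proj hm hf hC hD
  have hrate := inv_le_inv_sqrt hm
  have hG1 : IsBigOP μ l G (fun n => (√(m n : ℝ))⁻¹) :=
    hGO.mono_rate (fun n => by positivity) hrate
  have hG2 : IsBigOP μ l (fun n ω => √(G n ω)) (fun n => (√(m n : ℝ))⁻¹) := by
    have := hGO.sqrt fun n => by positivity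
    simpa only [Real.sqrt_inv] using this
  have hψ2 : MemLp (fun z : T × T => ψ z.1 ^ 2) 2 (ν.prod ν) := by
    refine MemLp.of_bound ((hψm.comp measurable_fst).pow_const 2).aestronglyMeasurable (C ^ 2)
      (ae_of_all _ fun z => ?_)
    rw [norm_pow]
    exact pow_le_pow_left₀ (norm_nonneg _) (hψC _) 2
  have hL := h.isBigOP_ustat₂_sub hm (f := fun a _ => ψ a ^ 2) hψ2
  have hmean : ∫ z : T × T, ψ z.1 ^ 2 ∂(ν.prod ν) = ∫ a, ψ a ^ 2 ∂ν := by
    rw [integral_fun_fst (f := fun a => ψ a ^ 2)]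
    simp
  rw [hmean] at hL
  -- Of the 6 C² / m, 2 C² / m pays for the inexact normalization of the row sums and 4 C² / m for
  -- the diagonal.
  have hconst : IsBigOP μ l (fun n (_ : Ω) => 6 * C ^ 2 * (m n : ℝ)⁻¹)
      (fun n => (√(m n : ℝ))⁻¹) :=
    (isBigOP_of_norm_le (C := 6 * C ^ 2) (Eventually.of_forall fun n ω => by
      rw [Real.norm_of_nonneg (by positivity)])).mono_rate (fun n => by positivity) hrate
  have htot := ((((hG2.const_mul (8 * C)).add (hG1.const_mul 4)).add hL.norm_of).add
    hconst).const_mul |c|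
  refine htot.of_ae_norm_le ?_
  filter_upwards [hm.eventually_ge_atTop 4] with n hn
  refine ae_of_all _ fun ω => ?_
  have hpos : (0 : ℝ) < m n := by exact_mod_cast (by omega : 0 < m n)
  have h4 : (4 : ℝ) ≤ m n := by exact_mod_cast hn
  set z : ℕ → T := fun i => Z i ω with hz
  set M : ℝ := (m n : ℝ) with hM
  set A : ℝ := ustat₂ (fun a _ => ψ a ^ 2) (m n) z with hA
  -- The kernel (a, b) ↦ ψ(a) has constant rows, of m - 1 equal terms.
  have hAeq : rowSq (fun a _ => ψ a) (m n) z = M * (M - 1) ^ 2 * A := by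
    have e1 : ∀ i ∈ Finset.range (m n), (∑ j ∈ (Finset.range (m n)).erase i, ψ (z i)) ^ 2
        = (M - 1) ^ 2 * ψ (z i) ^ 2 := by
      intro i hi
      rw [Finset.sum_const, Finset.card_erase_of_mem hi, Finset.card_range, nsmul_eq_mul,
        Nat.cast_sub (by omega), Nat.cast_one, mul_pow]
    rw [rowSq, Finset.sum_congr rfl e1, ← Finset.mul_sum, hA, ustat₂_fst _ (by omega)]
    change (M - 1) ^ 2 * ∑ i ∈ Finset.range (m n), ψ (z i) ^ 2
      = M * (M - 1) ^ 2 * (M⁻¹ * ∑ i ∈ Finset.range (m n), ψ (z i) ^ 2)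
    generalize ∑ i ∈ Finset.range (m n), ψ (z i) ^ 2 = s
    field_simp
  have hA0 : 0 ≤ A := by
    rw [hA, ustat₂_fst _ (by omega)]
    positivity
  have hAC : A ≤ C ^ 2 := by
    rw [hA, ← ustat₂_const (C ^ 2) (by omega : 2 ≤ m n) z]
    refine ustat₂_mono fun i j _ => ?_
    rw [← sq_abs]
    exact pow_le_pow_left₀ (abs_nonneg _) (hψC _) 2
  set B := ∑ p ∈ (Finset.range (m n)).offDiag, φ n ω (z p.1) (z p.2) ^ 2 with hB
  have hB1 : B ≤ M ^ 2 * C ^ 2 := sum_sq_le_of_bounded (hφC n ω) (m n) z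
  have hB0 : 0 ≤ B := Finset.sum_nonneg fun _ _ => sq_nonneg _
  set γ : ℝ := (M * (M - 1) * (M - 2))⁻¹ with hγ
  have hγ0 : 0 ≤ γ := inv_nonneg.2 (mul_nonneg (mul_nonneg hpos.le (by linarith)) (by linarith))
  have hγ1 : γ ≤ 4 * (M ^ 3)⁻¹ := inv_triples_le hn
  have hR := abs_rowSq_sub_le (φ n ω) (fun a _ => ψ a) (m n) z
  have hRG : rowSq (fun a b => φ n ω a b - ψ a) (m n) z = M ^ 3 * G n ω := by
    change _ = M ^ 3 * ((M ^ 3)⁻¹ * rowSq (fun a b => φ n ω a b - ψ a) (m n) z)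
    rw [mul_inv_cancel_left₀ (by positivity)]
  have hG0 : 0 ≤ G n ω := mul_nonneg (by positivity) (rowSq_nonneg _ _ _)
  have hR2 : |rowSq (φ n ω) (m n) z - rowSq (fun a _ => ψ a) (m n) z|
      ≤ M ^ 3 * (2 * C * √(G n ω) + G n ω) := by
    refine hR.trans ?_
    rw [hRG]
    have h1 : √(rowSq (fun a _ => ψ a) (m n) z * (M ^ 3 * G n ω)) ≤ M ^ 3 * (C * √(G n ω)) := by
      refine Real.sqrt_le_iff.2 ⟨by positivity, ?_⟩
      calc _ ≤ (M ^ 3 * C ^ 2) * (M ^ 3 * G n ω) := by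
            gcongr
            exact rowSq_le_of_bounded (fun a _ => hψC a) _ _
        _ = (M ^ 3) ^ 2 * C ^ 2 * (√(G n ω)) ^ 2 := by rw [Real.sq_sqrt hG0]; ring
        _ = _ := by ring
    linarith
  -- The normalization is off by the factor (M - 1) / (M - 2) = 1 + 1 / (M - 2).
  have hγA : γ * (M * (M - 1) ^ 2 * A) - A = A * (M - 2)⁻¹ := by
    have h1 : M - 1 ≠ 0 := by linarith
    have h2 : M - 2 ≠ 0 := by linarith
    rw [hγ]
    field_simp
    ring
  have hinv2 : (M - 2)⁻¹ ≤ 2 * M⁻¹ := by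
    rw [← div_eq_mul_inv, inv_eq_one_div, div_le_div_iff₀ (by linarith) hpos]
    linarith
  -- Four errors: replacing the rows by the projections, the normalization, the fluctuation of the
  -- average of ψ², and the diagonal.
  have hkey : ustat₃ (triple c (φ n ω)) (m n) z - c * ∫ a, ψ a ^ 2 ∂ν
      = c * (γ * (rowSq (φ n ω) (m n) z - rowSq (fun a _ => ψ a) (m n) z)
        + A * (M - 2)⁻¹ + (A - ∫ a, ψ a ^ 2 ∂ν) - γ * B) := by
    rw [ustat₃_triple_eq, ← hγA, hAeq]
    change c * γ * (rowSq (φ n ω) (m n) z - B) - _ = _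
    ring
  rw [hkey, norm_mul, norm_mul]
  simp only [Real.norm_eq_abs, abs_abs]
  refine mul_le_mul_of_nonneg_left (le_trans ?_ (le_abs_self _)) (abs_nonneg c)
  have t1 : |γ * (rowSq (φ n ω) (m n) z - rowSq (fun a _ => ψ a) (m n) z)|
      ≤ 8 * C * √(G n ω) + 4 * G n ω := by
    rw [abs_mul, abs_of_nonneg hγ0]
    calc _ ≤ (4 * (M ^ 3)⁻¹) * (M ^ 3 * (2 * C * √(G n ω) + G n ω)) := by gcongr
      _ = _ := by field_simp; ring
  have t2 : |A * (M - 2)⁻¹| ≤ 2 * C ^ 2 * M⁻¹ := by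
    rw [abs_of_nonneg (mul_nonneg hA0 (inv_nonneg.2 (by linarith)))]
    calc _ ≤ C ^ 2 * (2 * M⁻¹) :=
          mul_le_mul hAC hinv2 (inv_nonneg.2 (by linarith)) (sq_nonneg C)
      _ = _ := by ring
  have t3 : |γ * B| ≤ 4 * C ^ 2 * M⁻¹ := by
    rw [abs_of_nonneg (mul_nonneg hγ0 hB0)]
    calc _ ≤ (4 * (M ^ 3)⁻¹) * (M ^ 2 * C ^ 2) := by gcongr
      _ = _ := by field_simp
  have t4 := abs_sub (γ * (rowSq (φ n ω) (m n) z - rowSq (fun a _ => ψ a) (m n) z)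
        + A * (M - 2)⁻¹ + (A - ∫ a, ψ a ^ 2 ∂ν)) (γ * B)
  have t5 := abs_add_three (γ * (rowSq (φ n ω) (m n) z - rowSq (fun a _ => ψ a) (m n) z))
    (A * (M - 2)⁻¹) (A - ∫ a, ψ a ^ 2 ∂ν)
  have t6 : 6 * C ^ 2 * M⁻¹ = 2 * C ^ 2 * M⁻¹ + 4 * C ^ 2 * M⁻¹ := by ring
  linarith

end Triples

/-! ### Taylor and Landau inequalities -/

section Calculus

variable {E : Type*} [NormedAddCommGroup E] [NormedSpace ℝ E] {f : E → ℝ} {x₀ : E} {δ H C : ℝ}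

theorem TwiceDiffOn.mono {s t : Set E} (h : TwiceDiffOn f t) (hst : s ⊆ t) : TwiceDiffOn f s :=
  ⟨h.1.mono hst, h.2.mono hst⟩

/-- Taylor's inequality of order one. -/
theorem TwiceDiffOn.abs_sub_sub_le (hf : TwiceDiffOn f (Metric.ball x₀ δ))
    (hH : ∀ x ∈ Metric.ball x₀ δ, ‖fderiv ℝ (fderiv ℝ f) x‖ ≤ H) {x y : E}
    (hx : x ∈ Metric.ball x₀ δ) (hy : y ∈ Metric.ball x₀ δ) :
    |f y - f x - fderiv ℝ f x (y - x)| ≤ H * ‖y - x‖ ^ 2 := by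
  have hconv := convex_ball x₀ δ
  have hseg : segment ℝ x y ⊆ Metric.ball x₀ δ := hconv.segment_subset hx hy
  have hH0 : 0 ≤ H := (norm_nonneg (fderiv ℝ (fderiv ℝ f) x)).trans (hH x hx)
  -- The gradient moves by at most H ‖y - x‖ along the segment; the mean value inequality for f
  -- minus its linear part then gives the bound. No continuity of the second derivative is needed,
  -- at the price of H in place of H / 2.
  have hg : ∀ w ∈ segment ℝ x y, ‖fderiv ℝ f w - fderiv ℝ f x‖ ≤ H * ‖y - x‖ := by
    intro w hw
    have h1 := hconv.norm_image_sub_le_of_norm_fderiv_le (𝕜 := ℝ)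
      (fun z hz => (hf.2.differentiableAt (Metric.isOpen_ball.mem_nhds hz))) hH hx (hseg hw)
    refine h1.trans (mul_le_mul_of_nonneg_left ?_ hH0)
    obtain ⟨t, ht, rfl⟩ := (segment_eq_image' ℝ x y ▸ hw :)
    rw [add_sub_cancel_left, norm_smul, Real.norm_of_nonneg ht.1]
    exact mul_le_of_le_one_left (norm_nonneg _) ht.2
  have h2 := (convex_segment x y).norm_image_sub_le_of_norm_hasFDerivWithin_le' (𝕜 := ℝ)
    (fun z hz => ((hf.1.differentiableAt
      (Metric.isOpen_ball.mem_nhds (hseg hz))).hasFDerivAt).hasFDerivWithinAt)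
    hg (left_mem_segment ℝ x y) (right_mem_segment ℝ x y)
  rw [Real.norm_eq_abs] at h2
  linarith [sq ‖y - x‖]

/-- Landau's inequality: the square of the derivative is controlled by the second derivative. -/
theorem TwiceDiffOn.sq_norm_fderiv_le (hδ : 0 < δ) (hf : TwiceDiffOn f (Metric.ball x₀ δ))
    (hH : ∀ x ∈ Metric.ball x₀ δ, ‖fderiv ℝ (fderiv ℝ f) x‖ ≤ H) (hC : ∀ x, |f x| ≤ C) {x : E}
    (hx : x ∈ Metric.ball x₀ (δ / 2)) :
    ‖fderiv ℝ f x‖ ^ 2 ≤ (2 * C / (δ / 4) + δ / 4) ^ 2 * (1 + H) := by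
  have hx' : x ∈ Metric.ball x₀ δ := Metric.ball_subset_ball (by linarith) hx
  have hH0 : 0 ≤ H := (norm_nonneg (fderiv ℝ (fderiv ℝ f) x)).trans (hH x hx')
  have hC0 : 0 ≤ C := (abs_nonneg _).trans (hC x)
  -- Since x is within δ / 2 of the centre, a step of length at most δ / 4 stays in the ball where H
  -- is a bound.
  set r := δ / 4 with hr
  have hr0 : 0 < r := by positivity
  set s := √(1 + H) with hs
  have hs1 : 1 ≤ s := Real.one_le_sqrt.2 (by linarith)
  have hs2 : s ^ 2 = 1 + H := Real.sq_sqrt (by linarith)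
  have hs0 : 0 < s := by linarith
  have hbound : ‖fderiv ℝ f x‖ ≤ (2 * C / r + r) * s := by
    refine ContinuousLinearMap.opNorm_le_bound _ (by positivity) fun v => ?_
    rcases eq_or_ne v 0 with rfl | hv
    · simp
    have hv0 : 0 < ‖v‖ := norm_pos_iff.2 hv
    -- Taylor's inequality with step t bounds the derivative by 2C / t + H t. Taking t proportional
    -- to 1 / √(1 + H) makes both terms of order √(1 + H), and the 1 under the root ensures t ≤ r.
    set t := r / s with ht
    have ht0 : 0 < t := by positivity
    have htr : t ≤ r := div_le_self hr0.le hs1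
    set w := (t / ‖v‖) • v with hw
    have hwn : ‖w‖ = t := by
      rw [hw, norm_smul, Real.norm_of_nonneg (by positivity)]
      field_simp
    have hxw : x + w ∈ Metric.ball x₀ δ := by
      rw [Metric.mem_ball, dist_eq_norm] at hx ⊢
      calc ‖x + w - x₀‖ = ‖(x - x₀) + w‖ := by congr 1; abel
        _ ≤ ‖x - x₀‖ + ‖w‖ := norm_add_le _ _
        _ < δ := by rw [hwn]; linarith
    have h1 := hf.abs_sub_sub_le hH hx' hxw
    rw [add_sub_cancel_left, hwn] at h1
    have h2 : |fderiv ℝ f x w| ≤ 2 * C + H * t ^ 2 := by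
      have := hC x
      have := hC (x + w)
      simp only [abs_le] at *
      constructor <;> linarith
    have h3 : fderiv ℝ f x w = t / ‖v‖ * fderiv ℝ f x v := by
      rw [hw, map_smul, smul_eq_mul]
    rw [h3, abs_mul, abs_of_pos (by positivity : 0 < t / ‖v‖)] at h2
    have h4 : |fderiv ℝ f x v| ≤ (2 * C / t + H * t) * ‖v‖ := by
      rw [div_mul_eq_mul_div, div_le_iff₀ hv0] at h2
      have : t * |fderiv ℝ f x v| ≤ t * ((2 * C / t + H * t) * ‖v‖) := by
        refine h2.trans (le_of_eq ?_)
        field_simp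
      exact le_of_mul_le_mul_left this ht0
    rw [Real.norm_eq_abs]
    refine h4.trans (mul_le_mul_of_nonneg_right ?_ hv0.le)
    have h5 : 2 * C / t = 2 * C / r * s := by
      rw [ht]
      field_simp
    have h6 : H * t ≤ r * s := by
      rw [ht, mul_div_assoc', div_le_iff₀ hs0]
      nlinarith
    rw [h5]
    linarith
  calc ‖fderiv ℝ f x‖ ^ 2 ≤ ((2 * C / r + r) * s) ^ 2 :=
        pow_le_pow_left₀ (norm_nonneg _) hbound 2
    _ = _ := by rw [mul_pow, hs2]

/-- Mean value inequality with Landau's bound on the gradient. The squared increment involves H to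
the first power only, so an integrable Hessian bound controls increments in mean square. -/
theorem TwiceDiffOn.sq_sub_le (hδ : 0 < δ) (hf : TwiceDiffOn f (Metric.ball x₀ δ))
    (hH : ∀ x ∈ Metric.ball x₀ δ, ‖fderiv ℝ (fderiv ℝ f) x‖ ≤ H) (hC : ∀ x, |f x| ≤ C) {x : E}
    (hx : x ∈ Metric.ball x₀ (δ / 2)) :
    (f x - f x₀) ^ 2 ≤ (2 * C / (δ / 4) + δ / 4) ^ 2 * (1 + H) * ‖x - x₀‖ ^ 2 := by
  have hsub : Metric.ball x₀ (δ / 2) ⊆ Metric.ball x₀ δ := Metric.ball_subset_ball (by linarith)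
  have h0 : x₀ ∈ Metric.ball x₀ (δ / 2) := Metric.mem_ball_self (by positivity)
  have hH0 : 0 ≤ H := (norm_nonneg (fderiv ℝ (fderiv ℝ f) x)).trans (hH x (hsub hx))
  have h1 := (convex_ball x₀ (δ / 2)).norm_image_sub_le_of_norm_fderiv_le (𝕜 := ℝ)
    (C := √((2 * C / (δ / 4) + δ / 4) ^ 2 * (1 + H)))
    (fun z hz => hf.1.differentiableAt (Metric.isOpen_ball.mem_nhds (hsub hz)))
    (fun z hz => Real.le_sqrt_of_sq_le (hf.sq_norm_fderiv_le hδ hH hC hz)) h0 hx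
  rw [Real.norm_eq_abs] at h1
  have h2 := pow_le_pow_left₀ (abs_nonneg _) h1 2
  rwa [sq_abs, mul_pow, Real.sq_sqrt (by positivity)] at h2

end Calculus

/-! ### U-statistics with estimated parameters -/

section Parametric

variable {Ω T : Type*} [MeasurableSpace Ω] {μ : Measure Ω} [IsProbabilityMeasure μ]
  [MeasurableSpace T] {ν : Measure T} [IsProbabilityMeasure ν] {Z : ℕ → Ω → T}
  {l : Filter ℕ} {m : ℕ → ℕ}

/-- The supremum of the norms of the Hessians over a ball, as a real number. -/
noncomputable def hessBound {E : Type*} [NormedAddCommGroup E] [NormedSpace ℝ E]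
    (f : E → T → T → ℝ) (x₀ : E) (δ : ℝ) (z : T × T) : ℝ :=
  (⨆ x ∈ Metric.ball x₀ δ, ‖fderiv ℝ (fderiv ℝ (fun a => f a z.1 z.2)) x‖ₑ).toReal

/-- A bounded family of kernels with dominated second derivatives, whose first derivative at `x₀`
commutes with expectations. -/
structure SmoothFamily {E : Type*} [NormedAddCommGroup E] [NormedSpace ℝ E]
    (ν : Measure T) (f : E → T → T → ℝ) (x₀ : E) (C δ : ℝ) : Prop where
  pos : 0 < δ
  bound : ∀ x a b, |f x a b| ≤ C
  diff : ∀ a b, TwiceDiffOn (fun x => f x a b) (Metric.ball x₀ δ)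
  hessian : HessianDominated (fun x (z : T × T) => f x z.1 z.2) (ν.prod ν) x₀ δ
  gradient : GradientInterchange (fun x (z : T × T) => f x z.1 z.2) (ν.prod ν) x₀

namespace SmoothFamily

section Normed

variable {E : Type*} [NormedAddCommGroup E] [NormedSpace ℝ E]
  {f : E → T → T → ℝ} {x₀ : E} {C δ : ℝ}

theorem integrable_hessBound (h : SmoothFamily ν f x₀ C δ) :
    Integrable (hessBound f x₀ δ) (ν.prod ν) :=
  integrable_toReal_of_lintegral_ne_top h.hessian.1 h.hessian.2.ne

/-- Where the supremum is infinite, `toReal` returns 0 and the inequality could fail; integrability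
confines this to a null set. -/
theorem ae_norm_le_hessBound (h : SmoothFamily ν f x₀ C δ) :
    ∀ᵐ z ∂(ν.prod ν), ∀ x ∈ Metric.ball x₀ δ,
      ‖fderiv ℝ (fderiv ℝ (fun a => f a z.1 z.2)) x‖ ≤ hessBound f x₀ δ z := by
  filter_upwards [ae_lt_top' h.hessian.1 h.hessian.2.ne] with z hz x hx
  refine (toReal_enorm (fderiv ℝ (fderiv ℝ (fun a => f a z.1 z.2)) x)).symm.le.trans ?_
  exact ENNReal.toReal_mono hz.ne (le_iSup₂ (f := fun x (_ : x ∈ Metric.ball x₀ δ) =>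
    ‖fderiv ℝ (fderiv ℝ (fun a => f a z.1 z.2)) x‖ₑ) x hx)

/-- The bound of the squared increments. -/
noncomputable def lipBound (f : E → T → T → ℝ) (x₀ : E) (C δ : ℝ) (a b : T) : ℝ :=
  (2 * C / (δ / 4) + δ / 4) ^ 2 * (1 + hessBound f x₀ δ (a, b))

theorem hessBound_nonneg (f : E → T → T → ℝ) (x₀ : E) (δ : ℝ) (z : T × T) :
    0 ≤ hessBound f x₀ δ z := ENNReal.toReal_nonneg

theorem lipBound_nonneg (f : E → T → T → ℝ) (x₀ : E) (C δ : ℝ) (a b : T) :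
    0 ≤ lipBound f x₀ C δ a b :=
  mul_nonneg (sq_nonneg _) (add_nonneg zero_le_one (hessBound_nonneg _ _ _ _))

theorem integrable_lipBound (h : SmoothFamily ν f x₀ C δ) :
    Integrable (fun z : T × T => lipBound f x₀ C δ z.1 z.2) (ν.prod ν) :=
  ((integrable_const 1).add h.integrable_hessBound).const_mul _

/-- Almost surely, the increments of the kernel at all pairs of observations are controlled. -/
theorem ae_forall_pair (h : SmoothFamily ν f x₀ C δ) (hZ : IIDSample μ Z ν) :
    ∀ᵐ ω ∂μ, ∀ i j, i ≠ j →
      (∀ x ∈ Metric.ball x₀ (δ / 2),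
        (f x (Z i ω) (Z j ω) - f x₀ (Z i ω) (Z j ω)) ^ 2
          ≤ lipBound f x₀ C δ (Z i ω) (Z j ω) * ‖x - x₀‖ ^ 2) ∧
      ∀ x ∈ Metric.ball x₀ (δ / 2),
        |f x (Z i ω) (Z j ω) - f x₀ (Z i ω) (Z j ω)
          - fderiv ℝ (fun x => f x (Z i ω) (Z j ω)) x₀ (x - x₀)|
          ≤ hessBound f x₀ δ (Z i ω, Z j ω) * ‖x - x₀‖ ^ 2 := by
  -- The pair of observations has law ν ⊗ ν only for i ≠ j. The null set does not depend on the
  -- parameter x, so that x may later be the random estimate, which depends on the same sample.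
  have h1 : ∀ i j, i ≠ j → ∀ᵐ ω ∂μ, ∀ x ∈ Metric.ball x₀ δ,
      ‖fderiv ℝ (fderiv ℝ (fun a => f a (Z i ω) (Z j ω))) x‖
        ≤ hessBound f x₀ δ (Z i ω, Z j ω) := fun i j hij =>
    (hZ.measurePreserving_pair hij).quasiMeasurePreserving.ae h.ae_norm_le_hessBound
  rw [ae_all_iff]
  intro i
  rw [ae_all_iff]
  intro j
  by_cases hij : i = j
  · exact ae_of_all _ fun ω hc => absurd hij hc
  filter_upwards [h1 i j hij] with ω hω _
  exact ⟨fun x hx => (h.diff _ _).sq_sub_le h.pos hω (fun x => h.bound x _ _) hx,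
    fun x hx => (h.diff _ _).abs_sub_sub_le hω (Metric.mem_ball_self h.pos)
      (Metric.ball_subset_ball (by linarith [h.pos]) hx)⟩

/-- Consistency of the estimate makes the localization to the ball of radius δ / 2 harmless. -/
theorem tendsto_measure_notMem_ball {xn : ℕ → Ω → E} (hm : Tendsto m l atTop)
    (hx : IsBigOP μ l (fun n ω => xn n ω - x₀) (fun n => (√(m n : ℝ))⁻¹)) (hδ : 0 < δ) :
    Tendsto (fun n => μ {ω | xn n ω ∉ Metric.ball x₀ (δ / 2)}) l (𝓝 0) := by
  have h1 := hx.norm_of.tendstoInMeasure (tendsto_inv_sqrt hm)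
  rw [tendstoInMeasure_iff_norm] at h1
  refine (h1 (δ / 2) (by positivity)).congr fun n => ?_
  congr 1
  ext ω
  simp [dist_eq_norm]

theorem inv_sq_mul_sum_le_ustat₂ {g : T → T → ℝ} (hg : ∀ a b, 0 ≤ g a b) {n : ℕ} (hn : 2 ≤ n)
    (z : ℕ → T) :
    ((n : ℝ) ^ 2)⁻¹ * ∑ p ∈ (Finset.range n).offDiag, g (z p.1) (z p.2) ≤ ustat₂ g n z := by
  have hn' : (2 : ℝ) ≤ n := by exact_mod_cast hn
  rw [ustat₂_eq]
  refine mul_le_mul_of_nonneg_right (inv_anti₀ (by nlinarith) (by nlinarith))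
    (Finset.sum_nonneg fun p _ => hg _ _)

/-- Estimating the parameter changes the kernel by `O(1 / n)` in mean square. -/
theorem isBigOP_sqDist (h : SmoothFamily ν f x₀ C δ) (hZ : IIDSample μ Z ν)
    (hm : Tendsto m l atTop) {xn : ℕ → Ω → E}
    (hx : IsBigOP μ l (fun n ω => xn n ω - x₀) (fun n => (√(m n : ℝ))⁻¹)) :
    IsBigOP μ l (fun n ω => sqDist (f (xn n ω)) (f x₀) (m n) (fun i => Z i ω))
      (fun n => (m n : ℝ)⁻¹) := by
  -- On the good event the squared increments average to at most the U-statistic of `lipBound`,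
  -- which is `O_ℙ(1)`, times ‖xₙ - x₀‖², which is `O_ℙ(1 / m)`.
  have hL := hZ.isBigOP_ustat₂ hm h.integrable_lipBound
  have hx2 := (hx.norm_of.mul (fun n => by positivity) (fun n => by positivity) hx.norm_of)
  have htot := (hL.mul (fun _ => zero_le_one) (fun n => by positivity) hx2).congr_rate
    (s := fun n => (m n : ℝ)⁻¹) (c := 1) (Eventually.of_forall fun n => by
      rw [one_mul, one_mul, ← mul_inv, Real.mul_self_sqrt (by positivity)])
  refine htot.of_norm_le_off_ae (tendsto_measure_notMem_ball hm hx h.pos) ?_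
  filter_upwards [hm.eventually_ge_atTop 2] with n hn
  filter_upwards [h.ae_forall_pair hZ] with ω hω hball
  rw [not_not] at hball
  rw [Real.norm_of_nonneg (sqDist_nonneg _ _ _ _)]
  refine le_trans ?_ (le_abs_self _)
  simp_rw [abs_of_nonneg (lipBound_nonneg f x₀ C δ _ _)]
  calc sqDist (f (xn n ω)) (f x₀) (m n) (fun i => Z i ω)
      ≤ ((m n : ℝ) ^ 2)⁻¹ * ∑ p ∈ (Finset.range (m n)).offDiag,
          lipBound f x₀ C δ (Z p.1 ω) (Z p.2 ω) * ‖xn n ω - x₀‖ ^ 2 := by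
        rw [sqDist]
        gcongr with p hp
        exact (hω _ _ (Finset.mem_offDiag.1 hp).2.2).1 _ hball
    _ ≤ _ := by
        rw [← Finset.sum_mul, ← mul_assoc, ← sq]
        gcongr
        exact inv_sq_mul_sum_le_ustat₂ (fun a b => lipBound_nonneg _ _ _ _ a b) hn
          (fun i => Z i ω)

end Normed

variable {p : ℕ} {f : EuclideanSpace ℝ (Fin p) → T → T → ℝ} {x₀ : EuclideanSpace ℝ (Fin p)}
  {C δ : ℝ}

/-- By Landau's inequality at x₀ the squared gradient is dominated by the integrable `lipBound`.
Square integrability is what the law of large numbers with rate requires of the gradient kernel. -/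
theorem memLp_fderiv_apply (h : SmoothFamily ν f x₀ C δ) (v : EuclideanSpace ℝ (Fin p)) :
    MemLp (fun z : T × T => fderiv ℝ (fun x => f x z.1 z.2) x₀ v) 2 (ν.prod ν) := by
  have hint : Integrable (fun z : T × T => fderiv ℝ (fun x => f x z.1 z.2) x₀ v) (ν.prod ν) :=
    h.gradient.1.apply_continuousLinearMap v
  rw [memLp_two_iff_integrable_sq hint.1]
  refine Integrable.mono' (h.integrable_lipBound.mul_const (‖v‖ ^ 2)) (hint.1.pow 2) ?_
  filter_upwards [h.ae_norm_le_hessBound] with z hz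
  have h1 := (h.diff z.1 z.2).sq_norm_fderiv_le h.pos hz (fun x => h.bound x _ _)
    (Metric.mem_ball_self (half_pos h.pos))
  rw [norm_pow]
  calc ‖fderiv ℝ (fun x => f x z.1 z.2) x₀ v‖ ^ 2
      ≤ (‖fderiv ℝ (fun x => f x z.1 z.2) x₀‖ * ‖v‖) ^ 2 :=
        pow_le_pow_left₀ (norm_nonneg _) (ContinuousLinearMap.le_opNorm _ _) 2
    _ ≤ _ := by
        rw [mul_pow]
        exact mul_le_mul_of_nonneg_right h1 (sq_nonneg _)

/-- Expansion of the U-statistic with an estimated parameter. -/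
theorem isBigOP_ustat₂_sub_sub (h : SmoothFamily ν f x₀ C δ) (hZ : IIDSample μ Z ν)
    (hm : Tendsto m l atTop) {xn : ℕ → Ω → EuclideanSpace ℝ (Fin p)}
    (hx : IsBigOP μ l (fun n ω => xn n ω - x₀) (fun n => (√(m n : ℝ))⁻¹)) :
    IsBigOP μ l (fun n ω => ustat₂ (f (xn n ω)) (m n) (fun i => Z i ω)
        - ustat₂ (f x₀) (m n) (fun i => Z i ω)
        - fderiv ℝ (fun x => ∫ z, f x z.1 z.2 ∂(ν.prod ν)) x₀ (xn n ω - x₀))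
      (fun n => (m n : ℝ)⁻¹) := by
  rw [h.gradient.2.fderiv]
  -- The gradient is split into coordinates, so that the law of large numbers for real kernels
  -- applies to each of them.
  set e : Fin p → EuclideanSpace ℝ (Fin p) := fun c => EuclideanSpace.single c 1 with he
  set D : Fin p → T → T → ℝ := fun c a b => fderiv ℝ (fun x => f x a b) x₀ (e c) with hD
  set θ : Fin p → ℝ := fun c => ∫ z, D c z.1 z.2 ∂(ν.prod ν) with hθ
  have hexp : ∀ (A : EuclideanSpace ℝ (Fin p) →L[ℝ] ℝ) (v : EuclideanSpace ℝ (Fin p)),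
      A v = ∑ c, v c * A (e c) := by
    intro A v
    conv_lhs => rw [← (EuclideanSpace.basisFun (Fin p) ℝ).sum_repr v]
    rw [map_sum]
    refine Finset.sum_congr rfl fun c _ => ?_
    simp [he]
  have hθe : ∀ c, (∫ z : T × T, fderiv ℝ (fun x => f x z.1 z.2) x₀ ∂(ν.prod ν)) (e c) = θ c :=
    fun c => ContinuousLinearMap.integral_apply h.gradient.1 (e c)
  have hcoord : ∀ c, IsBigOP μ l (fun n ω => (xn n ω - x₀) c) (fun n => (√(m n : ℝ))⁻¹) :=
    fun c => hx.of_ae_norm_le (Eventually.of_forall fun n => ae_of_all _ fun ω =>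
      PiLp.norm_apply_le _ c)
  -- Each summand is a product of two factors of order m^(-1/2): the error of the parameter and that
  -- of the averaged partial derivative.
  have hsum : IsBigOP μ l (fun n ω => ∑ c, (xn n ω - x₀) c
      * (ustat₂ (D c) (m n) (fun i => Z i ω) - θ c)) (fun n => (m n : ℝ)⁻¹) :=
    IsBigOP.sum _ fun c _ => ((hcoord c).mul (fun n => by positivity) (fun n => by positivity)
      (hZ.isBigOP_ustat₂_sub hm (h.memLp_fderiv_apply (e c)))).congr_rate (c := 1)
        (Eventually.of_forall fun n => by
          rw [one_mul, ← mul_inv, Real.mul_self_sqrt (by positivity)])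
  -- Second-order remainder: the averaged Hessian bound is `O_ℙ(1)`, the squared error of the
  -- parameter `O_ℙ(1 / m)`.
  have hH := hZ.isBigOP_ustat₂ hm (f := fun a b => hessBound f x₀ δ (a, b)) h.integrable_hessBound
  have hx2 := (hx.norm_of.mul (fun n => by positivity) (fun n => by positivity) hx.norm_of)
  have hrem := (hH.mul (fun _ => zero_le_one) (fun n => by positivity) hx2).congr_rate
    (s := fun n => (m n : ℝ)⁻¹) (c := 1) (Eventually.of_forall fun n => by
      rw [one_mul, one_mul, ← mul_inv, Real.mul_self_sqrt (by positivity)])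
  refine (hsum.norm_of.add hrem.norm_of).of_norm_le_off_ae
    (tendsto_measure_notMem_ball hm hx h.pos) ?_
  refine Eventually.of_forall fun n => ?_
  filter_upwards [h.ae_forall_pair hZ] with ω hω hball
  rw [not_not] at hball
  set v := xn n ω - x₀ with hv
  set z : ℕ → T := fun i => Z i ω with hz
  have hlin : ∑ c, v c * (ustat₂ (D c) (m n) z - θ c)
      = ustat₂ (fun a b => fderiv ℝ (fun x => f x a b) x₀ v) (m n) z
        - (∫ z : T × T, fderiv ℝ (fun x => f x z.1 z.2) x₀ ∂(ν.prod ν)) v := by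
    rw [hexp (∫ z : T × T, fderiv ℝ (fun x => f x z.1 z.2) x₀ ∂(ν.prod ν)) v]
    simp_rw [hθe, hexp _ v, mul_sub, Finset.sum_sub_distrib]
    congr 1
    simp_rw [ustat₂_eq]
    rw [Finset.sum_comm, Finset.mul_sum]
    refine Finset.sum_congr rfl fun c _ => ?_
    rw [← Finset.mul_sum]
    simp only [D]
    ring
  have hdiff : ustat₂ (f (xn n ω)) (m n) z - ustat₂ (f x₀) (m n) z
      - ustat₂ (fun a b => fderiv ℝ (fun x => f x a b) x₀ v) (m n) z
      = ustat₂ (fun a b => f (xn n ω) a b - f x₀ a b - fderiv ℝ (fun x => f x a b) x₀ v)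
        (m n) z := by
    rw [ustat₂_sub, ustat₂_sub]
  have hrembd : |ustat₂ (fun a b => f (xn n ω) a b - f x₀ a b
      - fderiv ℝ (fun x => f x a b) x₀ v) (m n) z|
      ≤ ustat₂ (fun a b => |hessBound f x₀ δ (a, b)|) (m n) z * (‖v‖ * ‖v‖) := by
    refine (abs_ustat₂_le _ _ _).trans ?_
    rw [mul_comm, ← ustat₂_const_mul]
    refine ustat₂_mono fun i j hij => ?_
    refine ((hω i j hij).2 _ hball).trans ?_
    rw [mul_comm, sq]
    exact mul_le_mul_of_nonneg_left (le_abs_self _) (by positivity)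
  have hsplit : ustat₂ (f (xn n ω)) (m n) z - ustat₂ (f x₀) (m n) z
      - (∫ z : T × T, fderiv ℝ (fun x => f x z.1 z.2) x₀ ∂(ν.prod ν)) v
      = ∑ c, v c * (ustat₂ (D c) (m n) z - θ c)
        + ustat₂ (fun a b => f (xn n ω) a b - f x₀ a b - fderiv ℝ (fun x => f x a b) x₀ v)
          (m n) z := by
    rw [← hdiff, hlin]
    ring
  rw [hsplit]
  refine le_trans ?_ (le_abs_self _)
  exact (norm_add_le _ _).trans (add_le_add le_rfl (hrembd.trans (le_abs_self _)))

end SmoothFamily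

end Parametric

/-! ### Consecutive pairs of an i.i.d. sample -/

section Pairs

variable {Ω T : Type*} [MeasurableSpace Ω] {μ : Measure Ω} [IsProbabilityMeasure μ]
  [MeasurableSpace T] {ν : Measure T} [IsProbabilityMeasure ν] {Z : ℕ → Ω → T}

/-- Disjoint blocks of an independent family are independent. The sample is reindexed by `ℕ × Fin
2`, and the joint law of the rows is found by currying the infinite product measure. -/
theorem IIDSample.pairs (h : IIDSample μ Z ν) :
    IIDSample μ (fun i ω => (Z (2 * i) ω, Z (2 * i + 1) ω)) (ν.prod ν) := by
  have hm : ∀ i, MeasurePreserving (fun ω => (Z (2 * i) ω, Z (2 * i + 1) ω)) μ (ν.prod ν) :=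
    fun i => h.measurePreserving_pair (by omega)
  refine ⟨fun i => (hm i).measurable, fun i => (hm i).map_eq, ?_⟩
  obtain ⟨W, hWdef⟩ : ∃ W : ℕ × Fin 2 → Ω → T, W = fun p => Z (2 * p.1 + p.2) := ⟨_, rfl⟩
  have hinj : Function.Injective fun p : ℕ × Fin 2 => 2 * p.1 + (p.2 : ℕ) := by
    rintro ⟨i, a⟩ ⟨j, b⟩ hab
    simp only at hab
    have ha := a.2
    have hb := b.2
    ext <;> simp only <;> omega
  have hWm : ∀ p, Measurable (W p) := fun p => hWdef ▸ h.measurable _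
  have hWlaw : ∀ p, μ.map (W p) = ν := fun p => hWdef ▸ h.law _
  have hW : iIndepFun W μ := hWdef ▸ h.iIndep.precomp hinj
  have hrow : ∀ i, μ.map (fun ω (j : Fin 2) => W (i, j) ω)
      = Measure.infinitePi fun _ : Fin 2 => ν := by
    intro i
    have : iIndepFun (fun j => W (i, j)) μ :=
      hW.precomp (g := fun j : Fin 2 => (i, j)) fun a b hab => (Prod.mk.inj hab).2
    rw [this.map_fun_eq_infinitePi_map fun j => hWm _]
    simp_rw [hWlaw]
  have hcurry : iIndepFun (fun i ω (j : Fin 2) => W (i, j) ω) μ := by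
    rw [iIndepFun_iff_map_fun_eq_infinitePi_map fun i => measurable_pi_iff.2 fun j => hWm _]
    simp_rw [hrow]
    have h1 := hW.map_fun_eq_infinitePi_map hWm
    simp_rw [hWlaw] at h1
    rw [← Measure.infinitePi_map_curry (fun (_ : ℕ) (_ : Fin 2) => ν), ← h1,
      Measure.map_map (by fun_prop) (measurable_pi_iff.2 hWm)]
    rfl
  have := hcurry.comp (fun _ w => (w 0, w 1)) (fun _ => by fun_prop)
  subst hWdef
  exact this

end Pairs

/-! ### Expectations of the kernels -/

section Expectations

variable {S B : Type*} [MeasurableSpace S] [MeasurableSpace B] {k : S → S → ℝ}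
  {P A : Measure S} [IsProbabilityMeasure P] [IsProbabilityMeasure A]
  {κ : Measure B} [IsProbabilityMeasure κ] {C : ℝ}

theorem measurable_meanEmbed (hk : CharacteristicKernel k) : Measurable (meanEmbed k P) :=
  measurable_proj hk.measurable

theorem abs_meanEmbed_le (hC : ∀ x y, |k x y| ≤ C) (x : S) : |meanEmbed k P x| ≤ C :=
  abs_proj_le hC x

theorem integral_comp_eq {x : B → S} (hx : MeasurePreserving x κ P) {f : S → ℝ}
    (hf : Measurable f) : ∫ b, f (x b) ∂κ = ∫ s, f s ∂P := by
  rw [← hx.map_eq, integral_map hx.measurable.aemeasurable hf.aestronglyMeasurable]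

theorem CharacteristicKernel.measurable_right (hk : CharacteristicKernel k) (s : S) :
    Measurable (k s) :=
  hk.measurable.comp (measurable_const.prodMk measurable_id)

theorem integral_kernel_comp (hk : CharacteristicKernel k) {x : B → S}
    (hx : MeasurePreserving x κ P) (s : S) : ∫ b, k s (x b) ∂κ = meanEmbed k P s :=
  integral_comp_eq hx (hk.measurable_right s)

theorem integrable_kernel_comp (hk : CharacteristicKernel k) (hC : ∀ x y, |k x y| ≤ C)
    {x : B → S} (hx : MeasurePreserving x κ P) (s : S) : Integrable (fun b => k s (x b)) κ :=
  integrable_of_abs_le ((hk.measurable_right s).comp hx.measurable) fun b => hC s (x b)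

/-- Every term of the kernel involves only one of x(b) and y(b), so only the marginal laws matter
and no independence of x and y is required. -/
theorem integral_hKer_right (hk : CharacteristicKernel k) {x y : B → S}
    (hx : MeasurePreserving x κ P) (hy : MeasurePreserving y κ A) (a : S × S) :
    ∫ b, hKer k a (x b, y b) ∂κ = meanEmbed k P a.1 - meanEmbed k A a.1
      - meanEmbed k P a.2 + meanEmbed k A a.2 := by
  obtain ⟨C, hC⟩ := hk.bounded
  simp only [hKer, hk.symm (x _) a.2]
  have i1 := integrable_kernel_comp hk hC hx a.1
  have i2 := integrable_kernel_comp hk hC hy a.1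
  have i3 := integrable_kernel_comp hk hC hx a.2
  have i4 := integrable_kernel_comp hk hC hy a.2
  rw [integral_add (f := fun b => k a.1 (x b) - k a.1 (y b) - k a.2 (x b))
    ((i1.sub i2).sub i3) i4, integral_sub (f := fun b => k a.1 (x b) - k a.1 (y b))
    (i1.sub i2) i3, integral_sub i1 i2]
  simp_rw [integral_kernel_comp hk hx, integral_kernel_comp hk hy]

theorem integral_qKer_right (hk : CharacteristicKernel k) {x₁ y₁ x₂ y₂ : B → S}
    (hx₁ : MeasurePreserving x₁ κ P) (hy₁ : MeasurePreserving y₁ κ A)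
    (hx₂ : MeasurePreserving x₂ κ P) (hy₂ : MeasurePreserving y₂ κ A)
    (a : (S × S) × (S × S)) :
    ∫ b, qKer k a ((x₁ b, y₁ b), (x₂ b, y₂ b)) ∂κ = meanEmbed k P a.1.1 - meanEmbed k P a.2.2
      - meanEmbed k A a.2.1 + meanEmbed k A a.1.2 := by
  obtain ⟨C, hC⟩ := hk.bounded
  simp only [qKer, hk.symm (x₂ _) a.2.2]
  have i1 := integrable_kernel_comp hk hC hx₁ a.1.1
  have i2 := integrable_kernel_comp hk hC hx₂ a.2.2
  have i3 := integrable_kernel_comp hk hC hy₂ a.2.1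
  have i4 := integrable_kernel_comp hk hC hy₁ a.1.2
  rw [integral_add (f := fun b => k a.1.1 (x₁ b) - k a.2.2 (x₂ b) - k a.2.1 (y₂ b))
    ((i1.sub i2).sub i3) i4, integral_sub (f := fun b => k a.1.1 (x₁ b) - k a.2.2 (x₂ b))
    (i1.sub i2) i3, integral_sub i1 i2]
  simp_rw [integral_kernel_comp hk hx₁, integral_kernel_comp hk hy₁, integral_kernel_comp hk hx₂,
    integral_kernel_comp hk hy₂]

/-- Fubini and the symmetry of k split the cross term into two halves, the form in which it arises
from the projections of `hKer` and `qKer`. -/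
theorem mmdSq_eq (hk : CharacteristicKernel k) :
    mmdSq k A P = ∫ s, meanEmbed k P s ∂P - ∫ s, meanEmbed k A s ∂P
      - ∫ s, meanEmbed k P s ∂A + ∫ s, meanEmbed k A s ∂A := by
  obtain ⟨C, hC⟩ := hk.bounded
  have hswap : ∫ s, meanEmbed k A s ∂P = ∫ s, meanEmbed k P s ∂A := by
    simp only [meanEmbed]
    rw [integral_integral_swap (integrable_of_abs_le hk.measurable fun z => hC z.1 z.2)]
    simp_rw [fun x y => hk.symm y x]
  change ∫ s, meanEmbed k A s ∂A - 2 * ∫ s, meanEmbed k P s ∂A + ∫ s, meanEmbed k P s ∂P = _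
  rw [hswap]
  ring

theorem integral_meanEmbed_comp (hk : CharacteristicKernel k) {x : B → S} {Q : Measure S}
    [IsProbabilityMeasure Q] (hx : MeasurePreserving x κ P) :
    ∫ b, meanEmbed k Q (x b) ∂κ = ∫ s, meanEmbed k Q s ∂P :=
  integral_comp_eq hx (measurable_meanEmbed hk)

theorem measurable_hKer (hk : CharacteristicKernel k) {D : Type*} [MeasurableSpace D]
    {a b : D → S × S} (ha : Measurable a) (hb : Measurable b) :
    Measurable fun d => hKer k (a d) (b d) := by
  have hm : ∀ {u v : D → S}, Measurable u → Measurable v → Measurable fun d => k (u d) (v d) :=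
    fun hu hv => hk.measurable.comp (hu.prodMk hv)
  exact (((hm ha.fst hb.fst).sub (hm ha.fst hb.snd)).sub (hm hb.fst ha.snd)).add
    (hm ha.snd hb.snd)

theorem measurable_qKer (hk : CharacteristicKernel k) {D : Type*} [MeasurableSpace D]
    {a b : D → (S × S) × (S × S)} (ha : Measurable a) (hb : Measurable b) :
    Measurable fun d => qKer k (a d) (b d) := by
  have hm : ∀ {u v : D → S}, Measurable u → Measurable v → Measurable fun d => k (u d) (v d) :=
    fun hu hv => hk.measurable.comp (hu.prodMk hv)
  exact (((hm ha.fst.fst hb.fst.fst).sub (hm hb.snd.fst ha.snd.snd)).sub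
    (hm ha.snd.fst hb.snd.snd)).add (hm ha.fst.snd hb.fst.snd)

theorem abs_hKer_le (hC : ∀ x y, |k x y| ≤ C) (a b : S × S) : |hKer k a b| ≤ 4 * C := by
  have h1 := hC a.1 b.1
  have h2 := hC a.1 b.2
  have h3 := hC b.1 a.2
  have h4 := hC a.2 b.2
  simp only [hKer, abs_le] at *
  constructor <;> linarith

theorem abs_qKer_le (hC : ∀ x y, |k x y| ≤ C) (a b : (S × S) × (S × S)) :
    |qKer k a b| ≤ 4 * C := by
  have h1 := hC a.1.1 b.1.1
  have h2 := hC b.2.1 a.2.2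
  have h3 := hC a.2.1 b.2.2
  have h4 := hC a.1.2 b.1.2
  simp only [qKer, abs_le] at *
  constructor <;> linarith

theorem hKer_symm (hk : CharacteristicKernel k) (a b : S × S) : hKer k a b = hKer k b a := by
  simp only [hKer, hk.symm a.1 b.1, hk.symm a.2 b.2]
  ring

theorem qKer_symm (hk : CharacteristicKernel k) (a b : (S × S) × (S × S)) :
    qKer k a b = qKer k b a := by
  simp only [qKer, hk.symm a.1.1 b.1.1, hk.symm a.1.2 b.1.2]
  ring

theorem integral_hKer (hk : CharacteristicKernel k) {x y : B → S}
    (hx : MeasurePreserving x κ P) (hy : MeasurePreserving y κ A) :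
    ∫ z : B × B, hKer k (x z.1, y z.1) (x z.2, y z.2) ∂(κ.prod κ) = mmdSq k A P := by
  obtain ⟨C, hC⟩ := hk.bounded
  have hxm := hx.measurable
  have hym := hy.measurable
  rw [integral_prod _ (integrable_of_abs_le (measurable_hKer hk (by fun_prop) (by fun_prop))
    fun z => abs_hKer_le hC _ _)]
  simp_rw [integral_hKer_right hk hx hy]
  have i : ∀ {Q R : Measure S} [IsProbabilityMeasure Q] [IsProbabilityMeasure R] {u : B → S},
      MeasurePreserving u κ R → Integrable (fun b => meanEmbed k Q (u b)) κ := fun {Q R _ _ u} hu =>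
    integrable_of_abs_le ((measurable_meanEmbed hk).comp hu.measurable)
      fun b => abs_meanEmbed_le hC _
  rw [integral_add (f := fun b => meanEmbed k P (x b) - meanEmbed k A (x b) - meanEmbed k P (y b))
    (((i hx).sub (i hx)).sub (i hy)) (i hy),
    integral_sub (f := fun b => meanEmbed k P (x b) - meanEmbed k A (x b))
    ((i hx).sub (i hx)) (i hy), integral_sub (i hx) (i hx), mmdSq_eq hk]
  simp_rw [integral_meanEmbed_comp hk hx, integral_meanEmbed_comp hk hy]

theorem integral_qKer (hk : CharacteristicKernel k) {x y : B → S}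
    (hx : MeasurePreserving x κ P) (hy : MeasurePreserving y κ A) :
    ∫ z : (B × B) × (B × B), qKer k ((x z.1.1, y z.1.1), (x z.1.2, y z.1.2))
      ((x z.2.1, y z.2.1), (x z.2.2, y z.2.2)) ∂((κ.prod κ).prod (κ.prod κ)) = mmdSq k A P := by
  obtain ⟨C, hC⟩ := hk.bounded
  have hxm := hx.measurable
  have hym := hy.measurable
  have hx₁ := hx.comp (measurePreserving_fst (μ := κ) (ν := κ))
  have hx₂ := hx.comp (measurePreserving_snd (μ := κ) (ν := κ))
  have hy₁ := hy.comp (measurePreserving_fst (μ := κ) (ν := κ))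
  have hy₂ := hy.comp (measurePreserving_snd (μ := κ) (ν := κ))
  rw [integral_prod _ (integrable_of_abs_le (measurable_qKer hk (by fun_prop) (by fun_prop))
    fun z => abs_qKer_le hC _ _)]
  have hr := integral_qKer_right hk hx₁ hy₁ hx₂ hy₂
  simp only [Function.comp_apply] at hr
  simp_rw [hr]
  have i : ∀ {Q R : Measure S} [IsProbabilityMeasure Q] [IsProbabilityMeasure R] {u : B × B → S},
      MeasurePreserving u (κ.prod κ) R → Integrable (fun b => meanEmbed k Q (u b)) (κ.prod κ) :=
    fun {Q R _ _ u} hu => integrable_of_abs_le ((measurable_meanEmbed hk).comp hu.measurable)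
      fun b => abs_meanEmbed_le hC _
  have e1 := integral_sub (i (Q := P) hx₁) (i (Q := P) hy₂)
  have e2 := integral_sub ((i (Q := P) hx₁).sub (i (Q := P) hy₂)) (i (Q := A) hx₂)
  have e3 := integral_add (((i (Q := P) hx₁).sub (i (Q := P) hy₂)).sub (i (Q := A) hx₂))
    (i (Q := A) hy₁)
  simp only [Pi.sub_apply, Function.comp_apply] at e1 e2 e3
  rw [e3, e2, e1, mmdSq_eq hk]
  have f1 := integral_meanEmbed_comp (Q := P) hk hx₁
  have f2 := integral_meanEmbed_comp (Q := P) hk hy₂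
  have f3 := integral_meanEmbed_comp (Q := A) hk hx₂
  have f4 := integral_meanEmbed_comp (Q := A) hk hy₁
  simp only [Function.comp_apply] at f1 f2 f3 f4
  rw [f1, f2, f3, f4]
  ring

/-- Positive definiteness of k at the 2n points xᵢ, yᵢ, with weights 1 on the xᵢ and -1 on the yᵢ.
-/
theorem sum_hKer_nonneg (hk : CharacteristicKernel k) (n : ℕ) (w : ℕ → S × S) :
    0 ≤ ∑ i ∈ Finset.range n, ∑ j ∈ Finset.range n, hKer k (w i) (w j) := by
  have h := hk.posDef (n + n)
    (Fin.append (fun i : Fin n => (w i).1) (fun i : Fin n => (w i).2))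
    (Fin.append (fun _ => 1) (fun _ => -1))
  simp only [Fin.sum_univ_add, Fin.append_left, Fin.append_right, Finset.sum_add_distrib] at h
  simp_rw [Finset.sum_range]
  refine h.trans (le_of_eq ?_)
  simp only [hKer, Finset.sum_add_distrib, Finset.sum_sub_distrib]
  simp only [one_mul, mul_one, mul_neg, neg_mul, neg_neg, Finset.sum_neg_distrib]
  have e : ∑ i : Fin n, ∑ j : Fin n, k (w j).1 (w i).2 = ∑ i : Fin n, ∑ j : Fin n,
      k (w i).2 (w j).1 := by simp_rw [fun i j : Fin n => hk.symm (w j).1 (w i).2]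
  rw [e]
  ring

/-- The squared MMD is nonnegative. -/
theorem mmdSq_nonneg (hk : CharacteristicKernel k) {Ω : Type*} [MeasurableSpace Ω]
    {μ : Measure Ω} [IsProbabilityMeasure μ] {Z : ℕ → Ω → B} (hZ : IIDSample μ Z κ)
    {x y : B → S} (hx : MeasurePreserving x κ P) (hy : MeasurePreserving y κ A) :
    0 ≤ mmdSq k A P := by
  obtain ⟨C, hC⟩ := hk.bounded
  have hxm := hx.measurable
  have hym := hy.measurable
  set f : B → B → ℝ := fun a b => hKer k (x a, y a) (x b, y b) with hf
  have hfm : Measurable fun z : B × B => f z.1 z.2 :=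
    measurable_hKer hk (by fun_prop) (by fun_prop)
  have hfi : Integrable (fun z : B × B => f z.1 z.2) (κ.prod κ) :=
    integrable_of_abs_le hfm fun z => abs_hKer_le hC _ _
  -- MMD² is the mean of the U-statistic, which is a nonnegative full double sum minus a diagonal of
  -- size at most 4C n, divided by n (n - 1). Letting n tend to infinity removes the diagonal; the
  -- sample serves only this argument.
  have hlow : ∀ n : ℕ, 2 ≤ n → -(4 * C) / ((n : ℝ) - 1) ≤ mmdSq k A P := by
    intro n hn
    have hn' : (2 : ℝ) ≤ n := by exact_mod_cast hn
    rw [← integral_hKer hk hx hy, ← hZ.integral_ustat₂ (f := f) hfi hn]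
    have : ∀ ω, -(4 * C) / ((n : ℝ) - 1) ≤ ustat₂ f n (fun i => Z i ω) := by
      intro ω
      have h1 := sum_hKer_nonneg hk n fun i => (x (Z i ω), y (Z i ω))
      have h2 : ∑ i ∈ Finset.range n, ∑ j ∈ Finset.range n, f (Z i ω) (Z j ω)
          = ∑ p ∈ (Finset.range n).offDiag, f (Z p.1 ω) (Z p.2 ω)
            + ∑ i ∈ Finset.range n, f (Z i ω) (Z i ω) := by
        rw [offDiag_sum_eq_sum_erase n fun i j => f (Z i ω) (Z j ω), ← Finset.sum_add_distrib]
        exact Finset.sum_congr rfl fun i hi => (Finset.sum_erase_add _ _ hi).symm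
      have h3 : ∑ i ∈ Finset.range n, f (Z i ω) (Z i ω) ≤ n * (4 * C) := by
        refine (Finset.sum_le_sum fun i _ =>
          (le_abs_self _).trans (abs_hKer_le hC _ _)).trans (le_of_eq ?_)
        rw [Finset.sum_const, Finset.card_range, nsmul_eq_mul]
      have h4 : -(n * (4 * C)) ≤ ∑ p ∈ (Finset.range n).offDiag, f (Z p.1 ω) (Z p.2 ω) := by
        have : 0 ≤ ∑ i ∈ Finset.range n, ∑ j ∈ Finset.range n, f (Z i ω) (Z j ω) := h1
        linarith
      rw [ustat₂_eq, inv_mul_eq_div, div_le_div_iff₀ (by linarith) (by nlinarith)]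
      nlinarith
    calc -(4 * C) / ((n : ℝ) - 1) = ∫ _, -(4 * C) / ((n : ℝ) - 1) ∂μ := by simp
      _ ≤ _ := integral_mono (integrable_const _) (hZ.integrable_ustat₂ hfi n) this
  have hlim : Tendsto (fun n : ℕ => -(4 * C) / ((n : ℝ) - 1)) atTop (𝓝 0) :=
    Tendsto.const_div_atTop (tendsto_atTop_add_const_right _ _ tendsto_natCast_atTop_atTop) _
  exact le_of_tendsto hlim (by
    filter_upwards [eventually_ge_atTop 2] with n hn using hlow n hn)

end Expectations

/-! ### The two models on the sample -/

section Models

variable {Ω S 𝒰 𝒱 : Type*} [MeasurableSpace Ω] [MeasurableSpace S] [MeasurableSpace 𝒰]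
  [MeasurableSpace 𝒱] {μ : Measure Ω} [IsProbabilityMeasure μ]
  {X : ℕ → Ω → S} {U : ℕ → Ω → 𝒰} {V : ℕ → Ω → 𝒱}
  {ρ : Measure (S × 𝒰 × 𝒱)} {P : Measure S} {PU : Measure 𝒰} {PV : Measure 𝒱}
  {k : S → S → ℝ}

theorem IIDSample.comp {T T' : Type*} [MeasurableSpace T] [MeasurableSpace T'] {ν : Measure T}
    {ν' : Measure T'} {Z : ℕ → Ω → T} (h : IIDSample μ Z ν) {g : T → T'}
    (hg : MeasurePreserving g ν ν') : IIDSample μ (fun i ω => g (Z i ω)) ν' where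
  measurable i := hg.measurable.comp (h.measurable i)
  law i := (hg.comp ⟨h.measurable i, h.law i⟩).map_eq
  iIndep := h.iIndep.comp (fun _ => g) fun _ => hg.measurable

theorem Sampling.sample (h : Sampling μ X U V ρ P PU PV) :
    IIDSample μ (fun i ω => (X i ω, U i ω, V i ω)) ρ where
  measurable i := (h.measurable_X i).prodMk ((h.measurable_U i).prodMk (h.measurable_V i))
  law := h.law
  iIndep := h.iIndep

theorem Sampling.indepFun_XU (h : Sampling μ X U V ρ P PU PV) (i j : ℕ) :
    IndepFun (X i) (U j) μ :=
  h.indep_U.comp (measurable_pi_apply i) (measurable_pi_apply j)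

theorem Sampling.indepFun_XV (h : Sampling μ X U V ρ P PU PV) (i j : ℕ) :
    IndepFun (X i) (V j) μ :=
  h.indep_V.comp (measurable_pi_apply i) (measurable_pi_apply j)

theorem Sampling.measurePreserving_fstModel (h : Sampling μ X U V ρ P PU PV) :
    MeasurePreserving fstModel ρ (P.prod PU) := by
  have hm : Measurable (fstModel : S × 𝒰 × 𝒱 → S × 𝒰) :=
    measurable_fst.prodMk measurable_snd.fst
  refine ⟨hm, ?_⟩
  rw [← h.law 0, Measure.map_map hm (h.sample.measurable 0), ← h.law_X 0, ← h.law_U 0,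
    ← (h.indepFun_XU 0 0).map_prod_eq_prod_map_map (h.measurable_X 0).aemeasurable
      (h.measurable_U 0).aemeasurable]
  rfl

theorem Sampling.measurePreserving_sndModel (h : Sampling μ X U V ρ P PU PV) :
    MeasurePreserving sndModel ρ (P.prod PV) := by
  have hm : Measurable (sndModel : S × 𝒰 × 𝒱 → S × 𝒱) :=
    measurable_fst.prodMk measurable_snd.snd
  refine ⟨hm, ?_⟩
  rw [← h.law 0, Measure.map_map hm (h.sample.measurable 0), ← h.law_X 0, ← h.law_V 0,
    ← (h.indepFun_XV 0 0).map_prod_eq_prod_map_map (h.measurable_X 0).aemeasurable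
      (h.measurable_V 0).aemeasurable]
  rfl

theorem Sampling.sample_fst (h : Sampling μ X U V ρ P PU PV) :
    IIDSample μ (fun i ω => (X i ω, U i ω)) (P.prod PU) :=
  h.sample.comp h.measurePreserving_fstModel

theorem Sampling.sample_snd (h : Sampling μ X U V ρ P PU PV) :
    IIDSample μ (fun i ω => (X i ω, V i ω)) (P.prod PV) :=
  h.sample.comp h.measurePreserving_sndModel

/-! ### One parametric model: kernels, expectations, derivatives, measurability -/

section OneModel

variable {E : Type*} [NormedAddCommGroup E] [NormedSpace ℝ E] [MeasurableSpace E]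
  {F : 𝒰 → E → S} {Θ : Set E} {αs : E} [IsProbabilityMeasure P] [IsProbabilityMeasure PU]

theorem RegularModel.measurable_at (h : RegularModel k P PU F Θ αs) {α : E} (hα : α ∈ Θ) :
    Measurable fun u => F u α :=
  h.measurable.comp (measurable_id.prodMk (measurable_const (a := (⟨α, hα⟩ : Θ))))

theorem RegularModel.mem (h : RegularModel k P PU F Θ αs) : αs ∈ Θ :=
  interior_subset h.mem_interior

omit [NormedAddCommGroup E] [NormedSpace ℝ E] [MeasurableSpace E] in
theorem measurePreserving_gen {α : E} (hF : Measurable fun u => F u α) :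
    MeasurePreserving (fun a : S × 𝒰 => F a.2 α) (P.prod PU) (modelLaw F PU α) :=
  (show MeasurePreserving (fun u => F u α) PU (modelLaw F PU α) from ⟨hF, rfl⟩).comp
    measurePreserving_snd

omit [NormedAddCommGroup E] [NormedSpace ℝ E] [MeasurableSpace E] in
theorem isProbabilityMeasure_modelLaw {α : E} (hF : Measurable fun u => F u α) :
    IsProbabilityMeasure (modelLaw F PU α) :=
  Measure.isProbabilityMeasure_map hF.aemeasurable

omit [NormedAddCommGroup E] [NormedSpace ℝ E] [MeasurableSpace E] in
theorem measurable_gen {α : E} (hF : Measurable fun u => F u α) :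
    Measurable (gen F α : S × 𝒰 → S × S) :=
  measurable_fst.prodMk (hF.comp measurable_snd)

theorem abs_h_le {S 𝒰 E : Type*} [MeasurableSpace S] {k : S → S → ℝ} {F : 𝒰 → E → S} {C : ℝ}
    (hC : ∀ x y, |k x y| ≤ C) (α : E) (a b : S × 𝒰) : |h k F α a b| ≤ 4 * C :=
  abs_hKer_le hC _ _

theorem abs_q_le {S 𝒰 E : Type*} [MeasurableSpace S] {k : S → S → ℝ} {F : 𝒰 → E → S} {C : ℝ}
    (hC : ∀ x y, |k x y| ≤ C) (α : E) (a b : (S × 𝒰) × (S × 𝒰)) : |q k F α a b| ≤ 4 * C :=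
  abs_qKer_le hC _ _

omit [NormedAddCommGroup E] [NormedSpace ℝ E] [MeasurableSpace E] in
theorem measurable_h (hk : CharacteristicKernel k) {α : E} (hF : Measurable fun u => F u α)
    {D : Type*} [MeasurableSpace D] {a b : D → S × 𝒰} (ha : Measurable a) (hb : Measurable b) :
    Measurable fun d => h k F α (a d) (b d) :=
  measurable_hKer hk ((measurable_gen hF).comp ha) ((measurable_gen hF).comp hb)

omit [NormedAddCommGroup E] [NormedSpace ℝ E] [MeasurableSpace E] in
theorem measurable_q (hk : CharacteristicKernel k) {α : E} (hF : Measurable fun u => F u α)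
    {D : Type*} [MeasurableSpace D] {a b : D → (S × 𝒰) × (S × 𝒰)} (ha : Measurable a)
    (hb : Measurable b) : Measurable fun d => q k F α (a d) (b d) :=
  measurable_qKer hk
    (((measurable_gen hF).comp ha.fst).prodMk ((measurable_gen hF).comp ha.snd))
    (((measurable_gen hF).comp hb.fst).prodMk ((measurable_gen hF).comp hb.snd))

theorem integral_h (hk : CharacteristicKernel k) {α : E} (hF : Measurable fun u => F u α) :
    ∫ z : (S × 𝒰) × (S × 𝒰), h k F α z.1 z.2 ∂((P.prod PU).prod (P.prod PU))
      = mmdSq k (modelLaw F PU α) P := by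
  have := isProbabilityMeasure_modelLaw (PU := PU) hF
  exact integral_hKer hk measurePreserving_fst (measurePreserving_gen hF)

theorem integral_q (hk : CharacteristicKernel k) {α : E} (hF : Measurable fun u => F u α) :
    ∫ z : ((S × 𝒰) × (S × 𝒰)) × ((S × 𝒰) × (S × 𝒰)), q k F α z.1 z.2
      ∂(((P.prod PU).prod (P.prod PU)).prod ((P.prod PU).prod (P.prod PU)))
      = mmdSq k (modelLaw F PU α) P := by
  have := isProbabilityMeasure_modelLaw (PU := PU) hF
  exact integral_qKer hk measurePreserving_fst (measurePreserving_gen hF)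

theorem TwiceDiffOn.const (c : ℝ) (s : Set E) : TwiceDiffOn (fun _ : E => c) s := by
  refine ⟨differentiableOn_const c, ?_⟩
  have : fderiv ℝ (fun _ : E => c) = fun _ => 0 := by
    ext x
    simp
  rw [this]
  exact differentiableOn_const _

theorem TwiceDiffOn.add {f g : E → ℝ} {s : Set E} (hs : IsOpen s) (hf : TwiceDiffOn f s)
    (hg : TwiceDiffOn g s) : TwiceDiffOn (fun x => f x + g x) s :=
  ⟨hf.1.add hg.1, (hf.2.add hg.2).congr fun _ hx =>
    fderiv_fun_add (hf.1.differentiableAt (hs.mem_nhds hx))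
      (hg.1.differentiableAt (hs.mem_nhds hx))⟩

theorem TwiceDiffOn.sub {f g : E → ℝ} {s : Set E} (hs : IsOpen s) (hf : TwiceDiffOn f s)
    (hg : TwiceDiffOn g s) : TwiceDiffOn (fun x => f x - g x) s :=
  ⟨hf.1.sub hg.1, (hf.2.sub hg.2).congr fun _ hx =>
    fderiv_fun_sub (hf.1.differentiableAt (hs.mem_nhds hx))
      (hg.1.differentiableAt (hs.mem_nhds hx))⟩

theorem DiffGenerator.twiceDiffOn_h (hd : DiffGenerator k F Θ) (a b : S × 𝒰) :
    TwiceDiffOn (fun α => h k F α a b) (interior Θ) :=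
  (((TwiceDiffOn.const (k a.1 b.1) _).sub isOpen_interior (hd.left a.1 b.2)).sub isOpen_interior
    (hd.left b.1 a.2)).add isOpen_interior (hd.both a.2 b.2)

theorem DiffGenerator.twiceDiffOn_q (hd : DiffGenerator k F Θ) (a b : (S × 𝒰) × (S × 𝒰)) :
    TwiceDiffOn (fun α => q k F α a b) (interior Θ) :=
  (((TwiceDiffOn.const (k a.1.1 b.1.1) _).sub isOpen_interior (hd.left b.2.1 a.2.2)).sub isOpen_interior
    (hd.left a.2.1 b.2.2)).add isOpen_interior (hd.both a.1.2 b.1.2)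

/-- The kernels are differentiable on the interior of Θ only; a ball included in Θ is open, hence
included in this interior. -/
theorem exists_smoothFamily {C : ℝ} (hC : ∀ x y, |k x y| ≤ C) (hd : DiffGenerator k F Θ)
    (hr : ResidualDeriv k P PU F Θ αs) :
    ∃ δ, SmoothFamily (P.prod PU) (h k F) αs (4 * C) δ ∧
      SmoothFamily ((P.prod PU).prod (P.prod PU)) (q k F) αs (4 * C) δ := by
  obtain ⟨δ, hδ, hball, hh, hq, _⟩ := hr.hessian
  have hint : Metric.ball αs δ ⊆ interior Θ := interior_maximal hball Metric.isOpen_ball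
  exact ⟨δ, ⟨hδ, abs_h_le hC, fun a b => (hd.twiceDiffOn_h a b).mono hint,
    hh, hr.gradient_h⟩, ⟨hδ, abs_q_le hC,
    fun a b => (hd.twiceDiffOn_q a b).mono hint, hq, hr.gradient_q⟩⟩

/-- The expectations of `h` and `q` are identified with MMD² only at parameters where F(·; α) is
measurable. That this holds near αs suffices to identify the derivatives at αs. -/
theorem RegularModel.eventually_measurable (h : RegularModel k P PU F Θ αs) :
    ∀ᶠ α in 𝓝 αs, Measurable fun u => F u α := by
  filter_upwards [mem_interior_iff_mem_nhds.1 h.mem_interior] with α hα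
    using h.measurable_at hα

theorem fderiv_integral_h (hk : CharacteristicKernel k) (hreg : RegularModel k P PU F Θ αs) :
    fderiv ℝ (fun α => ∫ z : (S × 𝒰) × (S × 𝒰), h k F α z.1 z.2
      ∂((P.prod PU).prod (P.prod PU))) αs
      = fderiv ℝ (fun α => mmdSq k (modelLaw F PU α) P) αs :=
  Filter.EventuallyEq.fderiv_eq <| hreg.eventually_measurable.mono fun _ hα => integral_h hk hα

theorem fderiv_integral_q (hk : CharacteristicKernel k) (hreg : RegularModel k P PU F Θ αs) :
    fderiv ℝ (fun α => ∫ z : ((S × 𝒰) × (S × 𝒰)) × ((S × 𝒰) × (S × 𝒰)), q k F α z.1 z.2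
      ∂(((P.prod PU).prod (P.prod PU)).prod ((P.prod PU).prod (P.prod PU)))) αs
      = fderiv ℝ (fun α => mmdSq k (modelLaw F PU α) P) αs :=
  Filter.EventuallyEq.fderiv_eq <| hreg.eventually_measurable.mono fun _ hα => integral_q hk hα

theorem Minimizes.fderiv_eq_zero (hreg : RegularModel k P PU F Θ αs)
    (h : Minimizes k P PU F Θ αs) :
    fderiv ℝ (fun α => mmdSq k (modelLaw F PU α) P) αs = 0 :=
  (h.isLocalMin (mem_interior_iff_mem_nhds.1 hreg.mem_interior)).fderiv_eq_zero

theorem mmdSq_self (hk : CharacteristicKernel k) : mmdSq k P P = 0 := by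
  rw [mmdSq_eq hk]
  ring

/-- A well-specified parameter attains the lower bound 0 of MMD². The sample is needed only for
`mmdSq_nonneg`. -/
theorem minimizes_of_modelLaw_eq (hk : CharacteristicKernel k)
    (hreg : RegularModel k P PU F Θ αs) {Z : ℕ → Ω → S × 𝒰} (hZ : IIDSample μ Z (P.prod PU))
    (heq : modelLaw F PU αs = P) : Minimizes k P PU F Θ αs := by
  intro α hα
  have hF := hreg.measurable_at hα
  have := isProbabilityMeasure_modelLaw (PU := PU) hF
  change mmdSq k (modelLaw F PU αs) P ≤ mmdSq k (modelLaw F PU α) P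
  rw [heq, mmdSq_self hk]
  exact mmdSq_nonneg hk hZ measurePreserving_fst (measurePreserving_gen hF)

/-- The component is dropped exactly when αs is a minimizer, in which case the gradient is zero and
the value of v is irrelevant. Both cases can thus be treated together. -/
theorem fderiv_zeroIf (hreg : RegularModel k P PU F Θ αs) (v : E) :
    fderiv ℝ (fun α => mmdSq k (modelLaw F PU α) P) αs (zeroIf (Minimizes k P PU F Θ αs) v)
      = fderiv ℝ (fun α => mmdSq k (modelLaw F PU α) P) αs v := by
  by_cases hmin : Minimizes k P PU F Θ αs
  · simp [hmin.fderiv_eq_zero hreg]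
  · simp [zeroIf, hmin]

theorem measurable_generator_comp (hreg : RegularModel k P PU F Θ αs) {U : Ω → 𝒰} {α : Ω → E}
    (hU : Measurable U) (hα : Measurable α) (hαΘ : ∀ ω, α ω ∈ Θ) :
    Measurable fun ω => F (U ω) (α ω) :=
  hreg.measurable.comp (hU.prodMk (hα.subtype_mk (h := hαΘ)))

theorem measurable_mmdHat (hk : CharacteristicKernel k) (hreg : RegularModel k P PU F Θ αs)
    {X : ℕ → Ω → S} {U : ℕ → Ω → 𝒰} (hX : ∀ i, Measurable (X i)) (hU : ∀ i, Measurable (U i))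
    {α : Ω → E} (hα : Measurable α) (hαΘ : ∀ ω, α ω ∈ Θ) (n : ℕ) :
    Measurable fun ω => mmdHat k F (α ω) n (fun i => (X i ω, U i ω)) := by
  refine measurable_ustat₂ (Z := fun i ω => (X i ω, U i ω)) (f := fun ω => h k F (α ω))
    (fun i j => ?_) n
  exact measurable_hKer hk ((hX i).prodMk (measurable_generator_comp hreg (hU i) hα hαΘ))
    ((hX j).prodMk (measurable_generator_comp hreg (hU j) hα hαΘ))

theorem measurable_mmdHatSplit (hk : CharacteristicKernel k) (hreg : RegularModel k P PU F Θ αs)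
    {X : ℕ → Ω → S} {U : ℕ → Ω → 𝒰} (hX : ∀ i, Measurable (X i)) (hU : ∀ i, Measurable (U i))
    {α : Ω → E} (hα : Measurable α) (hαΘ : ∀ ω, α ω ∈ Θ) (n : ℕ) :
    Measurable fun ω => mmdHatSplit k F (α ω) n (fun i => (X i ω, U i ω)) := by
  have hm : ∀ i, Measurable fun ω => (X i ω, F (U i ω) (α ω)) := fun i =>
    (hX i).prodMk (measurable_generator_comp hreg (hU i) hα hαΘ)
  exact measurable_ustat₂
    (Z := fun i ω => ((X (2 * i) ω, U (2 * i) ω), (X (2 * i + 1) ω, U (2 * i + 1) ω)))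
    (f := fun ω => q k F (α ω))
    (fun i j => measurable_qKer hk ((hm (2 * i)).prodMk (hm (2 * i + 1)))
      ((hm (2 * j)).prodMk (hm (2 * j + 1)))) (n / 2)

end OneModel

end Models

/-! ### Even sample sizes -/

section Even

instance neBot_evenAtTop : evenAtTop.NeBot := by
  refine (atTop_basis.inf_principal _).neBot_iff.2 fun {n} _ => ⟨2 * n, ?_, ?_⟩
  · simp only [Set.mem_Ici]
    omega
  · exact even_two_mul n

instance isCountablyGenerated_evenAtTop : evenAtTop.IsCountablyGenerated :=
  inferInstanceAs (atTop ⊓ 𝓟 {n : ℕ | Even n}).IsCountablyGenerated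

theorem evenAtTop_le : evenAtTop ≤ atTop := inf_le_left

theorem tendsto_evenAtTop : Tendsto (fun n : ℕ => n) evenAtTop atTop :=
  tendsto_id.mono_left evenAtTop_le

theorem tendsto_half_evenAtTop : Tendsto (fun n : ℕ => n / 2) evenAtTop atTop :=
  (Nat.tendsto_div_const_atTop two_ne_zero).mono_left evenAtTop_le

theorem eventually_eq_two_mul_half : ∀ᶠ n : ℕ in evenAtTop, (n : ℝ) = 2 * ((n / 2 : ℕ) : ℝ) := by
  have : ∀ᶠ n in evenAtTop, Even n :=
    mem_inf_of_right (mem_principal_self _)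
  filter_upwards [this] with n hn
  have : n = 2 * (n / 2) := (Nat.mul_div_cancel' hn.two_dvd).symm
  exact_mod_cast this

end Even

/-! ### Stochastic orders and convergence in law -/

section Law

variable {Ω Ω' : Type*} [MeasurableSpace Ω] [MeasurableSpace Ω'] {μ : Measure Ω}
  [IsProbabilityMeasure μ] {μ' : Measure Ω'} [IsProbabilityMeasure μ'] {l : Filter ℕ}

/-- Sequences that converge in law are stochastically bounded. -/
theorem isBigOP_one_of_tendstoInDistribution {E : Type*} [NormedAddCommGroup E]
    [MeasurableSpace E] [BorelSpace E] {Y : ℕ → Ω → E} {Z : Ω' → E}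
    (h : TendstoInDistribution Y l Z (fun _ => μ) μ') : IsBigOP μ l Y (fun _ => 1) := by
  intro ε hε
  have hZ := h.aemeasurable_limit
  have := Measure.isProbabilityMeasure_map (μ := μ') hZ
  -- The closed sets ‖x‖ ≥ M decrease to the empty set, so one of them has mass less than ε under
  -- the limit law; the portmanteau inequality for closed sets transfers this to the sequence.
  have hcl : ∀ M : ℕ, IsClosed {x : E | (M : ℝ) ≤ ‖x‖} := fun M =>
    isClosed_le continuous_const continuous_norm
  have hlim : Tendsto (fun M : ℕ => μ'.map Z {x : E | (M : ℝ) ≤ ‖x‖}) atTop (𝓝 0) := by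
    have h1 := tendsto_measure_iInter_atTop (μ := μ'.map Z)
      (s := fun M : ℕ => {x : E | (M : ℝ) ≤ ‖x‖})
      (fun M => (hcl M).measurableSet.nullMeasurableSet)
      (fun a b hab x hx => le_trans (b := (b : ℝ)) (Nat.cast_le.2 hab) hx) ⟨0, measure_ne_top _ _⟩
    have h2 : ⋂ M : ℕ, {x : E | (M : ℝ) ≤ ‖x‖} = ∅ := by
      ext x
      obtain ⟨M, hM⟩ := exists_nat_gt ‖x‖
      simpa using ⟨M, hM⟩
    rwa [h2, measure_empty] at h1
  obtain ⟨M, hM⟩ := (hlim.eventually_lt_const (ENNReal.ofReal_pos.2 hε)).exists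
  refine ⟨M, ?_⟩
  have h3 := ProbabilityMeasure.limsup_measure_closed_le_of_tendsto h.tendsto (hcl M)
  filter_upwards [eventually_lt_of_limsup_lt (h3.trans_lt hM)] with n hn
  refine le_trans ?_ hn.le
  change _ ≤ μ.map (Y n) _
  rw [Measure.map_apply_of_aemeasurable (h.forall_aemeasurable n) (hcl M).measurableSet]
  refine measure_mono fun ω hω => ?_
  simp only [mul_one, Set.mem_ofPred_eq] at hω
  exact hω.le

theorem IsBigOP.of_sqrt_smul {E : Type*} [NormedAddCommGroup E] [NormedSpace ℝ E]
    {Y : ℕ → Ω → E} {m : ℕ → ℕ} (hm : Tendsto m l atTop)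
    (h : IsBigOP μ l (fun n ω => √(m n : ℝ) • Y n ω) (fun _ => 1)) :
    IsBigOP μ l Y (fun n => (√(m n : ℝ))⁻¹) := by
  intro ε hε
  obtain ⟨M, hM⟩ := h ε hε
  refine ⟨M, ?_⟩
  filter_upwards [hM, hm.eventually_ge_atTop 1] with n hn hn1
  have hpos : 0 < √(m n : ℝ) := Real.sqrt_pos.2 (by exact_mod_cast hn1)
  refine (measure_mono fun ω hω => ?_).trans hn
  simp only [Set.mem_ofPred_eq, norm_smul, Real.norm_of_nonneg hpos.le, mul_one] at hω ⊢
  rwa [← div_eq_mul_inv, div_lt_iff₀' hpos] at hω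

theorem IsBigOP.sqrt_mul {Y : ℕ → Ω → ℝ} {m : ℕ → ℕ}
    (h : IsBigOP μ l Y (fun n => (m n : ℝ)⁻¹)) :
    IsBigOP μ l (fun n ω => √(m n : ℝ) * Y n ω) (fun n => (√(m n : ℝ))⁻¹) := by
  have h1 : IsBigOP μ l (fun n (_ : Ω) => √(m n : ℝ)) (fun n => √(m n : ℝ)) :=
    isBigOP_of_norm_le (C := 1) (Eventually.of_forall fun n ω => by
      rw [Real.norm_of_nonneg (Real.sqrt_nonneg _), one_mul])
  refine (h1.mul (fun n => Real.sqrt_nonneg _) (fun n => by positivity) h).congr_rate (c := 1)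
    (Eventually.of_forall fun n => ?_)
  rw [one_mul, ← div_eq_mul_inv, Real.sqrt_div_self', one_div]

theorem tendstoInDistribution_of_isBigOP_sub [l.IsCountablyGenerated] {X Y : ℕ → Ω → ℝ}
    {Z : Ω' → ℝ} {r : ℕ → ℝ} (h : TendstoInDistribution X l Z (fun _ => μ) μ')
    (hY : ∀ n, AEMeasurable (Y n) μ) (hr : Tendsto r l (𝓝 0))
    (hXY : IsBigOP μ l (fun n ω => Y n ω - X n ω) r) :
    TendstoInDistribution Y l Z (fun _ => μ) μ' :=
  tendstoInDistribution_of_tendstoInMeasure_sub Y Z h (hXY.tendstoInMeasure hr) hY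

end Law

/-! ### Expansions of the estimators of one model -/

section OneModel

variable {Ω S 𝒰 : Type*} [MeasurableSpace Ω] [MeasurableSpace S] [MeasurableSpace 𝒰]
  {μ : Measure Ω} [IsProbabilityMeasure μ] {P : Measure S} [IsProbabilityMeasure P]
  {PU : Measure 𝒰} [IsProbabilityMeasure PU] {k : S → S → ℝ} {p : ℕ}
  {F : 𝒰 → EuclideanSpace ℝ (Fin p) → S} {Θ : Set (EuclideanSpace ℝ (Fin p))}
  {αs : EuclideanSpace ℝ (Fin p)} {αn : ℕ → Ω → EuclideanSpace ℝ (Fin p)}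
  {Z : ℕ → Ω → S × 𝒰}

theorem half_rate {E : Type*} [NormedAddCommGroup E] {Y : ℕ → Ω → E}
    (h : IsBigOP μ evenAtTop Y (fun n => (((n / 2 : ℕ) : ℝ))⁻¹)) :
    IsBigOP μ evenAtTop Y (fun n => (n : ℝ)⁻¹) := by
  refine h.congr_rate (c := 2) (eventually_eq_two_mul_half.mono fun n hn => ?_)
  rw [hn, mul_inv]
  ring

theorem sqrt_half_rate {E : Type*} [NormedAddCommGroup E] {Y : ℕ → Ω → E}
    (h : IsBigOP μ evenAtTop Y (fun n => (√(n : ℝ))⁻¹)) :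
    IsBigOP μ evenAtTop Y (fun n => (√((n / 2 : ℕ) : ℝ))⁻¹) := by
  refine h.congr_rate (c := (√2)⁻¹) (eventually_eq_two_mul_half.mono fun n hn => ?_)
  rw [hn, Real.sqrt_mul zero_le_two, mul_inv]

variable (hk : CharacteristicKernel k) (hreg : RegularModel k P PU F Θ αs)
  (hd : DiffGenerator k F Θ) (hr : ResidualDeriv k P PU F Θ αs)
  (hZ : IIDSample μ Z (P.prod PU))
  (hα : IsBigOP μ evenAtTop (fun n ω => αn n ω - αs) (fun n => (√(n : ℝ))⁻¹))

include hk hd hr hZ hα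

theorem isBigOP_sqDist_h :
    IsBigOP μ evenAtTop (fun n ω => sqDist (h k F (αn n ω)) (h k F αs) n (fun i => Z i ω))
      (fun n => (n : ℝ)⁻¹) := by
  obtain ⟨C, hC⟩ := hk.bounded
  obtain ⟨δ, hδ, _⟩ := exists_smoothFamily hC hd hr
  exact hδ.isBigOP_sqDist hZ tendsto_evenAtTop hα

theorem isBigOP_sqDist_q :
    IsBigOP μ evenAtTop (fun n ω => sqDist (q k F (αn n ω)) (q k F αs) (n / 2)
      (pairs fun i => Z i ω)) (fun n => ((n / 2 : ℕ) : ℝ)⁻¹) := by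
  obtain ⟨C, hC⟩ := hk.bounded
  obtain ⟨δ, _, hδ⟩ := exists_smoothFamily hC hd hr
  exact hδ.isBigOP_sqDist hZ.pairs tendsto_half_evenAtTop (sqrt_half_rate hα)

include hreg

theorem isBigOP_mmdHat_sub_sub :
    IsBigOP μ evenAtTop (fun n ω => mmdHat k F (αn n ω) n (fun i => Z i ω)
        - mmdHat k F αs n (fun i => Z i ω)
        - fderiv ℝ (fun α => mmdSq k (modelLaw F PU α) P) αs (αn n ω - αs))
      (fun n => (n : ℝ)⁻¹) := by
  obtain ⟨C, hC⟩ := hk.bounded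
  obtain ⟨δ, hδ, _⟩ := exists_smoothFamily hC hd hr
  rw [← fderiv_integral_h hk hreg]
  exact hδ.isBigOP_ustat₂_sub_sub hZ tendsto_evenAtTop hα

theorem isBigOP_mmdHatSplit_sub_sub :
    IsBigOP μ evenAtTop (fun n ω => mmdHatSplit k F (αn n ω) n (fun i => Z i ω)
        - mmdHatSplit k F αs n (fun i => Z i ω)
        - fderiv ℝ (fun α => mmdSq k (modelLaw F PU α) P) αs (αn n ω - αs))
      (fun n => (n : ℝ)⁻¹) := by
  obtain ⟨C, hC⟩ := hk.bounded
  obtain ⟨δ, _, hδ⟩ := exists_smoothFamily hC hd hr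
  rw [← fderiv_integral_q hk hreg]
  exact half_rate (hδ.isBigOP_ustat₂_sub_sub hZ.pairs tendsto_half_evenAtTop (sqrt_half_rate hα))

end OneModel

/-! ### Kernels of the comparison of two models -/

theorem sqDist_sub_le {T : Type*} (f g f' g' : T → T → ℝ) (m : ℕ) (z : ℕ → T) :
    sqDist (fun a b => f a b - g a b) (fun a b => f' a b - g' a b) m z
      ≤ 2 * sqDist f f' m z + 2 * sqDist g g' m z := by
  simp only [sqDist]
  rw [mul_left_comm 2, mul_left_comm 2, ← mul_add]
  refine mul_le_mul_of_nonneg_left ?_ (by positivity)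
  rw [Finset.mul_sum, Finset.mul_sum, ← Finset.sum_add_distrib]
  refine Finset.sum_le_sum fun p _ => ?_
  nlinarith [sq_nonneg ((f (z p.1) (z p.2) - f' (z p.1) (z p.2))
    + (g (z p.1) (z p.2) - g' (z p.1) (z p.2)))]

/-- With c = 2 and c = 2√2 the factor c² is the 4 and the 8 in `sigmaHatSq` and `sigmaHatSqSplit`,
and the two terms are the limits of the two parts of these estimators. -/
theorem variance_const_mul_proj {T : Type*} [MeasurableSpace T] {ν : Measure T}
    [IsProbabilityMeasure ν] {f : T → T → ℝ} {C : ℝ} (hf : Measurable fun z : T × T => f z.1 z.2)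
    (hC : ∀ a b, |f a b| ≤ C) (c : ℝ) :
    variance (fun a => c * ∫ b, f a b ∂ν) ν
      = c ^ 2 * (∫ a, (∫ b, f a b ∂ν) ^ 2 ∂ν - (∫ z, f z.1 z.2 ∂(ν.prod ν)) ^ 2) := by
  have hm : MemLp (fun a => ∫ b, f a b ∂ν) 2 ν :=
    MemLp.of_bound (measurable_proj hf).aestronglyMeasurable C (ae_of_all _ (abs_proj_le hC))
  rw [variance_const_mul, variance_eq_sub hm,
    integral_prod _ (integrable_of_abs_le hf fun z => hC z.1 z.2)]
  rfl

section Comparison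

variable {Ω S 𝒰 𝒱 E E' : Type*} [MeasurableSpace Ω] [MeasurableSpace S] [MeasurableSpace 𝒰]
  [MeasurableSpace 𝒱] {μ : Measure Ω} [IsProbabilityMeasure μ]
  {X : ℕ → Ω → S} {U : ℕ → Ω → 𝒰} {V : ℕ → Ω → 𝒱}
  {ρ : Measure (S × 𝒰 × 𝒱)} {P : Measure S} {PU : Measure 𝒰} {PV : Measure 𝒱}
  [IsProbabilityMeasure ρ] [IsProbabilityMeasure P] [IsProbabilityMeasure PU]
  [IsProbabilityMeasure PV] {k : S → S → ℝ} {F : 𝒰 → E → S} {G : 𝒱 → E' → S} {α : E} {β : E'}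

theorem ustat₂_hDiff (n : ℕ) (z : ℕ → S × 𝒰 × 𝒱) :
    ustat₂ (hDiff k F G α β) n z = mmdHat k F α n (fun i => fstModel (z i))
      - mmdHat k G β n (fun i => sndModel (z i)) :=
  ustat₂_sub (fun a b => h k F α (fstModel a) (fstModel b))
    (fun a b => h k G β (sndModel a) (sndModel b)) n z

theorem ustat₂_qDiff (n : ℕ) (z : ℕ → S × 𝒰 × 𝒱) :
    ustat₂ (qDiff k F G α β) (n / 2) (pairs z) = mmdHatSplit k F α n (fun i => fstModel (z i))
      - mmdHatSplit k G β n (fun i => sndModel (z i)) := by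
  simp only [ustat₂_eq, mmdHatSplit, qDiff, pairs, Finset.sum_sub_distrib, mul_sub]

theorem abs_hDiff_le {C : ℝ} (hC : ∀ x y, |k x y| ≤ C) (a b : S × 𝒰 × 𝒱) :
    |hDiff k F G α β a b| ≤ 8 * C := by
  refine (abs_sub _ _).trans ((add_le_add (abs_h_le hC _ _ _) (abs_h_le hC _ _ _)).trans ?_)
  linarith

theorem abs_qDiff_le {C : ℝ} (hC : ∀ x y, |k x y| ≤ C)
    (a b : (S × 𝒰 × 𝒱) × (S × 𝒰 × 𝒱)) : |qDiff k F G α β a b| ≤ 8 * C := by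
  refine (abs_sub _ _).trans ((add_le_add (abs_q_le hC _ _ _) (abs_q_le hC _ _ _)).trans ?_)
  linarith

theorem hDiff_symm (hk : CharacteristicKernel k) (a b : S × 𝒰 × 𝒱) :
    hDiff k F G α β a b = hDiff k F G α β b a := by
  simp only [hDiff, h, hKer_symm hk (gen F α (fstModel a)), hKer_symm hk (gen G β (sndModel a))]

theorem qDiff_symm (hk : CharacteristicKernel k) (a b : (S × 𝒰 × 𝒱) × (S × 𝒰 × 𝒱)) :
    qDiff k F G α β a b = qDiff k F G α β b a :=
  congrArg₂ (· - ·) (qKer_symm hk _ _) (qKer_symm hk _ _)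

theorem measurable_fstModel : Measurable (fstModel : S × 𝒰 × 𝒱 → S × 𝒰) :=
  measurable_fst.prodMk measurable_snd.fst

theorem measurable_sndModel : Measurable (sndModel : S × 𝒰 × 𝒱 → S × 𝒱) :=
  measurable_fst.prodMk measurable_snd.snd

section Measurability

variable (hk : CharacteristicKernel k) (hF : Measurable fun u => F u α)
  (hG : Measurable fun v => G v β)

include hk hF hG

theorem measurable_hDiff :
    Measurable fun z : (S × 𝒰 × 𝒱) × (S × 𝒰 × 𝒱) => hDiff k F G α β z.1 z.2 :=
  (measurable_h hk hF (measurable_fstModel.comp measurable_fst)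
      (measurable_fstModel.comp measurable_snd)).sub
    (measurable_h hk hG (measurable_sndModel.comp measurable_fst)
      (measurable_sndModel.comp measurable_snd))

omit hG in
theorem measurable_q_fstModel :
    Measurable fun z : ((S × 𝒰 × 𝒱) × (S × 𝒰 × 𝒱)) × ((S × 𝒰 × 𝒱) × (S × 𝒰 × 𝒱)) =>
      q k F α (fstModel z.1.1, fstModel z.1.2) (fstModel z.2.1, fstModel z.2.2) :=
  measurable_q hk hF
    ((measurable_fstModel.comp measurable_fst.fst).prodMk
      (measurable_fstModel.comp measurable_fst.snd))
    ((measurable_fstModel.comp measurable_snd.fst).prodMk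
      (measurable_fstModel.comp measurable_snd.snd))

omit hF in
theorem measurable_q_sndModel :
    Measurable fun z : ((S × 𝒰 × 𝒱) × (S × 𝒰 × 𝒱)) × ((S × 𝒰 × 𝒱) × (S × 𝒰 × 𝒱)) =>
      q k G β (sndModel z.1.1, sndModel z.1.2) (sndModel z.2.1, sndModel z.2.2) :=
  measurable_q hk hG
    ((measurable_sndModel.comp measurable_fst.fst).prodMk
      (measurable_sndModel.comp measurable_fst.snd))
    ((measurable_sndModel.comp measurable_snd.fst).prodMk
      (measurable_sndModel.comp measurable_snd.snd))

theorem measurable_qDiff :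
    Measurable fun z : ((S × 𝒰 × 𝒱) × (S × 𝒰 × 𝒱)) × ((S × 𝒰 × 𝒱) × (S × 𝒰 × 𝒱)) =>
      qDiff k F G α β z.1 z.2 :=
  (measurable_q_fstModel hk hF).sub (measurable_q_sndModel hk hG)

variable (hs : Sampling μ X U V ρ P PU PV)

omit [IsProbabilityMeasure ρ] hk hG in
include hs in
theorem Sampling.measurePreserving_genF :
    MeasurePreserving (fun a : S × 𝒰 × 𝒱 => F a.2.1 α) ρ (modelLaw F PU α) :=
  (measurePreserving_gen (P := P) hF).comp hs.measurePreserving_fstModel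

omit [IsProbabilityMeasure ρ] hk hF in
include hs in
theorem Sampling.measurePreserving_genG :
    MeasurePreserving (fun a : S × 𝒰 × 𝒱 => G a.2.2 β) ρ (modelLaw G PV β) :=
  (measurePreserving_gen (P := P) hG).comp hs.measurePreserving_sndModel

omit [IsProbabilityMeasure ρ] hk hF hG in
include hs in
theorem Sampling.measurePreserving_X : MeasurePreserving (fun a : S × 𝒰 × 𝒱 => a.1) ρ P :=
  (measurePreserving_fst (μ := P) (ν := PU)).comp hs.measurePreserving_fstModel

include hs

theorem integral_hDiff_right (a : S × 𝒰 × 𝒱) :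
    ∫ b, hDiff k F G α β a b ∂ρ
      = (meanEmbed k P a.1 - meanEmbed k (modelLaw F PU α) a.1
          - meanEmbed k P (F a.2.1 α) + meanEmbed k (modelLaw F PU α) (F a.2.1 α))
        - (meanEmbed k P a.1 - meanEmbed k (modelLaw G PV β) a.1
          - meanEmbed k P (G a.2.2 β) + meanEmbed k (modelLaw G PV β) (G a.2.2 β)) := by
  have := isProbabilityMeasure_modelLaw (PU := PU) hF
  have := isProbabilityMeasure_modelLaw (PU := PV) hG
  obtain ⟨C, hC⟩ := hk.bounded
  have hx := hs.measurePreserving_X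
  have hyF := hs.measurePreserving_genF hF
  have hyG := hs.measurePreserving_genG hG
  have e1 := integral_hKer_right hk hx hyF (a.1, F a.2.1 α)
  have e2 := integral_hKer_right hk hx hyG (a.1, G a.2.2 β)
  rw [← e1, ← e2]
  exact integral_sub
    (integrable_of_abs_le (measurable_hKer hk measurable_const
      (hx.measurable.prodMk hyF.measurable)) fun b => abs_hKer_le hC _ _)
    (integrable_of_abs_le (measurable_hKer hk measurable_const
      (hx.measurable.prodMk hyG.measurable)) fun b => abs_hKer_le hC _ _)

theorem integral_qDiff_right (a : (S × 𝒰 × 𝒱) × (S × 𝒰 × 𝒱)) :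
    ∫ b, qDiff k F G α β a b ∂(ρ.prod ρ)
      = (meanEmbed k P a.1.1 - meanEmbed k P (F a.2.2.1 α)
          - meanEmbed k (modelLaw F PU α) a.2.1
          + meanEmbed k (modelLaw F PU α) (F a.1.2.1 α))
        - (meanEmbed k P a.1.1 - meanEmbed k P (G a.2.2.2 β)
          - meanEmbed k (modelLaw G PV β) a.2.1
          + meanEmbed k (modelLaw G PV β) (G a.1.2.2 β)) := by
  have := isProbabilityMeasure_modelLaw (PU := PU) hF
  have := isProbabilityMeasure_modelLaw (PU := PV) hG
  obtain ⟨C, hC⟩ := hk.bounded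
  have h1 := measurePreserving_fst (μ := ρ) (ν := ρ)
  have h2 := measurePreserving_snd (μ := ρ) (ν := ρ)
  have hx := hs.measurePreserving_X
  have hyF := hs.measurePreserving_genF hF
  have hyG := hs.measurePreserving_genG hG
  have e1 := integral_qKer_right hk (hx.comp h1) (hyF.comp h1) (hx.comp h2) (hyF.comp h2)
    ((a.1.1, F a.1.2.1 α), (a.2.1, F a.2.2.1 α))
  have e2 := integral_qKer_right hk (hx.comp h1) (hyG.comp h1) (hx.comp h2) (hyG.comp h2)
    ((a.1.1, G a.1.2.2 β), (a.2.1, G a.2.2.2 β))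
  rw [← e1, ← e2]
  exact integral_sub
    (integrable_of_abs_le (measurable_qKer hk measurable_const
      (((hx.comp h1).measurable.prodMk (hyF.comp h1).measurable).prodMk
        ((hx.comp h2).measurable.prodMk (hyF.comp h2).measurable))) fun b => abs_qKer_le hC _ _)
    (integrable_of_abs_le (measurable_qKer hk measurable_const
      (((hx.comp h1).measurable.prodMk (hyG.comp h1).measurable).prodMk
        ((hx.comp h2).measurable.prodMk (hyG.comp h2).measurable))) fun b => abs_qKer_le hC _ _)

theorem integral_hDiff :
    ∫ z : (S × 𝒰 × 𝒱) × (S × 𝒰 × 𝒱), hDiff k F G α β z.1 z.2 ∂(ρ.prod ρ)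
      = mmdSq k (modelLaw F PU α) P - mmdSq k (modelLaw G PV β) P := by
  have := isProbabilityMeasure_modelLaw (PU := PU) hF
  have := isProbabilityMeasure_modelLaw (PU := PV) hG
  obtain ⟨C, hC⟩ := hk.bounded
  have hx := hs.measurePreserving_X
  have hyF := hs.measurePreserving_genF hF
  have hyG := hs.measurePreserving_genG hG
  rw [← integral_hKer hk hx hyF, ← integral_hKer hk hx hyG]
  exact integral_sub
    (integrable_of_abs_le (measurable_h hk hF
      (measurable_fstModel.comp measurable_fst) (measurable_fstModel.comp measurable_snd)) fun _ => abs_h_le hC _ _ _)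
    (integrable_of_abs_le (measurable_h hk hG
      (measurable_sndModel.comp measurable_fst) (measurable_sndModel.comp measurable_snd)) fun _ => abs_h_le hC _ _ _)

theorem integral_qDiff :
    ∫ z : ((S × 𝒰 × 𝒱) × (S × 𝒰 × 𝒱)) × ((S × 𝒰 × 𝒱) × (S × 𝒰 × 𝒱)),
      qDiff k F G α β z.1 z.2 ∂((ρ.prod ρ).prod (ρ.prod ρ))
      = mmdSq k (modelLaw F PU α) P - mmdSq k (modelLaw G PV β) P := by
  have := isProbabilityMeasure_modelLaw (PU := PU) hF
  have := isProbabilityMeasure_modelLaw (PU := PV) hG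
  obtain ⟨C, hC⟩ := hk.bounded
  have hx := hs.measurePreserving_X
  have hyF := hs.measurePreserving_genF hF
  have hyG := hs.measurePreserving_genG hG
  have e1 := integral_qKer hk hx hyF
  have e2 := integral_qKer hk hx hyG
  have i1 := integrable_of_abs_le (κ := (ρ.prod ρ).prod (ρ.prod ρ)) (measurable_q_fstModel hk hF)
    fun _ => abs_q_le hC _ _ _
  have i2 := integrable_of_abs_le (κ := (ρ.prod ρ).prod (ρ.prod ρ)) (measurable_q_sndModel hk hG)
    fun _ => abs_q_le hC _ _ _
  rw [← e1, ← e2]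
  exact integral_sub i1 i2

/-- The kernel of the comparison is degenerate if both models are well specified. -/
theorem integral_hDiff_right_eq_zero (hFP : modelLaw F PU α = P) (hGP : modelLaw G PV β = P)
    (a : S × 𝒰 × 𝒱) : ∫ b, hDiff k F G α β a b ∂ρ = 0 := by
  rw [integral_hDiff_right hk hF hG hs, hFP, hGP]
  ring

end Measurability

end Comparison

/-! ### Positivity of the asymptotic variance of the split-sample comparison -/

section Positivity

variable {Ω S 𝒰 𝒱 : Type*} [MeasurableSpace Ω] [MeasurableSpace S] [MeasurableSpace 𝒰]
  [MeasurableSpace 𝒱] {μ : Measure Ω} [IsProbabilityMeasure μ]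
  {X : ℕ → Ω → S} {U : ℕ → Ω → 𝒰} {V : ℕ → Ω → 𝒱}
  {ρ : Measure (S × 𝒰 × 𝒱)} {P : Measure S} {PU : Measure 𝒰} {PV : Measure 𝒱}
  [IsProbabilityMeasure ρ] [IsProbabilityMeasure P] [IsProbabilityMeasure PU]
  [IsProbabilityMeasure PV] {k : S → S → ℝ}

theorem variance_comp_eq {T : Type*} [MeasurableSpace T] {ν : Measure T} {Y : Ω → T}
    (hY : MeasurePreserving Y μ ν) {f : T → ℝ} (hf : Measurable f) :
    variance f ν = variance (fun ω => f (Y ω)) μ := by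
  rw [← hY.map_eq, variance_map hf.aemeasurable hY.aemeasurable]
  rfl

theorem aeConst_of_variance_comp_eq_zero {f : S → ℝ} {C : ℝ} (hf : Measurable f)
    (hC : ∀ s, |f s| ≤ C) {Y : Ω → S} (hY : MeasurePreserving Y μ P)
    (h0 : variance (fun ω => f (Y ω)) μ = 0) : AEConst f P := by
  refine ⟨∫ s, f s ∂P, ae_eq_integral_of_variance_eq_zero
    (MemLp.of_bound hf.aestronglyMeasurable C (ae_of_all _ hC)) ?_⟩
  rwa [variance_comp_eq hY hf]

theorem AEConst.of_neg {f : S → ℝ} (h : AEConst (fun s => - f s) P) : AEConst f P := by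
  obtain ⟨c, hc⟩ := h
  exact ⟨-c, hc.mono fun s hs => by rw [← hs, neg_neg]⟩

theorem AEConst.mono_ac {f : S → ℝ} {Q : Measure S} (h : AEConst f Q) (hPQ : P ≪ Q) :
    AEConst f P := by
  obtain ⟨c, hc⟩ := h
  exact ⟨c, hPQ.ae_le hc⟩

/-- Variances add up over pairwise independent variables, and nonnegative numbers with sum zero all
vanish. -/
theorem variance_eq_zero_of_variance_sum_eq_zero {ι : Type*} [Fintype ι] {W : ι → Ω → ℝ}
    (hW : ∀ i, MemLp (W i) 2 μ) (hind : Pairwise fun i j => IndepFun (W i) (W j) μ)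
    (h0 : variance (fun ω => ∑ i, W i ω) μ = 0) (i : ι) : variance (W i) μ = 0 := by
  have h1 := IndepFun.variance_sum (μ := μ) (s := Finset.univ) (X := W) (fun i _ => hW i)
    fun i _ j _ hij => hind hij
  have h2 : (∑ i, W i) = fun ω => ∑ i, W i ω := by
    ext ω
    simp
  rw [h2, h0, eq_comm, Finset.sum_eq_zero_iff_of_nonneg fun i _ => variance_nonneg _ _] at h1
  exact h1 i (Finset.mem_univ i)

variable {E E' : Type*} [NormedAddCommGroup E] [NormedSpace ℝ E] [MeasurableSpace E]
  [NormedAddCommGroup E'] [NormedSpace ℝ E'] [MeasurableSpace E']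
  {F : 𝒰 → E → S} {G : 𝒱 → E' → S} {α : E} {β : E'}

omit [NormedAddCommGroup E] [NormedSpace ℝ E] [MeasurableSpace E]
  [NormedAddCommGroup E'] [NormedSpace ℝ E'] [MeasurableSpace E'] in
-- The projection of `qDiff` evaluates each mean embedding at a different input variable, and the
-- term common to both models, μ_P at the first observation, cancels. Its variance is therefore a
-- sum of five variances.
theorem aeConst_of_sigmaSqSplit_eq_zero (hk : CharacteristicKernel k)
    (hF : Measurable fun u => F u α) (hG : Measurable fun v => G v β)
    (hs : Sampling μ X U V ρ P PU PV)
    (hUV : IndepFun (fun ω i => U i ω) (fun ω i => V i ω) μ)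
    (h0 : sigmaSqSplit k F G α β ρ = 0) :
    AEConst (meanEmbed k P) (modelLaw F PU α) ∧
      AEConst (meanEmbed k P) (modelLaw G PV β) ∧
      AEConst (meanEmbed k (modelLaw F PU α)) (modelLaw F PU α) ∧
      AEConst (meanEmbed k (modelLaw G PV β)) (modelLaw G PV β) ∧
      AEConst (fun x => meanEmbed k (modelLaw F PU α) x - meanEmbed k (modelLaw G PV β) x) P := by
  have := isProbabilityMeasure_modelLaw (PU := PU) hF
  have := isProbabilityMeasure_modelLaw (PU := PV) hG
  obtain ⟨C, hC⟩ := hk.bounded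
  set A := modelLaw F PU α with hA
  set B := modelLaw G PV β with hB
  have mP : Measurable (meanEmbed k P) := measurable_meanEmbed hk
  have mA : Measurable (meanEmbed k A) := measurable_meanEmbed hk
  have mB : Measurable (meanEmbed k B) := measurable_meanEmbed hk
  have bP : ∀ s, |meanEmbed k P s| ≤ C := abs_meanEmbed_le hC
  have bA : ∀ s, |meanEmbed k A s| ≤ C := abs_meanEmbed_le hC
  have bB : ∀ s, |meanEmbed k B s| ≤ C := abs_meanEmbed_le hC
  have bAB : ∀ s, |-(meanEmbed k A s - meanEmbed k B s)| ≤ 2 * C := fun s => by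
    rw [abs_neg]
    exact (abs_sub _ _).trans (by linarith [bA s, bB s])
  have hmFu : ∀ i, MeasurePreserving (fun ω => F (U i ω) α) μ A := fun i =>
    (show MeasurePreserving (fun u => F u α) PU A from ⟨hF, rfl⟩).comp
      ⟨hs.measurable_U i, hs.law_U i⟩
  have hmGv : ∀ i, MeasurePreserving (fun ω => G (V i ω) β) μ B := fun i =>
    (show MeasurePreserving (fun v => G v β) PV B from ⟨hG, rfl⟩).comp
      ⟨hs.measurable_V i, hs.law_V i⟩
  have hmX : MeasurePreserving (X 1) μ P := ⟨hs.measurable_X 1, hs.law_X 1⟩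
  -- The five terms depend on U 0, V 0, V 1, U 1 and X 1 respectively.
  let W : Fin 5 → Ω → ℝ := ![fun ω => meanEmbed k A (F (U 0 ω) α),
    fun ω => -meanEmbed k B (G (V 0 ω) β), fun ω => meanEmbed k P (G (V 1 ω) β),
    fun ω => -meanEmbed k P (F (U 1 ω) α),
    fun ω => -(meanEmbed k A (X 1 ω) - meanEmbed k B (X 1 ω))]
  have hpair := hs.sample.measurePreserving_pair zero_ne_one
  have hsum : variance (fun ω => ∑ i, W i ω) μ = 0 := by
    have h1 : sigmaSqSplit k F G α β ρ = (2 * √2) ^ 2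
        * variance (fun a => ∫ b, qDiff k F G α β a b ∂(ρ.prod ρ)) (ρ.prod ρ) :=
      variance_const_mul _ _ _
    have h2 : variance (fun a => ∫ b, qDiff k F G α β a b ∂(ρ.prod ρ)) (ρ.prod ρ)
        = variance (fun ω => ∑ i, W i ω) μ := by
      rw [variance_comp_eq hpair (measurable_proj (measurable_qDiff hk hF hG))]
      congr 1
      ext ω
      rw [integral_qDiff_right hk hF hG hs, Fin.sum_univ_five]
      simp only [W, Matrix.cons_val]
      ring
    rw [h0, h2] at h1
    have h3 : (2 * √2) ^ 2 ≠ 0 := by positivity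
    exact (mul_eq_zero.1 h1.symm).resolve_left h3
  have memLp : ∀ {f : S → ℝ} {c : ℝ} {Y : Ω → S}, Measurable f → (∀ s, |f s| ≤ c) →
      Measurable Y → MemLp (fun ω => f (Y ω)) 2 μ := fun {f c Y} hf hc hY =>
    MemLp.of_bound (hf.comp hY).aestronglyMeasurable c (ae_of_all _ fun _ => hc _)
  have hW : ∀ i, MemLp (W i) 2 μ := by
    intro i
    fin_cases i
    · exact memLp mA bA (hmFu 0).measurable
    · exact (memLp mB bB (hmGv 0).measurable).neg
    · exact memLp mP bP (hmGv 1).measurable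
    · exact (memLp mP bP (hmFu 1).measurable).neg
    · exact memLp (f := fun s => -(meanEmbed k A s - meanEmbed k B s)) (mA.sub mB).neg bAB
        hmX.measurable
  have hUVi : ∀ i j, IndepFun (U i) (V j) μ := fun i j =>
    hUV.comp (measurable_pi_apply i) (measurable_pi_apply j)
  have h01 := hs.iIndep.indepFun (zero_ne_one (α := ℕ))
  have hUU : IndepFun (U 0) (U 1) μ := h01.comp (φ := fun a : S × 𝒰 × 𝒱 => a.2.1)
    (ψ := fun a : S × 𝒰 × 𝒱 => a.2.1)
    measurable_snd.fst measurable_snd.fst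
  have hVV : IndepFun (V 0) (V 1) μ := h01.comp (φ := fun a : S × 𝒰 × 𝒱 => a.2.2)
    (ψ := fun a : S × 𝒰 × 𝒱 => a.2.2)
    measurable_snd.snd measurable_snd.snd
  have f0 : Measurable fun u => meanEmbed k A (F u α) := mA.comp hF
  have f1 : Measurable fun v => -meanEmbed k B (G v β) := (mB.comp hG).neg
  have f2 : Measurable fun v => meanEmbed k P (G v β) := mP.comp hG
  have f3 : Measurable fun u => -meanEmbed k P (F u α) := (mP.comp hF).neg
  have f4 : Measurable fun x => -(meanEmbed k A x - meanEmbed k B x) := (mA.sub mB).neg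
  -- The ten pairs use three sources: independence of the samples (Uᵢ) and (Vᵢ), independence of
  -- each of them from (Xᵢ), and independence of different observations.
  have hlt : ∀ i j, i < j → IndepFun (W i) (W j) μ := by
    intro i j hij
    fin_cases i <;> fin_cases j <;> first
      | exact absurd hij (by decide)
      | exact (hUVi 0 0).comp f0 f1
      | exact (hUVi 0 1).comp f0 f2
      | exact hUU.comp f0 f3
      | exact (hs.indepFun_XU 1 0).symm.comp f0 f4
      | exact hVV.comp f1 f2
      | exact (hUVi 1 0).symm.comp f1 f3
      | exact (hs.indepFun_XV 1 0).symm.comp f1 f4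
      | exact (hUVi 1 1).symm.comp f2 f3
      | exact (hs.indepFun_XV 1 1).symm.comp f2 f4
      | exact (hs.indepFun_XU 1 1).symm.comp f3 f4
  have hvar := variance_eq_zero_of_variance_sum_eq_zero hW (fun i j hij =>
    hij.lt_or_gt.elim (hlt i j) fun h => (hlt j i h).symm) hsum
  refine ⟨AEConst.of_neg ?_, ?_, ?_, AEConst.of_neg ?_, AEConst.of_neg ?_⟩
  · exact aeConst_of_variance_comp_eq_zero mP.neg (fun s => (abs_neg _).trans_le (bP s))
      (hmFu 1) (hvar 3)
  · exact aeConst_of_variance_comp_eq_zero mP bP (hmGv 1) (hvar 2)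
  · exact aeConst_of_variance_comp_eq_zero mA bA (hmFu 0) (hvar 0)
  · exact aeConst_of_variance_comp_eq_zero mB.neg (fun s => (abs_neg _).trans_le (bB s))
      (hmGv 0) (hvar 1)
  · exact aeConst_of_variance_comp_eq_zero (mA.sub mB).neg bAB hmX (hvar 4)

/-- Constancy under the law of the model passes to P by absolute continuity, where regularity of the
model excludes it. -/
theorem RegularModel.not_aeConst_modelLaw (hk : CharacteristicKernel k) {Θ : Set E} {αs : E}
    (hreg : RegularModel k P PU F Θ αs) (hac : P ≪ modelLaw F PU αs) :
    ¬ AEConst (meanEmbed k (modelLaw F PU αs)) (modelLaw F PU αs) := by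
  intro h
  have hF := hreg.measurable_at hreg.mem
  refine hreg.not_aeConst ?_
  have : (fun x => ∫ u, k x (F u αs) ∂PU) = meanEmbed k (modelLaw F PU αs) := by
    ext x
    have := isProbabilityMeasure_modelLaw (PU := PU) hF
    exact integral_kernel_comp hk (show MeasurePreserving (fun u => F u αs) PU (modelLaw F PU αs) from ⟨hF, rfl⟩) x
  rw [this]
  exact h.mono_ac hac

end Positivity

/-! ### Rates of the estimators -/

section Rates

variable {Ω : Type*} [MeasurableSpace Ω] {μ : Measure Ω} [IsProbabilityMeasure μ] {l : Filter ℕ}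

/-- The joint convergence bounds the component when it is kept, and the separate hypothesis bounds
it when it is dropped. -/
theorem IsBigOP.of_zeroIf {E : Type*} [NormedAddCommGroup E] {Y : ℕ → Ω → E} {r : ℕ → ℝ}
    {p : Prop} (h : IsBigOP μ l (fun n ω => zeroIf p (Y n ω)) r) (h' : p → IsBigOP μ l Y r) :
    IsBigOP μ l Y r := by
  by_cases hp : p
  · exact h' hp
  · simpa [zeroIf, hp] using h

theorem IsBigOP.clm_apply {E : Type*} [NormedAddCommGroup E] [NormedSpace ℝ E] {Y : ℕ → Ω → E}
    {r : ℕ → ℝ} (h : IsBigOP μ l Y r) (D : E →L[ℝ] ℝ) : IsBigOP μ l (fun n ω => D (Y n ω)) r :=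
  (h.norm_of.const_mul ‖D‖).of_ae_norm_le (Eventually.of_forall fun n => ae_of_all _ fun ω => by
    simpa using D.le_opNorm (Y n ω))

theorem IsBigOP.sub {Y Y' : ℕ → Ω → ℝ} {r : ℕ → ℝ} (h : IsBigOP μ l Y r)
    (h' : IsBigOP μ l Y' r) : IsBigOP μ l (fun n ω => Y n ω - Y' n ω) r := by
  simpa only [neg_one_mul, ← sub_eq_add_neg] using h.add (h'.const_mul (-1))

theorem IsBigOP.tendstoInMeasure_const {Y : ℕ → Ω → ℝ} {r : ℕ → ℝ} {c : ℝ}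
    (h : IsBigOP μ l (fun n ω => Y n ω - c) r) (hr : Tendsto r l (𝓝 0)) :
    TendstoInMeasure μ Y l (fun _ => c) := by
  have h1 := h.tendstoInMeasure hr
  rw [tendstoInMeasure_iff_norm] at h1 ⊢
  simpa only [sub_zero] using h1

/-- From Y² - c² = (Y - c)² + 2c (Y - c). -/
theorem IsBigOP.sq_sub_sq {Y : ℕ → Ω → ℝ} {m : ℕ → ℕ} {c : ℝ} (hm : Tendsto m l atTop)
    (h : IsBigOP μ l (fun n ω => Y n ω - c) (fun n => (√(m n : ℝ))⁻¹)) :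
    IsBigOP μ l (fun n ω => Y n ω ^ 2 - c ^ 2) (fun n => (√(m n : ℝ))⁻¹) := by
  have h1 := (h.mul (fun n => by positivity) (fun n => by positivity) h).congr_rate (c := 1)
    (s := fun n => (m n : ℝ)⁻¹) (Eventually.of_forall fun n => by
      rw [one_mul, ← mul_inv, Real.mul_self_sqrt (by positivity)])
  have h2 := (h1.mono_rate (fun n => by positivity) (inv_le_inv_sqrt hm)).add
    (h.const_mul (2 * c))
  refine h2.of_ae_norm_le (Eventually.of_forall fun n => ae_of_all _ fun ω => le_of_eq ?_)
  congr 1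
  ring

end Rates

/-! ### Rate of the estimated MMD of one model -/

section OneModel

variable {Ω S 𝒰 : Type*} [MeasurableSpace Ω] [MeasurableSpace S] [MeasurableSpace 𝒰]
  {μ : Measure Ω} [IsProbabilityMeasure μ] {P : Measure S} [IsProbabilityMeasure P]
  {PU : Measure 𝒰} [IsProbabilityMeasure PU] {k : S → S → ℝ} {p : ℕ}
  {F : 𝒰 → EuclideanSpace ℝ (Fin p) → S} {Θ : Set (EuclideanSpace ℝ (Fin p))}
  {αs : EuclideanSpace ℝ (Fin p)} {αn : ℕ → Ω → EuclideanSpace ℝ (Fin p)}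
  {Z : ℕ → Ω → S × 𝒰}

theorem isBigOP_mmdHat_sub (hk : CharacteristicKernel k) (hreg : RegularModel k P PU F Θ αs)
    (hd : DiffGenerator k F Θ) (hr : ResidualDeriv k P PU F Θ αs)
    (hZ : IIDSample μ Z (P.prod PU))
    (hα : IsBigOP μ evenAtTop (fun n ω => αn n ω - αs) (fun n => (√(n : ℝ))⁻¹)) :
    IsBigOP μ evenAtTop (fun n ω => mmdHat k F (αn n ω) n (fun i => Z i ω)
      - mmdSq k (modelLaw F PU αs) P) (fun n => (√(n : ℝ))⁻¹) := by
  obtain ⟨C, hC⟩ := hk.bounded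
  have hF := hreg.measurable_at hreg.mem
  have h1 := (isBigOP_mmdHat_sub_sub hk hreg hd hr hZ hα).mono_rate (fun n => by positivity)
    (inv_le_inv_sqrt tendsto_evenAtTop)
  have h2 := hZ.isBigOP_ustat₂_sub tendsto_evenAtTop
    (IIDSample.memLp_of_bounded (measurable_h hk hF measurable_fst measurable_snd) (abs_h_le hC αs))
  rw [integral_h hk hF] at h2
  refine ((h1.add h2).add (hα.clm_apply (fderiv ℝ (fun α => mmdSq k (modelLaw F PU α) P)
    αs))).of_ae_norm_le (Eventually.of_forall fun n => ae_of_all _ fun ω => le_of_eq ?_)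
  congr 1
  simp only [mmdHat]
  ring

/-- Both first-order terms of the expansion vanish: the gradient, because αs is a minimizer, and the
projection of the kernel, because the two mean embeddings coincide. -/
theorem isBigOP_mmdHat_of_modelLaw_eq (hk : CharacteristicKernel k)
    (hreg : RegularModel k P PU F Θ αs)
    (hd : DiffGenerator k F Θ) (hr : ResidualDeriv k P PU F Θ αs)
    (hZ : IIDSample μ Z (P.prod PU))
    (hα : IsBigOP μ evenAtTop (fun n ω => αn n ω - αs) (fun n => (√(n : ℝ))⁻¹))
    (heq : modelLaw F PU αs = P) :
    IsBigOP μ evenAtTop (fun n ω => mmdHat k F (αn n ω) n (fun i => Z i ω))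
      (fun n => (n : ℝ)⁻¹) := by
  obtain ⟨C, hC⟩ := hk.bounded
  have hF := hreg.measurable_at hreg.mem
  have h1 := isBigOP_mmdHat_sub_sub hk hreg hd hr hZ hα
  rw [(minimizes_of_modelLaw_eq hk hreg hZ heq).fderiv_eq_zero hreg] at h1
  have hmp := measurePreserving_gen (P := P) (PU := PU) hF
  rw [heq] at hmp
  have h2 := hZ.isBigOP_ustat₂_of_degenerate tendsto_evenAtTop
    (measurable_h hk hF measurable_fst measurable_snd) (abs_h_le hC αs)
    (fun a b => hKer_symm hk _ _) (fun a => by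
      refine (integral_hKer_right hk measurePreserving_fst hmp (gen F αs a)).trans ?_
      ring)
  refine (h1.add h2).of_ae_norm_le (Eventually.of_forall fun n => ae_of_all _ fun ω => le_of_eq ?_)
  congr 1
  simp only [mmdHat, zero_apply]
  ring

end OneModel

theorem sqDist_qDiff_le {S 𝒰 𝒱 E E' : Type*} {k : S → S → ℝ} {F : 𝒰 → E → S} {G : 𝒱 → E' → S}
    (α α' : E) (β β' : E') (m : ℕ) (z : ℕ → S × 𝒰 × 𝒱) :
    sqDist (qDiff k F G α β) (qDiff k F G α' β') m (pairs z)
      ≤ 2 * sqDist (q k F α) (q k F α') m (pairs fun i => fstModel (z i))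
        + 2 * sqDist (q k G β) (q k G β') m (pairs fun i => sndModel (z i)) := by
  have := sqDist_sub_le
    (fun a b => q k F α (fstModel a.1, fstModel a.2) (fstModel b.1, fstModel b.2))
    (fun a b => q k G β (sndModel a.1, sndModel a.2) (sndModel b.1, sndModel b.2))
    (fun a b => q k F α' (fstModel a.1, fstModel a.2) (fstModel b.1, fstModel b.2))
    (fun a b => q k G β' (sndModel a.1, sndModel a.2) (sndModel b.1, sndModel b.2)) m (pairs z)
  simpa only [sqDist, qDiff, pairs] using this

/-! ### Difference of the two estimators and consistency of the variance estimators -/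

section TwoModels

variable {Ω S 𝒰 𝒱 : Type*} [MeasurableSpace Ω] [MeasurableSpace S] [MeasurableSpace 𝒰]
  [MeasurableSpace 𝒱] {μ : Measure Ω} [IsProbabilityMeasure μ]
  {X : ℕ → Ω → S} {U : ℕ → Ω → 𝒰} {V : ℕ → Ω → 𝒱}
  {ρ : Measure (S × 𝒰 × 𝒱)} {P : Measure S} {PU : Measure 𝒰} {PV : Measure 𝒱}
  [IsProbabilityMeasure ρ] [IsProbabilityMeasure P] [IsProbabilityMeasure PU]
  [IsProbabilityMeasure PV] {k : S → S → ℝ} {p₁ p₂ : ℕ}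
  {Θ₁ : Set (EuclideanSpace ℝ (Fin p₁))} {Θ₂ : Set (EuclideanSpace ℝ (Fin p₂))}
  {F : 𝒰 → EuclideanSpace ℝ (Fin p₁) → S} {G : 𝒱 → EuclideanSpace ℝ (Fin p₂) → S}
  {αs : EuclideanSpace ℝ (Fin p₁)} {βs : EuclideanSpace ℝ (Fin p₂)}
  {αn : ℕ → Ω → EuclideanSpace ℝ (Fin p₁)} {βn : ℕ → Ω → EuclideanSpace ℝ (Fin p₂)}
  (hk : CharacteristicKernel k) (hs : Sampling μ X U V ρ P PU PV)
  (hreg₁ : RegularModel k P PU F Θ₁ αs) (hreg₂ : RegularModel k P PV G Θ₂ βs)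
  (hd₁ : DiffGenerator k F Θ₁) (hd₂ : DiffGenerator k G Θ₂)
  (hr₁ : ResidualDeriv k P PU F Θ₁ αs) (hr₂ : ResidualDeriv k P PV G Θ₂ βs)
  (hα : IsBigOP μ evenAtTop (fun n ω => αn n ω - αs) (fun n => (√(n : ℝ))⁻¹))
  (hβ : IsBigOP μ evenAtTop (fun n ω => βn n ω - βs) (fun n => (√(n : ℝ))⁻¹))

include hk hs hd₁ hd₂ hr₁ hr₂ hα hβ

theorem isBigOP_sqDist_hDiff :
    IsBigOP μ evenAtTop (fun n ω => sqDist (hDiff k F G (αn n ω) (βn n ω)) (hDiff k F G αs βs) n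
      (fun i => (X i ω, U i ω, V i ω))) (fun n => (n : ℝ)⁻¹) := by
  have h1 := isBigOP_sqDist_h hk hd₁ hr₁ hs.sample_fst hα
  have h2 := isBigOP_sqDist_h hk hd₂ hr₂ hs.sample_snd hβ
  refine ((h1.const_mul 2).add (h2.const_mul 2)).of_ae_norm_le
    (Eventually.of_forall fun n => ae_of_all _ fun ω => ?_)
  rw [Real.norm_of_nonneg (sqDist_nonneg _ _ _ _)]
  exact (sqDist_sub_le (fun a b => h k F (αn n ω) (fstModel a) (fstModel b))
    (fun a b => h k G (βn n ω) (sndModel a) (sndModel b))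
    (fun a b => h k F αs (fstModel a) (fstModel b))
    (fun a b => h k G βs (sndModel a) (sndModel b)) n _).trans (le_abs_self _)

theorem isBigOP_sqDist_qDiff :
    IsBigOP μ evenAtTop (fun n ω => sqDist (qDiff k F G (αn n ω) (βn n ω)) (qDiff k F G αs βs)
      (n / 2) (pairs fun i => (X i ω, U i ω, V i ω))) (fun n => ((n / 2 : ℕ) : ℝ)⁻¹) := by
  have h1 := isBigOP_sqDist_q hk hd₁ hr₁ hs.sample_fst hα
  have h2 := isBigOP_sqDist_q hk hd₂ hr₂ hs.sample_snd hβ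
  refine ((h1.const_mul 2).add (h2.const_mul 2)).of_ae_norm_le
    (Eventually.of_forall fun n => ae_of_all _ fun ω => ?_)
  rw [Real.norm_of_nonneg (sqDist_nonneg _ _ _ _)]
  exact (sqDist_qDiff_le _ _ _ _ (n / 2) _).trans (le_abs_self _)

include hreg₁ hreg₂

theorem isBigOP_mmdHat_diff_sub :
    IsBigOP μ evenAtTop (fun n ω => mmdHat k F (αn n ω) n (fun i => (X i ω, U i ω))
        - mmdHat k G (βn n ω) n (fun i => (X i ω, V i ω))
        - (mmdSq k (modelLaw F PU αs) P - mmdSq k (modelLaw G PV βs) P))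
      (fun n => (√(n : ℝ))⁻¹) := by
  have h1 := isBigOP_mmdHat_sub hk hreg₁ hd₁ hr₁ hs.sample_fst hα
  have h2 := isBigOP_mmdHat_sub hk hreg₂ hd₂ hr₂ hs.sample_snd hβ
  refine (h1.sub h2).of_ae_norm_le (Eventually.of_forall fun n => ae_of_all _ fun ω => le_of_eq ?_)
  congr 1
  ring

theorem tendstoInMeasure_sigmaHatSq :
    TendstoInMeasure μ (fun n ω => sigmaHatSq k F G (αn n ω) (βn n ω) n
      (fun i => (X i ω, U i ω, V i ω))) evenAtTop (fun _ => sigmaSq k F G αs βs ρ) := by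
  obtain ⟨C, hC⟩ := hk.bounded
  have hF := hreg₁.measurable_at hreg₁.mem
  have hG := hreg₂.measurable_at hreg₂.mem
  have hm := measurable_hDiff hk hF hG
  have h1 := hs.sample.isBigOP_ustat₃_sub tendsto_evenAtTop 4 hm (abs_hDiff_le hC)
    (fun n ω => abs_hDiff_le hC) (isBigOP_sqDist_hDiff hk hs hd₁ hd₂ hr₁ hr₂ hα hβ)
  have h2 := (isBigOP_mmdHat_diff_sub hk hs hreg₁ hreg₂ hd₁ hd₂ hr₁ hr₂ hα hβ).sq_sub_sq
    tendsto_evenAtTop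
  refine IsBigOP.tendstoInMeasure_const (r := fun n => (√(n : ℝ))⁻¹) ?_
    (tendsto_inv_sqrt tendsto_evenAtTop)
  refine (h1.sub (h2.const_mul 4)).of_ae_norm_le
    (Eventually.of_forall fun n => ae_of_all _ fun ω => le_of_eq ?_)
  congr 1
  rw [sigmaSq, variance_const_mul_proj hm (abs_hDiff_le hC), integral_hDiff hk hF hG hs]
  simp only [sigmaHatSq, gDiff, fstModel, sndModel]
  ring

theorem tendstoInMeasure_sigmaHatSqSplit :
    TendstoInMeasure μ (fun n ω => sigmaHatSqSplit k F G (αn n ω) (βn n ω) n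
      (fun i => (X i ω, U i ω, V i ω))) evenAtTop (fun _ => sigmaSqSplit k F G αs βs ρ) := by
  obtain ⟨C, hC⟩ := hk.bounded
  have hF := hreg₁.measurable_at hreg₁.mem
  have hG := hreg₂.measurable_at hreg₂.mem
  have hm := measurable_qDiff hk hF hG
  have h1 := hs.sample.pairs.isBigOP_ustat₃_sub tendsto_half_evenAtTop 8 hm (abs_qDiff_le hC)
    (fun n ω => abs_qDiff_le hC) (isBigOP_sqDist_qDiff hk hs hd₁ hd₂ hr₁ hr₂ hα hβ)
  -- The subtracted square is computed from the full sample, so its rate in n is converted into one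
  -- in n / 2.
  have h2 := sqrt_half_rate <| (isBigOP_mmdHat_diff_sub hk hs hreg₁ hreg₂ hd₁ hd₂ hr₁ hr₂ hα
    hβ).sq_sub_sq tendsto_evenAtTop
  refine IsBigOP.tendstoInMeasure_const (r := fun n => (√((n / 2 : ℕ) : ℝ))⁻¹) ?_
    (tendsto_inv_sqrt tendsto_half_evenAtTop)
  refine (h1.sub (h2.const_mul 8)).of_ae_norm_le
    (Eventually.of_forall fun n => ae_of_all _ fun ω => le_of_eq ?_)
  congr 1
  rw [sigmaSqSplit, variance_const_mul_proj hm (abs_qDiff_le hC), integral_qDiff hk hF hG hs,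
    mul_pow, Real.sq_sqrt zero_le_two]
  simp only [sigmaHatSqSplit, xiDiff, fstModel, sndModel]
  unfold pairs
  ring

theorem isBigOP_mmdHat_diff_of_modelLaw_eq (hFP : modelLaw F PU αs = P)
    (hGP : modelLaw G PV βs = P) :
    IsBigOP μ evenAtTop (fun n ω => mmdHat k F (αn n ω) n (fun i => (X i ω, U i ω))
        - mmdHat k G (βn n ω) n (fun i => (X i ω, V i ω))) (fun n => (n : ℝ)⁻¹) :=
  (isBigOP_mmdHat_of_modelLaw_eq hk hreg₁ hd₁ hr₁ hs.sample_fst hα hFP).sub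
    (isBigOP_mmdHat_of_modelLaw_eq hk hreg₂ hd₂ hr₂ hs.sample_snd hβ hGP)

theorem isBigOP_sigmaHatSq_of_modelLaw_eq (hFP : modelLaw F PU αs = P)
    (hGP : modelLaw G PV βs = P) :
    IsBigOP μ evenAtTop (fun n ω => sigmaHatSq k F G (αn n ω) (βn n ω) n
      (fun i => (X i ω, U i ω, V i ω))) (fun n => (n : ℝ)⁻¹) := by
  obtain ⟨C, hC⟩ := hk.bounded
  have hF := hreg₁.measurable_at hreg₁.mem
  have hG := hreg₂.measurable_at hreg₂.mem
  have h1 := hs.sample.isBigOP_ustat₃_of_degenerate tendsto_evenAtTop 4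
    (measurable_hDiff hk hF hG) (abs_hDiff_le hC)
    (fun n ω => abs_hDiff_le hC) (isBigOP_sqDist_hDiff hk hs hd₁ hd₂ hr₁ hr₂ hα hβ)
    (integral_hDiff_right_eq_zero hk hF hG hs hFP hGP)
  have hdn := isBigOP_mmdHat_diff_of_modelLaw_eq hk hs hreg₁ hreg₂ hd₁ hd₂ hr₁ hr₂ hα hβ hFP hGP
  have h2 := (hdn.mul (fun n => by positivity) (fun n => by positivity) hdn).mono_rate
    (s := fun n => (n : ℝ)⁻¹) (fun n => by positivity) (by
      filter_upwards [tendsto_evenAtTop.eventually_ge_atTop 1] with n hn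
      exact mul_le_of_le_one_left (by positivity) (inv_le_one_of_one_le₀ (by exact_mod_cast hn)))
  refine (h1.sub (h2.const_mul 4)).of_ae_norm_le
    (Eventually.of_forall fun n => ae_of_all _ fun ω => le_of_eq ?_)
  congr 1
  simp only [sigmaHatSq, gDiff, fstModel, sndModel]
  ring

omit hd₁ hd₂ hr₁ hr₂ hα hβ in
theorem sigmaSq_eq_zero_of_modelLaw_eq (hFP : modelLaw F PU αs = P)
    (hGP : modelLaw G PV βs = P) : sigmaSq k F G αs βs ρ = 0 := by
  have hF := hreg₁.measurable_at hreg₁.mem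
  have hG := hreg₂.measurable_at hreg₂.mem
  simp only [sigmaSq, integral_hDiff_right_eq_zero hk hF hG hs hFP hGP, mul_zero]
  exact variance_zero ρ

end TwoModels

/-! ### Limit laws -/

section Limits

variable {Ω Ω' : Type*} [MeasurableSpace Ω] [MeasurableSpace Ω'] {μ : Measure Ω}
  [IsProbabilityMeasure μ] {μ' : Measure Ω'} [IsProbabilityMeasure μ']

/-- Limit law of the difference of two estimators that are linear in the estimated parameters,
up to `O(1 / n)`. -/
theorem tendstoInDistribution_plugIn {E E' : Type*} [NormedAddCommGroup E] [NormedSpace ℝ E]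
    [NormedAddCommGroup E'] [NormedSpace ℝ E'] {p p' : Prop} {D : E →L[ℝ] ℝ} {D' : E' →L[ℝ] ℝ}
    (hD : ∀ v, D (zeroIf p v) = D v) (hD' : ∀ v, D' (zeroIf p' v) = D' v)
    {a b a₀ b₀ : ℕ → Ω → ℝ} {M M' : ℝ} {e : ℕ → Ω → E} {e' : ℕ → Ω → E'} {L : Ω' → ℝ}
    (hlim : TendstoInDistribution (fun (n : ℕ) ω => √n * (a₀ n ω - M) - √n * (b₀ n ω - M')
      + D (zeroIf p (√n • e n ω)) - D' (zeroIf p' (√n • e' n ω))) evenAtTop L (fun _ => μ) μ')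
    (ha : IsBigOP μ evenAtTop (fun n ω => a n ω - a₀ n ω - D (e n ω)) (fun n => (n : ℝ)⁻¹))
    (hb : IsBigOP μ evenAtTop (fun n ω => b n ω - b₀ n ω - D' (e' n ω)) (fun n => (n : ℝ)⁻¹))
    (ham : ∀ n, Measurable (a n)) (hbm : ∀ n, Measurable (b n)) :
    TendstoInDistribution (fun (n : ℕ) ω => √n * (a n ω - M - b n ω + M')) evenAtTop L
      (fun _ => μ) μ' := by
  refine tendstoInDistribution_of_isBigOP_sub hlim
    (fun n => ((((ham n).sub_const M).sub (hbm n)).add_const M').const_mul _ |>.aemeasurable)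
    (tendsto_inv_sqrt tendsto_evenAtTop) ?_
  -- After the linear terms cancel, √n times the two remainders of order 1 / n is left.
  refine (ha.sub hb).sqrt_mul.of_ae_norm_le
    (Eventually.of_forall fun n => ae_of_all _ fun ω => le_of_eq ?_)
  congr 1
  rw [hD, hD', map_smul, map_smul, smul_eq_mul, smul_eq_mul]
  ring

variable {S 𝒰 𝒱 E E' : Type*} [MeasurableSpace S] [MeasurableSpace 𝒰] [MeasurableSpace 𝒱]
  {X : ℕ → Ω → S} {U : ℕ → Ω → 𝒰} {V : ℕ → Ω → 𝒱}
  {ρ : Measure (S × 𝒰 × 𝒱)} {P : Measure S} {PU : Measure 𝒰} {PV : Measure 𝒱}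
  [IsProbabilityMeasure ρ] [IsProbabilityMeasure P] [IsProbabilityMeasure PU]
  [IsProbabilityMeasure PV] {k : S → S → ℝ} {F : 𝒰 → E → S} {G : 𝒱 → E' → S} {α : E} {β : E'}
  {L : Ω' → ℝ}

/-- The convergence to L is given, so its law is read off from the central limit theorem by
uniqueness of limits. Applying the theorem to the single kernel `hDiff` takes care of the dependence
between the two estimators, which share the data. -/
theorem hasLaw_of_tendstoInDistribution_mmdHat (hk : CharacteristicKernel k)
    (hF : Measurable fun u => F u α) (hG : Measurable fun v => G v β)
    (hs : Sampling μ X U V ρ P PU PV)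
    (h : TendstoInDistribution (fun (n : ℕ) ω =>
      √n * (mmdHat k F α n (fun i => (X i ω, U i ω)) - mmdSq k (modelLaw F PU α) P)
        - √n * (mmdHat k G β n (fun i => (X i ω, V i ω)) - mmdSq k (modelLaw G PV β) P))
      evenAtTop L (fun _ => μ) μ') :
    HasLaw L (gaussianReal 0 (sigmaSq k F G α β ρ).toNNReal) μ' := by
  obtain ⟨C, hC⟩ := hk.bounded
  have hclt := hs.sample.tendstoInDistribution_ustat₂ tendsto_evenAtTop
    (measurable_hDiff hk hF hG) (abs_hDiff_le hC) (hDiff_symm hk)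
  rw [integral_hDiff hk hF hG hs] at hclt
  have heq : (fun (n : ℕ) ω => √(n : ℝ) * (ustat₂ (hDiff k F G α β) n
      (fun i => (X i ω, U i ω, V i ω))
      - (mmdSq k (modelLaw F PU α) P - mmdSq k (modelLaw G PV β) P)))
      = fun (n : ℕ) ω =>
      √n * (mmdHat k F α n (fun i => (X i ω, U i ω)) - mmdSq k (modelLaw F PU α) P)
        - √n * (mmdHat k G β n (fun i => (X i ω, V i ω)) - mmdSq k (modelLaw G PV β) P) := by
    ext n ω
    rw [ustat₂_hDiff]
    simp only [fstModel, sndModel]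
    ring
  rw [heq] at hclt
  refine ⟨h.aemeasurable_limit, ?_⟩
  rw [tendstoInDistribution_unique _ h hclt, Measure.map_id]
  rfl

theorem hasLaw_of_tendstoInDistribution_mmdHatSplit (hk : CharacteristicKernel k)
    (hF : Measurable fun u => F u α) (hG : Measurable fun v => G v β)
    (hs : Sampling μ X U V ρ P PU PV)
    (h : TendstoInDistribution (fun (n : ℕ) ω =>
      √n * (mmdHatSplit k F α n (fun i => (X i ω, U i ω)) - mmdSq k (modelLaw F PU α) P)
        - √n * (mmdHatSplit k G β n (fun i => (X i ω, V i ω)) - mmdSq k (modelLaw G PV β) P))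
      evenAtTop L (fun _ => μ) μ') :
    HasLaw L (gaussianReal 0 (sigmaSqSplit k F G α β ρ).toNNReal) μ' := by
  obtain ⟨C, hC⟩ := hk.bounded
  -- The sample of pairs has size n / 2; since √n = √2 √(n / 2), the kernel is multiplied by √2,
  -- which turns the factor 2 of the projection into 2√2.
  have hclt := hs.sample.pairs.tendstoInDistribution_ustat₂ tendsto_half_evenAtTop
    (f := fun a b => √2 * qDiff k F G α β a b) (C := √2 * (8 * C))
    ((measurable_qDiff hk hF hG).const_mul _)
    (fun a b => by
      rw [abs_mul, abs_of_nonneg (Real.sqrt_nonneg _)]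
      exact mul_le_mul_of_nonneg_left (abs_qDiff_le hC a b) (Real.sqrt_nonneg _))
    (fun a b => by rw [qDiff_symm hk])
  simp only [integral_const_mul, ustat₂_const_mul] at hclt
  rw [integral_qDiff hk hF hG hs] at hclt
  -- For even n the two sequences are equal, hence the constant 0. They may differ for odd n, where
  -- n / 2 is rounded down, but `evenAtTop` ignores those.
  have hclt' := tendstoInDistribution_of_isBigOP_sub (r := fun n : ℕ => (√(n : ℝ))⁻¹) hclt
    h.forall_aemeasurable (tendsto_inv_sqrt tendsto_evenAtTop)
    (isBigOP_of_norm_le (C := 0) (eventually_eq_two_mul_half.mono fun n hn ω => by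
      have e := ustat₂_qDiff (k := k) (F := F) (G := G) (α := α) (β := β) n
        (fun i => (X i ω, U i ω, V i ω))
      simp only [fstModel, sndModel] at e
      unfold pairs at e
      rw [zero_mul, norm_le_zero_iff, e, hn, Real.sqrt_mul zero_le_two]
      ring))
  refine ⟨h.aemeasurable_limit, ?_⟩
  rw [tendstoInDistribution_unique _ h hclt', Measure.map_id, sigmaSqSplit]
  simp only [mul_assoc]

end Limits

end MMDComparison

/-! ### The comparison theorem -/

theorem mainTheorem6
    {Ω Ω' S 𝒰 𝒱 : Type*} [MeasurableSpace Ω] [MeasurableSpace Ω'] [MeasurableSpace S]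
    [MeasurableSpace 𝒰] [MeasurableSpace 𝒱]
    (μ : Measure Ω) [IsProbabilityMeasure μ] (μ' : Measure Ω') [IsProbabilityMeasure μ']
    (P : Measure S) [IsProbabilityMeasure P]
    (PU : Measure 𝒰) [IsProbabilityMeasure PU] (PV : Measure 𝒱) [IsProbabilityMeasure PV]
    (ρ : Measure (S × 𝒰 × 𝒱)) [IsProbabilityMeasure ρ]
    {p₁ p₂ : ℕ}
    -- the kernel, the data and the random inputs of the two generators
    (k : S → S → ℝ) (hk : MMDComparison.CharacteristicKernel k)
    (X : ℕ → Ω → S) (U : ℕ → Ω → 𝒰) (V : ℕ → Ω → 𝒱)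
    (hsample : MMDComparison.Sampling μ X U V ρ P PU PV)
    -- the two models
    (Θ₁ : Set (EuclideanSpace ℝ (Fin p₁))) (Θ₂ : Set (EuclideanSpace ℝ (Fin p₂)))
    (F : 𝒰 → EuclideanSpace ℝ (Fin p₁) → S) (G : 𝒱 → EuclideanSpace ℝ (Fin p₂) → S)
    (αs : EuclideanSpace ℝ (Fin p₁)) (βs : EuclideanSpace ℝ (Fin p₂))
    (hreg₁ : MMDComparison.RegularModel k P PU F Θ₁ αs)
    (hreg₂ : MMDComparison.RegularModel k P PV G Θ₂ βs)
    (hdiff₁ : MMDComparison.DiffGenerator k F Θ₁)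
    (hdiff₂ : MMDComparison.DiffGenerator k G Θ₂)
    (hres₁ : MMDComparison.ResidualDeriv k P PU F Θ₁ αs)
    (hres₂ : MMDComparison.ResidualDeriv k P PV G Θ₂ βs)
    -- the estimated parameters
    (αn : ℕ → Ω → EuclideanSpace ℝ (Fin p₁)) (βn : ℕ → Ω → EuclideanSpace ℝ (Fin p₂))
    (hαn : ∀ n, Measurable (αn n)) (hβn : ∀ n, Measurable (βn n))
    (hαΘ : ∀ n ω, αn n ω ∈ Θ₁) (hβΘ : ∀ n ω, βn n ω ∈ Θ₂)
    -- joint weak convergence; the component of an estimated parameter is dropped, and replaced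
    -- by stochastic boundedness, if the parameter that it estimates minimizes the MMD
    (Z₁ Z₂ Zq₁ Zq₂ : Ω' → ℝ)
    (V₁ : Ω' → EuclideanSpace ℝ (Fin p₁)) (V₂ : Ω' → EuclideanSpace ℝ (Fin p₂))
    (hjoint : TendstoInDistribution
      (fun (n : ℕ) ω =>
        (√n * (MMDComparison.mmdHat k F αs n (fun i => (X i ω, U i ω))
            - MMDComparison.mmdSq k (MMDComparison.modelLaw F PU αs) P),
         √n * (MMDComparison.mmdHat k G βs n (fun i => (X i ω, V i ω))
            - MMDComparison.mmdSq k (MMDComparison.modelLaw G PV βs) P),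
         √n * (MMDComparison.mmdHatSplit k F αs n (fun i => (X i ω, U i ω))
            - MMDComparison.mmdSq k (MMDComparison.modelLaw F PU αs) P),
         √n * (MMDComparison.mmdHatSplit k G βs n (fun i => (X i ω, V i ω))
            - MMDComparison.mmdSq k (MMDComparison.modelLaw G PV βs) P),
         MMDComparison.zeroIf (MMDComparison.Minimizes k P PU F Θ₁ αs)
           (√n • (αn n ω - αs)),
         MMDComparison.zeroIf (MMDComparison.Minimizes k P PV G Θ₂ βs)
           (√n • (βn n ω - βs))))
      MMDComparison.evenAtTop
      (fun ω' => (Z₁ ω', Z₂ ω', Zq₁ ω', Zq₂ ω',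
        MMDComparison.zeroIf (MMDComparison.Minimizes k P PU F Θ₁ αs) (V₁ ω'),
        MMDComparison.zeroIf (MMDComparison.Minimizes k P PV G Θ₂ βs) (V₂ ω')))
      (fun _ => μ) μ')
    (hαO : MMDComparison.Minimizes k P PU F Θ₁ αs →
      MMDComparison.IsBigOP μ MMDComparison.evenAtTop
        (fun n ω => √n • (αn n ω - αs)) (fun _ => 1))
    (hβO : MMDComparison.Minimizes k P PV G Θ₂ βs →
      MMDComparison.IsBigOP μ MMDComparison.evenAtTop
        (fun n ω => √n • (βn n ω - βs)) (fun _ => 1)) :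
    -- (i)
    (TendstoInDistribution
        (fun (n : ℕ) ω =>
          √n * (MMDComparison.mmdHat k F (αn n ω) n (fun i => (X i ω, U i ω))
            - MMDComparison.mmdSq k (MMDComparison.modelLaw F PU αs) P
            - MMDComparison.mmdHat k G (βn n ω) n (fun i => (X i ω, V i ω))
            + MMDComparison.mmdSq k (MMDComparison.modelLaw G PV βs) P))
        MMDComparison.evenAtTop
        (fun ω' => (Z₁ ω' - Z₂ ω')
          + fderiv ℝ (fun α => MMDComparison.mmdSq k (MMDComparison.modelLaw F PU α) P) αs (V₁ ω')
          - fderiv ℝ (fun β => MMDComparison.mmdSq k (MMDComparison.modelLaw G PV β) P) βs (V₂ ω'))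
        (fun _ => μ) μ' ∧
      HasLaw (fun ω' => Z₁ ω' - Z₂ ω')
        (gaussianReal 0 (MMDComparison.sigmaSq k F G αs βs ρ).toNNReal) μ' ∧
      TendstoInMeasure μ
        (fun n ω => MMDComparison.sigmaHatSq k F G (αn n ω) (βn n ω) n
          (fun i => (X i ω, U i ω, V i ω)))
        MMDComparison.evenAtTop (fun _ => MMDComparison.sigmaSq k F G αs βs ρ)) ∧
    -- (ii)
    (MMDComparison.modelLaw F PU αs = P → MMDComparison.modelLaw G PV βs = P →
      MMDComparison.sigmaSq k F G αs βs ρ = 0 ∧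
      MMDComparison.IsBigOP μ MMDComparison.evenAtTop
        (fun n ω => MMDComparison.sigmaHatSq k F G (αn n ω) (βn n ω) n
          (fun i => (X i ω, U i ω, V i ω)))
        (fun n => (n : ℝ)⁻¹) ∧
      MMDComparison.IsBigOP μ MMDComparison.evenAtTop
        (fun (n : ℕ) ω =>
          √n * (MMDComparison.mmdHat k F (αn n ω) n (fun i => (X i ω, U i ω))
            - MMDComparison.mmdHat k G (βn n ω) n (fun i => (X i ω, V i ω))))
        (fun n => (√n)⁻¹)) ∧
    -- (iii)
    (TendstoInDistribution
        (fun (n : ℕ) ω =>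
          √n * (MMDComparison.mmdHatSplit k F (αn n ω) n (fun i => (X i ω, U i ω))
            - MMDComparison.mmdSq k (MMDComparison.modelLaw F PU αs) P
            - MMDComparison.mmdHatSplit k G (βn n ω) n (fun i => (X i ω, V i ω))
            + MMDComparison.mmdSq k (MMDComparison.modelLaw G PV βs) P))
        MMDComparison.evenAtTop
        (fun ω' => (Zq₁ ω' - Zq₂ ω')
          + fderiv ℝ (fun α => MMDComparison.mmdSq k (MMDComparison.modelLaw F PU α) P) αs (V₁ ω')
          - fderiv ℝ (fun β => MMDComparison.mmdSq k (MMDComparison.modelLaw G PV β) P) βs (V₂ ω'))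
        (fun _ => μ) μ' ∧
      HasLaw (fun ω' => Zq₁ ω' - Zq₂ ω')
        (gaussianReal 0 (MMDComparison.sigmaSqSplit k F G αs βs ρ).toNNReal) μ' ∧
      (IndepFun (fun ω i => U i ω) (fun ω i => V i ω) μ →
        (P ≪ MMDComparison.modelLaw F PU αs ∨ P ≪ MMDComparison.modelLaw G PV βs ∨
          ¬ (MMDComparison.AEConst (MMDComparison.meanEmbed k P)
                (MMDComparison.modelLaw F PU αs) ∧
             MMDComparison.AEConst (MMDComparison.meanEmbed k P)
                (MMDComparison.modelLaw G PV βs) ∧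
             MMDComparison.AEConst (MMDComparison.meanEmbed k (MMDComparison.modelLaw F PU αs))
                (MMDComparison.modelLaw F PU αs) ∧
             MMDComparison.AEConst (MMDComparison.meanEmbed k (MMDComparison.modelLaw G PV βs))
                (MMDComparison.modelLaw G PV βs) ∧
             MMDComparison.AEConst
                (fun x => MMDComparison.meanEmbed k (MMDComparison.modelLaw F PU αs) x
                  - MMDComparison.meanEmbed k (MMDComparison.modelLaw G PV βs) x) P)) →
        0 < MMDComparison.sigmaSqSplit k F G αs βs ρ) ∧
      TendstoInMeasure μ
        (fun n ω => MMDComparison.sigmaHatSqSplit k F G (αn n ω) (βn n ω) n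
          (fun i => (X i ω, U i ω, V i ω)))
        MMDComparison.evenAtTop (fun _ => MMDComparison.sigmaSqSplit k F G αs βs ρ)) := by
  have hF := hreg₁.measurable_at hreg₁.mem
  have hG := hreg₂.measurable_at hreg₂.mem
  have hα_law := hjoint.continuous_comp (g := fun
    z : ℝ × ℝ × ℝ × ℝ × EuclideanSpace ℝ (Fin p₁) × EuclideanSpace ℝ (Fin p₂) => z.2.2.2.2.1) (by fun_prop)
  have hβ_law := hjoint.continuous_comp (g := fun
    z : ℝ × ℝ × ℝ × ℝ × EuclideanSpace ℝ (Fin p₁) × EuclideanSpace ℝ (Fin p₂) => z.2.2.2.2.2) (by fun_prop)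
  -- The rate n^(-1/2) of the parameter comes from tightness of the convergent component, or from
  -- `hαO` at a minimizer.
  have hα : MMDComparison.IsBigOP μ MMDComparison.evenAtTop (fun n ω => αn n ω - αs)
      (fun n => (√(n : ℝ))⁻¹) :=
    MMDComparison.IsBigOP.of_sqrt_smul MMDComparison.tendsto_evenAtTop <|
      MMDComparison.IsBigOP.of_zeroIf (MMDComparison.isBigOP_one_of_tendstoInDistribution
        hα_law) hαO
  have hβ : MMDComparison.IsBigOP μ MMDComparison.evenAtTop (fun n ω => βn n ω - βs)
      (fun n => (√(n : ℝ))⁻¹) :=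
    MMDComparison.IsBigOP.of_sqrt_smul MMDComparison.tendsto_evenAtTop <|
      MMDComparison.IsBigOP.of_zeroIf (MMDComparison.isBigOP_one_of_tendstoInDistribution
        hβ_law) hβO
  have hD₁ := MMDComparison.fderiv_zeroIf hreg₁
  have hD₂ := MMDComparison.fderiv_zeroIf hreg₂
  refine ⟨⟨?_, ?_, ?_⟩, fun hFP hGP => ⟨?_, ?_, ?_⟩, ?_, ?_, ?_, ?_⟩
  -- Continuous mapping applied to the joint limit gives the law of the linearized statistic, from
  -- which the plug-in statistic differs by `O_ℙ(n^(-1/2))`.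
  · have hlim := hjoint.continuous_comp (g := fun
      z : ℝ × ℝ × ℝ × ℝ × EuclideanSpace ℝ (Fin p₁) × EuclideanSpace ℝ (Fin p₂) =>
      z.1 - z.2.1
      + fderiv ℝ (fun α => MMDComparison.mmdSq k (MMDComparison.modelLaw F PU α) P) αs z.2.2.2.2.1
      - fderiv ℝ (fun β => MMDComparison.mmdSq k (MMDComparison.modelLaw G PV β) P) βs
        z.2.2.2.2.2) (by fun_prop)
    have h := MMDComparison.tendstoInDistribution_plugIn hD₁ hD₂ hlim
      (MMDComparison.isBigOP_mmdHat_sub_sub hk hreg₁ hdiff₁ hres₁ hsample.sample_fst hα)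
      (MMDComparison.isBigOP_mmdHat_sub_sub hk hreg₂ hdiff₂ hres₂ hsample.sample_snd hβ)
      (fun n => MMDComparison.measurable_mmdHat hk hreg₁ hsample.measurable_X
        hsample.measurable_U (hαn n) (hαΘ n) n)
      (fun n => MMDComparison.measurable_mmdHat hk hreg₂ hsample.measurable_X
        hsample.measurable_V (hβn n) (hβΘ n) n)
    simpa only [Function.comp_def, hD₁, hD₂] using h
  · exact MMDComparison.hasLaw_of_tendstoInDistribution_mmdHat hk hF hG hsample
      (hjoint.continuous_comp (g := fun
      z : ℝ × ℝ × ℝ × ℝ × EuclideanSpace ℝ (Fin p₁) × EuclideanSpace ℝ (Fin p₂) =>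
      z.1 - z.2.1) (by fun_prop))
  · exact MMDComparison.tendstoInMeasure_sigmaHatSq hk hsample hreg₁ hreg₂ hdiff₁ hdiff₂ hres₁
      hres₂ hα hβ
  · exact MMDComparison.sigmaSq_eq_zero_of_modelLaw_eq hk hsample hreg₁ hreg₂ hFP hGP
  · exact MMDComparison.isBigOP_sigmaHatSq_of_modelLaw_eq hk hsample hreg₁ hreg₂ hdiff₁ hdiff₂
      hres₁ hres₂ hα hβ hFP hGP
  · exact (MMDComparison.isBigOP_mmdHat_diff_of_modelLaw_eq hk hsample hreg₁ hreg₂ hdiff₁ hdiff₂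
      hres₁ hres₂ hα hβ hFP hGP).sqrt_mul
  · have hlim := hjoint.continuous_comp (g := fun
      z : ℝ × ℝ × ℝ × ℝ × EuclideanSpace ℝ (Fin p₁) × EuclideanSpace ℝ (Fin p₂) =>
      z.2.2.1 - z.2.2.2.1
      + fderiv ℝ (fun α => MMDComparison.mmdSq k (MMDComparison.modelLaw F PU α) P) αs z.2.2.2.2.1
      - fderiv ℝ (fun β => MMDComparison.mmdSq k (MMDComparison.modelLaw G PV β) P) βs
        z.2.2.2.2.2) (by fun_prop)
    have h := MMDComparison.tendstoInDistribution_plugIn hD₁ hD₂ hlim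
      (MMDComparison.isBigOP_mmdHatSplit_sub_sub hk hreg₁ hdiff₁ hres₁ hsample.sample_fst hα)
      (MMDComparison.isBigOP_mmdHatSplit_sub_sub hk hreg₂ hdiff₂ hres₂ hsample.sample_snd hβ)
      (fun n => MMDComparison.measurable_mmdHatSplit hk hreg₁ hsample.measurable_X
        hsample.measurable_U (hαn n) (hαΘ n) n)
      (fun n => MMDComparison.measurable_mmdHatSplit hk hreg₂ hsample.measurable_X
        hsample.measurable_V (hβn n) (hβΘ n) n)
    simpa only [Function.comp_def, hD₁, hD₂] using h
  · exact MMDComparison.hasLaw_of_tendstoInDistribution_mmdHatSplit hk hF hG hsample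
      (hjoint.continuous_comp (g := fun
      z : ℝ × ℝ × ℝ × ℝ × EuclideanSpace ℝ (Fin p₁) × EuclideanSpace ℝ (Fin p₂) =>
      z.2.2.1 - z.2.2.2.1) (by fun_prop))
  · intro hUV hcase
    refine lt_of_le_of_ne (variance_nonneg _ _) fun h0 => ?_
    have hconst := MMDComparison.aeConst_of_sigmaSqSplit_eq_zero hk hF hG hsample hUV h0.symm
    -- Vanishing variance would make all five mean embedding variables constant. Absolute continuity
    -- with respect to one model is contradicted by the constancy of that model's own mean
    -- embedding.
    rcases hcase with hac | hac | hne
    · exact hreg₁.not_aeConst_modelLaw hk hac hconst.2.2.1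
    · exact hreg₂.not_aeConst_modelLaw hk hac hconst.2.2.2.1
    · exact hne hconst
  · exact MMDComparison.tendstoInMeasure_sigmaHatSqSplit hk hsample hreg₁ hreg₂ hdiff₁ hdiff₂
      hres₁ hres₂ hα hβ
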